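/- **Setting.** For $A\in\mathbb R^{m\times n}$ (rows are data points) and $k\ge 1$, a cluster indicator matrix is $X\in\mathbb R^{m\times k}$ for which there is a partition of the $m$ points into $k$ non-empty clusters $S_1,\dots,S_k$ with $X_{ij}=1/\sqrt{|S_j|}$ if point $i$ lies in $S_j$ and $X_{ij}=0$ otherwise. Put $\mathrm F_{\mathrm{opt}}(A)=\min_X\|A-XX^{\mathsf T}A\|_F^2$. A randomized algorithm that returns an indicator matrix is a $\gamma$-approximation ($\gamma\ge1$) with failure probability $\delta_\gamma$ if on every input $B$, with probability at least $1-\delta_\gamma$, its output $X$ satisfies $\|B-XX^{\mathsf T}B\|_F^2\le\gamma\,\mathrm F_{\mathrm{opt}}(B)$. **Algorithm (feature selection)** with inputs $A\in\mathbb R^{m\times n}$, $k$, $\varepsilon\in(0,1/3)$ and a constant $c_1$: 1. (FastFrobeniusSVD) Let $s=k+\lceil k/\varepsilon+1\rceil$, let $R\in\mathbb R^{n\times s}$ have i.i.d. $\mathcal N(0,1)$ entries, compute $Y=AR$, let the columns of $Q$ be an orthonormal basis of the column space of $Y$ (Gram–Schmidt), and let the columns of $Z\in\mathbb R^{n\times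 k}$ be the top $k$ right singular vectors of $Q^{\mathsf T}A$. 2. Let $r=\lceil c_1\cdot 4k\ln(200k)/\varepsilon^2\rceil$. 3. Put $p_i=\|Z_{(i)}\|_2^2/\|Z\|_F^2$, where $Z_{(i)}$ is the $i$-th row of $Z$. Independently for $t=1,\dots,r$ pick $i_t\in\{1,\dots,n\}$ with $\Pr(i_t=i)=p_i$; let $\Omega=[e_{i_1},\dots,e_{i_r}]\in\mathbb R^{n\times r}$ and let $S\in\mathbb R^{r\times r}$ be diagonal with $S_{tt}=1/\sqrt{r\,p_{i_t}}$. 4. Return $C=A\Omega S\in\mathbb R^{m\times r}$, which consists of $r$ rescaled columns of $A$. **Theorem.** For every sufficiently large absolute constant $c_1$ there is a constant $K>0$ such that for all $m,n$, all $k$ with $2\le k\le\min\{m,n\}$, all $A\in\mathbb R^{m\times n}$ and all $\varepsilon\in(0,1/3)$ the following hold for the algorithm above. * *Number of features.* $0<r\le K\,k\ln(k)/\varepsilon^2$. * *Running time.* In the real random-access machine model (unit cost for an arithmetic operation, square root, comparison or random draw; $pq\min\{p,q\}$ steps for a singular value decomposition of a $p\times q$ matrix, plus $qk^2$ for completing to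 $k$ vectors), an implementation with Gram–Schmidt orthonormalization and with sampling by binary search in the partial sums of the $p_i$ performs steps 1–3 (that is, it computes all $i_t$ and $S_{tt}$) in at most $$K\Bigl(\frac{mnk}{\varepsilon}+\frac{k\ln k}{\varepsilon^2}\,\ln\frac{k\ln k}{\varepsilon}\Bigr)$$ steps, whatever the random outcomes. If $r\le n$, the same bound holds for the whole algorithm, including writing down the $m\times r$ matrix $C$. * *Features.* In that implementation, conditionally on $R$, the indices $i_1,\dots,i_r$ are independent with $\Pr(i_t=i)=p_i$, the rescaling factors are $S_{tt}=1/\sqrt{r\,p_{i_t}}$, and the output is $C=A\Omega S$. * *Quality.* Run any $\gamma$-approximation k-means algorithm, with $\gamma\ge 1$ and failure probability $\delta_\gamma$, on $C$ and $k$, and let $X_{\tilde\gamma}$ be its output. Then, with probability at least $0.2-\delta_\gamma$, $$\|A-X_{\tilde\gamma}X_{\tilde\gamma}^{\mathsf T}A\|_F^2\le\bigl(1+(2+\varepsilon)\gamma\bigr)\,\mathrm F_{\mathrm{opt}}(A).$$ -/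

import Mathlib

open MeasureTheory ProbabilityTheory
open scoped BigOperators ENNReal

noncomputable section

namespace KMeans

/-! ### The k-means problem -/

/-- The squared Frobenius norm. -/
def frobSq {m n : ℕ} (M : Matrix (Fin m) (Fin n) ℝ) : ℝ := ∑ i, ∑ j, M i j ^ 2

/-- `X` is the cluster indicator matrix of a partition of `m` points into `k` non-empty clusters:
`f i` is the cluster of the point `i`, and `X i j = 1 / √(size of cluster j)` exactly if `i` lies
in cluster `j`. -/
def IsIndicatorMatrix {m k : ℕ} (X : Matrix (Fin m) (Fin k) ℝ) : Prop :=
  ∃ f : Fin m → Fin k, Function.Surjective f ∧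
    ∀ i j, X i j =
      if f i = j then 1 / √((Finset.univ.filter fun i' => f i' = j).card : ℝ) else 0

/-- The set of all `m × k` cluster indicator matrices (a finite set). -/
abbrev IndicatorMatrix (m k : ℕ) : Type :=
  {X : Matrix (Fin m) (Fin k) ℝ // IsIndicatorMatrix X}

/-- The k-means objective `‖A - X Xᵀ A‖_F²`; the rows of `A` are the points. -/
def cost {m n k : ℕ} (A : Matrix (Fin m) (Fin n) ℝ) (X : Matrix (Fin m) (Fin k) ℝ) : ℝ :=
  frobSq (A - X * X.transpose * A)

/-- The optimal value of the k-means objective: a minimum over a finite set, which is non-empty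
if `1 ≤ k ≤ m`. -/
def optCost {m n : ℕ} (A : Matrix (Fin m) (Fin n) ℝ) (k : ℕ) : ℝ :=
  ⨅ X : IndicatorMatrix m k, cost A X.1

/-- A randomized k-means algorithm, on inputs of `m` points with `n` features and for `k` clusters:
to every data matrix it assigns the distribution of the indicator matrix that it returns. -/
abbrev ClusteringAlgorithm (m n k : ℕ) : Type :=
  Matrix (Fin m) (Fin n) ℝ → PMF (IndicatorMatrix m k)

/-- `alg` is a `γ`-approximation algorithm for k-means with failure probability at most `δ`. -/
def IsApproximation {m n k : ℕ} (alg : ClusteringAlgorithm m n k) (γ δ : ℝ) : Prop :=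
  1 ≤ γ ∧ ∀ B : Matrix (Fin m) (Fin n) ℝ,
    ENNReal.ofReal (1 - δ) ≤
      (alg B).toOuterMeasure {X | cost B X.1 ≤ γ * optCost B k}

/-! ### Programs with a step count

A computation of the real random-access machine is a value together with the number of steps it
took.  A step is one arithmetic operation, square root, comparison or rounding of real numbers, one
operation on indices, or one draw of a random number; it includes reading the operands from memory
and writing the result.  Lists stand for arrays, whose entries are accessible in one step. -/

/-- A value and the number of steps spent on computing it. -/
structure Timed (α : Type) where
  val : α
  time : ℕ

instance : Monad Timed where
  pure a := ⟨a, 0⟩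
  bind x f := ⟨(f x.val).val, x.time + (f x.val).time⟩

namespace Timed

def sub (x y : ℝ) : Timed ℝ := ⟨x - y, 1⟩
def mul (x y : ℝ) : Timed ℝ := ⟨x * y, 1⟩
def div (x y : ℝ) : Timed ℝ := ⟨x / y, 1⟩
def sqrt (x : ℝ) : Timed ℝ := ⟨√x, 1⟩

/-- A random real number is taken from the random source. -/
def draw (x : ℝ) : Timed ℝ := ⟨x, 1⟩

/-- The test `x = 0`. -/
def isZero (x : ℝ) : Timed Bool := ⟨decide (x = 0), 1⟩

/-- The computation `x`, with `c` additional steps. -/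
def charge {α : Type} (c : ℕ) (x : Timed α) : Timed α := ⟨x.val, c + x.time⟩

/-- A loop that fills an array; one step of loop overhead for each entry. -/
def array {α : Type} {n : ℕ} (f : Fin n → Timed α) : Timed (Fin n → α) :=
  ⟨fun i => (f i).val, ∑ i, ((f i).time + 1)⟩

/-- A double loop that fills a matrix. -/
def matrix {m n : ℕ} (f : Fin m → Fin n → Timed ℝ) : Timed (Matrix (Fin m) (Fin n) ℝ) :=
  ⟨Matrix.of fun i j => (f i j).val, ∑ i, ((∑ j, ((f i j).time + 1)) + 1)⟩

/-- A loop that adds up computed numbers; one addition and one step of overhead for each. -/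
def sum {n : ℕ} (f : Fin n → Timed ℝ) : Timed ℝ :=
  ⟨∑ i, (f i).val, ∑ i, ((f i).time + 2)⟩

/-- The array of partial sums `p 0 + ⋯ + p i`, by a loop with one addition for each entry. -/
def partialSums {n : ℕ} (p : Fin n → ℝ) : Timed (Fin n → ℝ) :=
  ⟨fun i => ∑ j ∈ Finset.Iic i, p j, 2 * n⟩

/-- The inner product of two vectors. -/
def dot {n : ℕ} (x y : Fin n → ℝ) : Timed ℝ := sum fun i => mul (x i) (y i)

/-- The product of two matrices, by the definition. -/
def matMul {m n p : ℕ} (M : Matrix (Fin m) (Fin n) ℝ) (N : Matrix (Fin n) (Fin p) ℝ) :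
    Timed (Matrix (Fin m) (Fin p) ℝ) :=
  matrix fun i j => dot (fun l => M i l) (fun l => N l j)

end Timed

open Timed

/-! ### The approximate singular value decomposition -/

/-- The columns of the square matrix `V` form an orthonormal basis of right singular vectors of
`B`, that is of eigenvectors of `Bᵀ B`, in the order of decreasing singular values `σ`. -/
def IsRightSingularBasis {p n : ℕ} (B : Matrix (Fin p) (Fin n) ℝ)
    (V : Matrix (Fin n) (Fin n) ℝ) : Prop :=
  V.transpose * V = 1 ∧ ∃ σ : Fin n → ℝ, Antitone σ ∧ (∀ i, 0 ≤ σ i) ∧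
    B.transpose * B * V = V * Matrix.diagonal fun i => σ i ^ 2

theorem exists_rightSingularBasis {p n : ℕ} (B : Matrix (Fin p) (Fin n) ℝ) :
    ∃ V, IsRightSingularBasis B V := by
  have hps : (B.transpose * B).PosSemidef := by
    simpa using Matrix.posSemidef_conjTranspose_mul_self B
  have hA : (B.transpose * B).IsHermitian := hps.isHermitian
  let U : Matrix (Fin n) (Fin n) ℝ := hA.eigenvectorUnitary
  have hU : U.transpose * U = 1 := by
    have h := Matrix.mem_unitaryGroup_iff'.1 hA.eigenvectorUnitary.2
    simpa [Matrix.star_eq_conjTranspose] using h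
  let e : Equiv.Perm (Fin n) := Tuple.sort fun i => -hA.eigenvalues i
  have he : Monotone ((fun i => -hA.eigenvalues i) ∘ e) := Tuple.monotone_sort _
  refine ⟨U.submatrix id e, ?_, fun i => √(hA.eigenvalues (e i)), ?_, fun i => Real.sqrt_nonneg _,
    ?_⟩
  · have h : (U.submatrix id e).transpose * U.submatrix id e =
        (U.transpose * U).submatrix e e := by
      ext i j
      simp [Matrix.mul_apply]
    rw [h, hU, Matrix.submatrix_one_equiv]
  · intro i j hij
    refine Real.sqrt_le_sqrt ?_
    have h := he hij
    simpa using h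
  · ext i j
    have h := congrFun (hA.mulVec_eigenvectorBasis (e j)) i
    rw [Matrix.mul_diagonal, Real.sq_sqrt (hps.eigenvalues_nonneg _), Matrix.mul_apply]
    simp only [Matrix.mulVec, dotProduct, Pi.smul_apply, smul_eq_mul] at h
    simp only [Matrix.submatrix_apply, id_eq, U, Matrix.IsHermitian.eigenvectorUnitary_apply]
    rw [h, mul_comm]

/-- The top `k` right singular vectors of `B` (for `k ≤ n`), as the columns of an `n × k` matrix.
Ties between equal singular values are broken in some fixed way. -/
def topRightSingularVectors {p n : ℕ} (B : Matrix (Fin p) (Fin n) ℝ) (k : ℕ) :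
    Matrix (Fin n) (Fin k) ℝ :=
  Matrix.of fun i j =>
    if h : j.1 < n then Classical.choose (exists_rightSingularBasis B) i ⟨j.1, h⟩ else 0

/-- A dense singular value decomposition of a `p × n` matrix is a subroutine of the machine which
takes `p n min(p, n)` steps, the usual count; `n k²` steps are added for an orthonormal completion
to `k` vectors in the case `p < k`. -/
def svd {p n : ℕ} (B : Matrix (Fin p) (Fin n) ℝ) (k : ℕ) : Timed (Matrix (Fin n) (Fin k) ℝ) :=
  ⟨topRightSingularVectors B k, p * n * min p n + n * k ^ 2 + 1⟩

/-- Subtract from `w` its components along the members of a list of orthonormal vectors. -/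
def removeComponents {m : ℕ} : List (Fin m → ℝ) → (Fin m → ℝ) → Timed (Fin m → ℝ)
  | [], w => pure w
  | q :: Q, w => do
    let c ← dot q w
    let w' ← array fun i => do
      let t ← mul c (q i)
      sub (w i) t
    removeComponents Q w'

/-- The Gram-Schmidt process: `Q` is a list of orthonormal vectors, which is extended to an
orthonormal basis of the span of `Q` and the given vectors. -/
def orthonormalize {m : ℕ} (Q : List (Fin m → ℝ)) :
    List (Fin m → ℝ) → Timed (List (Fin m → ℝ))
  | [] => pure Q
  | y :: ys => do
    let w ← removeComponents Q y
    let s ← dot w w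
    let b ← isZero s
    if b then
      orthonormalize Q ys
    else do
      let c ← sqrt s
      let q ← array fun i => div (w i) c
      orthonormalize (q :: Q) ys

/-- The number `k + ⌈k / ε + 1⌉` of columns of the Gaussian matrix. -/
def gaussianCols (k : ℕ) (ε : ℝ) : ℕ := k + ⌈(k : ℝ) / ε + 1⌉₊

/-- `FastFrobeniusSVD`, for the outcome `G` of the random Gaussian matrix:
`Y = A G`; the columns of `Q` are an orthonormal basis of the column space of `Y`;
the result consists of the top `k` right singular vectors of `Qᵀ A`. -/
def fastFrobeniusSVD {m n s : ℕ} (A : Matrix (Fin m) (Fin n) ℝ) (k : ℕ)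
    (G : Fin n → Fin s → ℝ) : Timed (Matrix (Fin n) (Fin k) ℝ) := do
  let R ← matrix fun i j => draw (G i j)
  let Y ← matMul A R
  let Q ← orthonormalize [] (List.ofFn fun j => fun i => Y i j)
  let B ← matrix fun (a : Fin Q.length) j => dot (Q.get a) (fun i => A i j)
  svd B k

/-! ### Random sampling of columns -/

/-- The sampling probabilities `p i = ‖i-th row of Z‖² / ‖Z‖_F²`. -/
def samplingProb {n k : ℕ} (Z : Matrix (Fin n) (Fin k) ℝ) (i : Fin n) : ℝ :=
  (∑ j, Z i j ^ 2) / frobSq Z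

/-- Binary search for the least index `i` in `{lo, …, hi}` with `x < F i`, for an increasing array
`F` (the result is `hi` if there is none).  A round takes five steps: two comparisons and the
computation of the new bounds. -/
def binarySearch {n : ℕ} [NeZero n] (F : Fin n → ℝ) (x : ℝ) (lo hi : ℕ) : Timed ℕ :=
  if lo < hi then
    charge 5 <|
      if x < F (Fin.ofNat n ((lo + hi) / 2)) then
        binarySearch F x lo ((lo + hi) / 2)
      else
        binarySearch F x ((lo + hi) / 2 + 1) hi
  else
    charge 1 (pure lo)
termination_by hi - lo

/-- The outcome of the sampling procedure: the selected indices and the rescaling factors. -/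
structure Sample (n r : ℕ) where
  idx : Fin r → Fin n
  scale : Fin r → ℝ

/-- The sampling matrix `Ω`, with columns `e_{idx 0}, e_{idx 1}, …`. -/
def Sample.samplingMatrix {n r : ℕ} (S : Sample n r) : Matrix (Fin n) (Fin r) ℝ :=
  Matrix.of fun i t => if i = S.idx t then 1 else 0

/-- The diagonal rescaling matrix. -/
def Sample.rescalingMatrix {n r : ℕ} (S : Sample n r) : Matrix (Fin r) (Fin r) ℝ :=
  Matrix.diagonal S.scale

/-- `RandomizedSampling`, for the outcomes `u t` of `r` uniform random numbers: the index `i` is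
picked with the probability `p i = ‖i-th row of Z‖² / ‖Z‖_F²`, by inversion of the distribution
function, and its rescaling factor is `1 / √(r p i)`.  The matrices `Ω`, `S` are stored sparsely. -/
def randomizedSampling {n k r : ℕ} [NeZero n] (Z : Matrix (Fin n) (Fin k) ℝ)
    (u : Fin r → unitInterval) : Timed (Sample n r) := do
  let rows ← array fun i => dot (Z i) (Z i)
  let total ← sum fun i => pure (rows i)
  let p ← array fun i => div (rows i) total
  let F ← partialSums p
  let idx ← array fun t => do
    let x ← draw (u t)
    let i ← binarySearch F x 0 (n - 1)
    pure (Fin.ofNat n i)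
  let scale ← array fun t => do
    let a ← mul r (p (idx t))
    let b ← sqrt a
    div 1 b
  pure ⟨idx, scale⟩

/-! ### The feature selection algorithm -/

/-- The number `r = ⌈c₁ · 4 k ln(200 k) / ε²⌉` of features. -/
def numFeatures (c₁ : ℝ) (k : ℕ) (ε : ℝ) : ℕ :=
  ⌈c₁ * (4 * k * Real.log (200 * k)) / ε ^ 2⌉₊

/-- The selection of the features and of their rescaling factors: `FastFrobeniusSVD` followed by
`RandomizedSampling`. -/
def chooseFeatures {m n s r : ℕ} [NeZero n] (A : Matrix (Fin m) (Fin n) ℝ) (k : ℕ)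
    (G : Fin n → Fin s → ℝ) (u : Fin r → unitInterval) : Timed (Sample n r) := do
  let Z ← fastFrobeniusSVD A k G
  randomizedSampling Z u

/-- The whole algorithm: select the features and write down the `m × r` matrix `C` of the `r`
rescaled columns of `A`. -/
def featureSelection {m n s r : ℕ} [NeZero n] (A : Matrix (Fin m) (Fin n) ℝ) (k : ℕ)
    (G : Fin n → Fin s → ℝ) (u : Fin r → unitInterval) :
    Timed (Matrix (Fin m) (Fin r) ℝ) := do
  let S ← chooseFeatures A k G u
  matrix fun i t => mul (A i (S.idx t)) (S.scale t)

/-- The law of an `n × s` matrix with independent standard Gaussian entries. -/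
def gaussianLaw (n s : ℕ) : Measure (Fin n → Fin s → ℝ) :=
  Measure.pi fun _ => Measure.pi fun _ => gaussianReal 0 1

/-- The law of `r` independent uniform random numbers in `[0, 1]`. -/
def uniformLaw (r : ℕ) : Measure (Fin r → unitInterval) :=
  Measure.pi fun _ => volume

/-- The probability that the feature selection algorithm with `s` Gaussian columns and `r` features,
followed by the clustering algorithm `alg` on the selected features, returns a clustering in the set
`good`.  As the values of `alg` are arbitrary, the integrands need not be measurable, in which case
`∫⁻` is the lower integral: a lower bound for it is the strongest possible reading. -/
def successProb {m n k r : ℕ} [NeZero n] (A : Matrix (Fin m) (Fin n) ℝ) (s : ℕ)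
    (alg : ClusteringAlgorithm m r k) (good : Set (IndicatorMatrix m k)) : ℝ≥0∞ :=
  ∫⁻ G, ∫⁻ u, (alg (featureSelection A k G u).val).toOuterMeasure good
    ∂uniformLaw r ∂gaussianLaw n s

/-- The bound `m n k / ε + (k ln k / ε²) ln(k ln k / ε)` on the running time, without constant. -/
def timeBound (m n k : ℕ) (ε : ℝ) : ℝ :=
  (m : ℝ) * n * k / ε + k * Real.log k / ε ^ 2 * Real.log (k * Real.log k / ε)

end KMeans

end

/-!
The error splits at the approximate singular vectors `Z` and is controlled in two independent steps.

*The Gaussian sketch.*  Let `V` have `k` orthonormal columns whose span contains the rows of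
`Xᵀ A`, where `X` is an optimal clustering, and put `E = A - A V Vᵀ`, so that `‖E‖² ≤ F_opt`.
Complete `V` to an orthogonal matrix; as the Gaussian law is invariant under it, `R = Vᵀ G` and
`E G` are independent.  The matrix `A G R⁺`, with the right inverse `R⁺ = Rᵀ (R Rᵀ)⁻¹`, lies in the
column space of `A G` and differs from `A V` by `E G R⁺`.  By Ky Fan's principle the error of
`A Z Zᵀ` is therefore at most `‖E‖² + ‖E G R⁺‖²` (`frobSq_sub_fastFrobeniusSVD_le`).  The expectation
of the second term is at most `‖E‖² 𝔼‖R⁺‖²`, and a column of `R⁺` has squared norm at most the inverse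
of a chi-square variable with `s - k + 1` degrees of freedom (`lintegral_rightInverse_col_le`),
which gives `𝔼‖R⁺‖² ≤ k / (s - k - 1) ≤ ε` (`exists_excess_error`).

*The sampling.*  With `Z` fixed, write `D` for the operation of sampling and rescaling columns.
Three random quantities matter.  First, `Zᵀ D Dᵀ Z` has least eigenvalue at least `0.9` with
probability at least `1 - k exp(-r / (800 k))`.  This matrix Chernoff bound is proved without the
matrix exponential: with `T = I - s ∑ x xᵀ`, the potential `tr T ^ q` contracts in expectation under
each sample (`sampleMean_trace_residualMatrix_pow_le`), and letting `q → ∞` with `s = η / (4 q L)`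
gives the exponential bound (`sampleMean_exists_lt_le`).  Second, sampling does not increase the
expected squared norm of `A - X Xᵀ A`, for a fixed optimal `X`.  Third, for `N = A - A Z Zᵀ`, which
satisfies `N Z = 0`, the expectation of `‖N D Dᵀ Z‖²` is at most `(k / r) ‖N‖²`.  On the event that
`Zᵀ D Dᵀ Z` is well-conditioned, every clustering `X` satisfies
`cost A X ≤ 1.25 cost (A D) X + 12.5 ‖N D Dᵀ Z‖² + ‖N‖²` (`cost_le_of_sample`).

If `X` is the output of a `γ`-approximation on `A D`, the first term is at most
`1.25 γ ‖(A - X₀ X₀ᵀ A) D‖²`, where `X₀` is an optimal clustering of `A`.  The clustering can thus be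
bad only if `1.25 ‖(A - X₀ X₀ᵀ A) D‖² + 12.5 ‖N D Dᵀ Z‖² + (‖N‖² - F_opt)` exceeds `(2 + ε) F_opt`.
By Markov's inequality, over both sources of randomness, the probability of this event is at most
about `(1.25 + ε) / (2 + ε) < 0.7` (`sampleMean_exists_bad_le`, `le_successProb`).

The sampling procedure inverts the distribution function, so the set of `u ∈ [0, 1]` which select an
index `i` is an interval of length `p i` (`volume_selectIndex_eq`).  In the step count, `Q` has at most
`min (m, n)` columns, which makes the singular value decomposition cost `O(m n s)`, and the `r` binary
searches cost `O(r log n) ≤ O(r log r + n)` steps (`mul_log_le`).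
-/

noncomputable section

namespace KMeans

open Timed

/-! ### The Frobenius norm and Ky Fan's maximum principle -/

open Matrix in
theorem frobSq_eq_trace {m n : ℕ} (M : Matrix (Fin m) (Fin n) ℝ) :
    frobSq M = (M * Mᵀ).trace := by
  simp [frobSq, Matrix.trace, Matrix.mul_apply, sq]

theorem frobSq_nonneg {m n : ℕ} (M : Matrix (Fin m) (Fin n) ℝ) : 0 ≤ frobSq M :=
  Finset.sum_nonneg fun _ _ => Finset.sum_nonneg fun _ _ => sq_nonneg _

theorem frobSq_transpose {m n : ℕ} (M : Matrix (Fin m) (Fin n) ℝ) :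
    frobSq M.transpose = frobSq M := by
  simp only [frobSq, Matrix.transpose_apply]
  exact Finset.sum_comm

theorem frobSq_neg {m n : ℕ} (M : Matrix (Fin m) (Fin n) ℝ) : frobSq (-M) = frobSq M := by
  simp [frobSq]

open Matrix in
/-- Pythagoras for the projection `Z Zᵀ` acting on the rows of `N`. -/
theorem frobSq_eq_add_right {m n k : ℕ} {Z : Matrix (Fin n) (Fin k) ℝ}
    (hZ : Z.transpose * Z = 1) (N : Matrix (Fin m) (Fin n) ℝ) :
    frobSq N = frobSq (N * Z) + frobSq (N - N * Z * Z.transpose) := by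
  have h : (N - N * Z * Zᵀ) * (N - N * Z * Zᵀ)ᵀ = N * Nᵀ - (N * Z) * (N * Z)ᵀ := by
    have h1 : N * Z * Zᵀ * (Z * (Zᵀ * Nᵀ)) = N * Z * (Zᵀ * Nᵀ) := by
      rw [Matrix.mul_assoc (N * Z), ← Matrix.mul_assoc Zᵀ Z, hZ, Matrix.one_mul]
    simp only [Matrix.transpose_sub, Matrix.transpose_mul, Matrix.transpose_transpose,
      Matrix.sub_mul, Matrix.mul_sub]
    rw [h1, ← Matrix.mul_assoc N Z, Matrix.mul_assoc (N * Z) Zᵀ Nᵀ]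
    abel
  rw [frobSq_eq_trace (N - _), h, Matrix.trace_sub, ← frobSq_eq_trace, ← frobSq_eq_trace]
  ring

/-- Pythagoras for the projection `Q Qᵀ` acting on the columns of `N`. -/
theorem frobSq_eq_add_left {m n k : ℕ} {Q : Matrix (Fin m) (Fin k) ℝ}
    (hQ : Q.transpose * Q = 1) (N : Matrix (Fin m) (Fin n) ℝ) :
    frobSq N = frobSq (Q.transpose * N) + frobSq (N - Q * Q.transpose * N) := by
  have h := frobSq_eq_add_right hQ N.transpose
  have h1 : N.transpose * Q = (Q.transpose * N).transpose := by simp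
  have h2 : N.transpose - N.transpose * Q * Q.transpose =
      (N - Q * Q.transpose * N).transpose := by
    simp [Matrix.mul_assoc]
  rwa [h2, h1, frobSq_transpose, frobSq_transpose, frobSq_transpose] at h

theorem frobSq_mul_le {m n k : ℕ} {Z : Matrix (Fin n) (Fin k) ℝ}
    (hZ : Z.transpose * Z = 1) (N : Matrix (Fin m) (Fin n) ℝ) :
    frobSq (N * Z) ≤ frobSq N := by
  have := frobSq_eq_add_right hZ N
  have := frobSq_nonneg (N - N * Z * Z.transpose)
  linarith

theorem frobSq_transpose_mul_le {m n k : ℕ} {Q : Matrix (Fin m) (Fin k) ℝ}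
    (hQ : Q.transpose * Q = 1) (N : Matrix (Fin m) (Fin n) ℝ) :
    frobSq (Q.transpose * N) ≤ frobSq N := by
  have := frobSq_eq_add_left hQ N
  have := frobSq_nonneg (N - Q * Q.transpose * N)
  linarith

theorem frobSq_sub_proj_le {m n k : ℕ} {Q : Matrix (Fin m) (Fin k) ℝ}
    (hQ : Q.transpose * Q = 1) (N : Matrix (Fin m) (Fin n) ℝ) :
    frobSq (N - Q * Q.transpose * N) ≤ frobSq N := by
  have := frobSq_eq_add_left hQ N
  have := frobSq_nonneg (Q.transpose * N)
  linarith

theorem sum_castLE {k n : ℕ} (h : k ≤ n) (g : Fin n → ℝ) :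
    ∑ j : Fin k, g (Fin.castLE h j) = ∑ i : Fin n, if i.1 < k then g i else 0 := by
  rw [← Finset.sum_filter]
  refine Finset.sum_bij (fun j _ => Fin.castLE h j) ?_ ?_ ?_ ?_
  · intro j _; simp
  · intro a _ b _ hab; simpa using hab
  · intro b hb
    exact ⟨⟨b.1, by simpa using hb⟩, by simp, by ext; simp⟩
  · intros; rfl

theorem topRightSingularVectors_eq {p n k : ℕ} (h : k ≤ n) (B : Matrix (Fin p) (Fin n) ℝ) :
    topRightSingularVectors B k =
      (Classical.choose (exists_rightSingularBasis B)).submatrix id (Fin.castLE h) := by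
  ext i j
  have : j.1 < n := j.2.trans_le h
  simp only [topRightSingularVectors, Matrix.of_apply, this, dif_pos, Matrix.submatrix_apply, id_eq]
  rfl

theorem submatrix_castLE_transpose_mul {n k : ℕ} (h : k ≤ n) {U : Matrix (Fin n) (Fin n) ℝ}
    (hU : U.transpose * U = 1) :
    (U.submatrix id (Fin.castLE h)).transpose * U.submatrix id (Fin.castLE h) = 1 := by
  have h1 : (U.submatrix id (Fin.castLE h)).transpose * U.submatrix id (Fin.castLE h) =
      (U.transpose * U).submatrix (Fin.castLE h) (Fin.castLE h) := by
    ext i j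
    simp [Matrix.mul_apply]
  rw [h1, hU, Matrix.submatrix_one _ (Fin.castLE_injective h)]

theorem topRightSingularVectors_orthonormal {p n k : ℕ} (h : k ≤ n)
    (B : Matrix (Fin p) (Fin n) ℝ) :
    (topRightSingularVectors B k).transpose * topRightSingularVectors B k = 1 := by
  rw [topRightSingularVectors_eq h]
  exact submatrix_castLE_transpose_mul h (Classical.choose_spec (exists_rightSingularBasis B)).1

open Matrix in
/-- For a right singular basis `U` of `B`, the columns of `V` contribute to `‖B V‖²` the squared
singular values, weighted with the squared row norms of `Uᵀ V`. -/
theorem frobSq_mul_eq_sum {p n k : ℕ} {B : Matrix (Fin p) (Fin n) ℝ}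
    {U : Matrix (Fin n) (Fin n) ℝ} {l : Fin n → ℝ} (hU : U.transpose * U = 1)
    (hB : B.transpose * B * U = U * Matrix.diagonal l) (V : Matrix (Fin n) (Fin k) ℝ) :
    frobSq (B * V) = ∑ i, l i * ∑ j, (U.transpose * V) i j ^ 2 := by
  have hU' : U * Uᵀ = 1 := mul_eq_one_comm.1 hU
  have h1 : Bᵀ * B = U * Matrix.diagonal l * Uᵀ := by
    rw [← hB, Matrix.mul_assoc, hU', Matrix.mul_one]
  have h2 : (B * V)ᵀ * (B * V) = (Uᵀ * V)ᵀ * (Matrix.diagonal l * (Uᵀ * V)) := by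
    simp only [Matrix.transpose_mul, Matrix.transpose_transpose]
    rw [Matrix.mul_assoc, ← Matrix.mul_assoc Bᵀ, h1]
    simp only [Matrix.mul_assoc]
  rw [← frobSq_transpose, frobSq_eq_trace, Matrix.transpose_transpose, h2, Matrix.trace_mul_comm,
    Matrix.trace]
  refine Finset.sum_congr rfl fun i _ => ?_
  rw [Matrix.diag_apply, Matrix.mul_apply, Finset.mul_sum]
  refine Finset.sum_congr rfl fun j _ => ?_
  rw [Matrix.diagonal_mul, Matrix.transpose_apply]; ring

open Matrix in
/-- Ky Fan's maximum principle: among all `n × k` matrices `V` with orthonormal columns, the top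
right singular vectors maximize `‖B V‖_F`. -/
theorem frobSq_mul_le_topRightSingularVectors {p n k : ℕ} (hk : 1 ≤ k) (h : k ≤ n)
    (B : Matrix (Fin p) (Fin n) ℝ) {V : Matrix (Fin n) (Fin k) ℝ} (hV : V.transpose * V = 1) :
    frobSq (B * V) ≤ frobSq (B * topRightSingularVectors B k) := by
  obtain ⟨hU, σ, hσ, hσ0, hB⟩ := Classical.choose_spec (exists_rightSingularBasis B)
  rw [topRightSingularVectors_eq h]
  set U := Classical.choose (exists_rightSingularBasis B)
  rw [frobSq_mul_eq_sum hU hB V, frobSq_mul_eq_sum hU hB]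
  have hU' : U * Uᵀ = 1 := mul_eq_one_comm.1 hU
  have hW : (Uᵀ * V)ᵀ * (Uᵀ * V) = 1 := by
    rw [Matrix.transpose_mul, Matrix.transpose_transpose, Matrix.mul_assoc, ← Matrix.mul_assoc U,
      hU', Matrix.one_mul, hV]
  set W := Uᵀ * V
  have hw1 : ∀ i, ∑ j, W i j ^ 2 ≤ 1 := by
    intro i
    have := frobSq_mul_le hW (Matrix.of fun (_ : Fin 1) l => if i = l then (1 : ℝ) else 0)
    simpa [frobSq, Matrix.mul_apply] using this
  have hwk : ∑ i, ∑ j, W i j ^ 2 = k := by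
    change frobSq W = k
    rw [← frobSq_transpose, frobSq_eq_trace, Matrix.transpose_transpose, hW]; simp
  have hx : ∀ i, ∑ j, (Uᵀ * U.submatrix id (Fin.castLE h)) i j ^ 2 = if i.1 < k then 1 else 0 := by
    intro i
    have : Uᵀ * U.submatrix id (Fin.castLE h) = (Uᵀ * U).submatrix id (Fin.castLE h) := by
      ext; simp [Matrix.mul_apply]
    rw [this, hU]
    change ∑ j, (1 : Matrix (Fin n) (Fin n) ℝ) i (Fin.castLE h j) ^ 2 = _
    rw [sum_castLE h (fun j => (1 : Matrix (Fin n) (Fin n) ℝ) i j ^ 2)]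
    rw [Finset.sum_eq_single i]
    · simp
    · intro b _ hb; simp [Matrix.one_apply_ne (Ne.symm hb)]
    · simp
  simp only [hx]
  -- weights in `[0, 1]` of total `k` are best placed above the threshold `c`, the `k`-th value
  set c := σ ⟨k - 1, by omega⟩ ^ 2 with hc
  have key : ∀ i, σ i ^ 2 * (∑ j, W i j ^ 2) - σ i ^ 2 * (if i.1 < k then (1 : ℝ) else 0) ≤
      c * (∑ j, W i j ^ 2) - c * (if i.1 < k then 1 else 0) := by
    intro i
    have hnn : 0 ≤ ∑ j, W i j ^ 2 := Finset.sum_nonneg fun _ _ => sq_nonneg _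
    split_ifs with hi
    · have : c ≤ σ i ^ 2 := by
        refine pow_le_pow_left₀ (hσ0 _) (hσ ?_) 2
        rw [Fin.le_def]; simp; omega
      nlinarith [hw1 i]
    · have : σ i ^ 2 ≤ c := by
        refine pow_le_pow_left₀ (hσ0 _) (hσ ?_) 2
        rw [Fin.le_def]; simp; omega
      nlinarith
  have hsum := Finset.sum_le_sum fun i (_ : i ∈ Finset.univ) => key i
  rw [Finset.sum_sub_distrib, Finset.sum_sub_distrib, ← Finset.mul_sum, ← Finset.mul_sum, hwk,
    ← sum_castLE h (fun _ => (1 : ℝ))] at hsum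
  simp only [Finset.sum_const, Finset.card_univ, Fintype.card_fin, nsmul_eq_mul, mul_one,
    sub_self] at hsum
  linarith

/-! ### The Gram-Schmidt process -/

@[simp] theorem Timed.val_bind {α β : Type} (x : Timed α) (f : α → Timed β) :
    (x >>= f).val = (f x.val).val := rfl

@[simp] theorem Timed.time_bind {α β : Type} (x : Timed α) (f : α → Timed β) :
    (x >>= f).time = x.time + (f x.val).time := rfl

@[simp] theorem Timed.val_pure {α : Type} (x : α) : (pure x : Timed α).val = x := rfl

@[simp] theorem Timed.time_pure {α : Type} (x : α) : (pure x : Timed α).time = 0 := rfl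

theorem Timed.val_dot {n : ℕ} (x y : Fin n → ℝ) : (dot x y).val = x ⬝ᵥ y := rfl

/-- The members of the list are pairwise orthogonal unit vectors. -/
def IsOrthonormalList {m : ℕ} (Q : List (Fin m → ℝ)) : Prop :=
  Q.Pairwise (fun a b => a ⬝ᵥ b = 0) ∧ ∀ q ∈ Q, q ⬝ᵥ q = 1

theorem val_removeComponents_cons {m : ℕ} (q : Fin m → ℝ) (Q : List (Fin m → ℝ))
    (w : Fin m → ℝ) :
    (removeComponents (q :: Q) w).val = (removeComponents Q (w - (q ⬝ᵥ w) • q)).val := rfl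

theorem sub_removeComponents_mem {m : ℕ} (Q : List (Fin m → ℝ)) (w : Fin m → ℝ) :
    w - (removeComponents Q w).val ∈ Submodule.span ℝ {q | q ∈ Q} := by
  induction Q generalizing w with
  | nil => simp [removeComponents]
  | cons q Q ih =>
    rw [val_removeComponents_cons]
    have h1 := ih (w - (q ⬝ᵥ w) • q)
    have h2 : Submodule.span ℝ {x | x ∈ Q} ≤ Submodule.span ℝ {x | x ∈ q :: Q} :=
      Submodule.span_mono fun x hx => List.mem_cons_of_mem _ hx
    have h3 : (q ⬝ᵥ w) • q ∈ Submodule.span ℝ {x | x ∈ q :: Q} :=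
      Submodule.smul_mem _ _ (Submodule.subset_span (by simp))
    have := Submodule.add_mem _ (h2 h1) h3
    convert this using 1
    abel

theorem dotProduct_eq_zero_of_mem_span {m : ℕ} {s : Set (Fin m → ℝ)} {u v : Fin m → ℝ}
    (h : ∀ q ∈ s, u ⬝ᵥ q = 0) (hv : v ∈ Submodule.span ℝ s) : u ⬝ᵥ v = 0 := by
  induction hv using Submodule.span_induction with
  | mem x hx => exact h x hx
  | zero => simp
  | add x y _ _ hx hy => rw [dotProduct_add, hx, hy, add_zero]
  | smul a x _ hx => rw [dotProduct_smul, hx, smul_zero]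

theorem dotProduct_removeComponents {m : ℕ} {Q : List (Fin m → ℝ)} (hQ : IsOrthonormalList Q)
    (w : Fin m → ℝ) : ∀ q ∈ Q, q ⬝ᵥ (removeComponents Q w).val = 0 := by
  induction Q generalizing w with
  | nil => simp
  | cons q Q ih =>
    obtain ⟨h1, h2⟩ := hQ
    rw [List.pairwise_cons] at h1
    have hQ' : IsOrthonormalList Q := ⟨h1.2, fun x hx => h2 x (List.mem_cons_of_mem _ hx)⟩
    intro x hx
    rw [val_removeComponents_cons]
    rcases List.mem_cons.1 hx with rfl | hx
    · have h3 := dotProduct_eq_zero_of_mem_span (u := x) (s := {y | y ∈ Q}) h1.1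
        (sub_removeComponents_mem Q (w - (x ⬝ᵥ w) • x))
      rw [dotProduct_sub, sub_eq_zero] at h3
      rw [← h3, dotProduct_sub, dotProduct_smul, h2 x (by simp)]
      simp
    · exact ih hQ' _ x hx

theorem val_orthonormalize_cons {m : ℕ} (Q : List (Fin m → ℝ)) (y : Fin m → ℝ)
    (ys : List (Fin m → ℝ)) :
    (orthonormalize Q (y :: ys)).val =
      if (removeComponents Q y).val = 0 then (orthonormalize Q ys).val
      else (orthonormalize ((fun i => (removeComponents Q y).val i /
        √((removeComponents Q y).val ⬝ᵥ (removeComponents Q y).val)) :: Q) ys).val := by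
  simp only [orthonormalize, Timed.val_bind, Timed.isZero, decide_eq_true_eq, Timed.val_dot,
    dotProduct_self_eq_zero]
  split_ifs <;> rfl

theorem normalized_mul_self {m : ℕ} {w : Fin m → ℝ} (hw : w ≠ 0) :
    (fun i => w i / √(w ⬝ᵥ w)) ⬝ᵥ (fun i => w i / √(w ⬝ᵥ w)) = 1 := by
  have h0 : 0 ≤ w ⬝ᵥ w := Finset.sum_nonneg fun i _ => mul_self_nonneg _
  have h1 : w ⬝ᵥ w ≠ 0 := fun h => hw (dotProduct_self_eq_zero.1 h)
  have : (fun i => w i / √(w ⬝ᵥ w)) = (√(w ⬝ᵥ w))⁻¹ • w := by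
    ext i; simp [div_eq_inv_mul]
  rw [this, smul_dotProduct, dotProduct_smul, smul_eq_mul, smul_eq_mul, ← mul_assoc, ← mul_inv,
    Real.mul_self_sqrt h0, inv_mul_cancel₀ h1]

/-- The extended list is orthonormal, spans what it was extended by, and stays within every subspace
that contains the input. -/
theorem orthonormalize_spec {m : ℕ} (ys Q : List (Fin m → ℝ)) (hQ : IsOrthonormalList Q) :
    IsOrthonormalList (orthonormalize Q ys).val ∧
      (∀ q ∈ Q, q ∈ (orthonormalize Q ys).val) ∧
      (∀ y ∈ ys, y ∈ Submodule.span ℝ {q | q ∈ (orthonormalize Q ys).val}) ∧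
      (∀ S : Submodule ℝ (Fin m → ℝ), (∀ q ∈ Q, q ∈ S) → (∀ y ∈ ys, y ∈ S) →
        ∀ q ∈ (orthonormalize Q ys).val, q ∈ S) ∧
      (orthonormalize Q ys).val.length ≤ Q.length + ys.length := by
  induction ys generalizing Q with
  | nil => exact ⟨hQ, by simp [orthonormalize], by simp, by simp +contextual [orthonormalize], le_rfl⟩
  | cons y ys ih =>
    have hmem := sub_removeComponents_mem Q y
    have horth := dotProduct_removeComponents hQ y
    rw [val_orthonormalize_cons]
    set w := (removeComponents Q y).val with hw
    split_ifs with hw0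
    · obtain ⟨h1, h2, h3, h4, h5⟩ := ih Q hQ
      refine ⟨h1, h2, ?_, fun S hS hy => h4 S hS fun z hz => hy z (by simp [hz]), ?_⟩
      · intro z hz
        rcases List.mem_cons.1 hz with rfl | hz
        · rw [hw0, sub_zero] at hmem
          exact Submodule.span_mono h2 hmem
        · exact h3 z hz
      · simp only [List.length_cons]; omega
    · have hs : (fun i => w i / √(w ⬝ᵥ w)) = (√(w ⬝ᵥ w))⁻¹ • w := by
        ext i; simp [div_eq_inv_mul]
      have hn := normalized_mul_self hw0
      have hss : w = √(w ⬝ᵥ w) • (fun i => w i / √(w ⬝ᵥ w)) := by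
        have h1 : √(w ⬝ᵥ w) ≠ 0 := by
          intro h
          rw [h] at hn
          simp at hn
        ext i; simp [mul_div_cancel₀ _ h1]
      set q := (fun i => w i / √(w ⬝ᵥ w)) with hq
      have hQ' : IsOrthonormalList (q :: Q) := by
        refine ⟨List.pairwise_cons.2 ⟨fun x hx => ?_, hQ.1⟩, ?_⟩
        · rw [hs, smul_dotProduct, dotProduct_comm w x, horth x hx, smul_zero]
        · intro x hx
          rcases List.mem_cons.1 hx with rfl | hx
          · exact hn
          · exact hQ.2 x hx
      obtain ⟨h1, h2, h3, h4, h5⟩ := ih (q :: Q) hQ'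
      refine ⟨h1, fun x hx => h2 x (List.mem_cons_of_mem _ hx), ?_, ?_, ?_⟩
      · intro z hz
        rcases List.mem_cons.1 hz with rfl | hz
        · have e1 := Submodule.span_mono (R := ℝ) (s := {x | x ∈ Q})
            (t := {x | x ∈ (orthonormalize (q :: Q) ys).val})
            (fun x hx => h2 x (List.mem_cons_of_mem _ hx)) hmem
          have e2 : w ∈ Submodule.span ℝ {x | x ∈ (orthonormalize (q :: Q) ys).val} := by
            rw [hss]
            exact Submodule.smul_mem _ _ (Submodule.subset_span (h2 q (by simp)))
          simpa using Submodule.add_mem _ e1 e2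
        · exact h3 z hz
      · intro S hS hy
        refine h4 S ?_ fun z hz => hy z (by simp [hz])
        intro x hx
        rcases List.mem_cons.1 hx with rfl | hx
        · rw [hs]
          have e1 : Submodule.span ℝ {x | x ∈ Q} ≤ S := Submodule.span_le.2 hS
          have e2 := S.sub_mem (hy y (by simp)) (e1 hmem)
          rw [sub_sub_cancel] at e2
          exact S.smul_mem _ e2
        · exact hS x hx
      · simp only [List.length_cons] at h5 ⊢; omega

/-! ### The deterministic error bound for the approximate singular value decomposition -/

/-- The matrix whose columns are the members of the list. -/
def listMatrix {m : ℕ} (L : List (Fin m → ℝ)) : Matrix (Fin m) (Fin L.length) ℝ :=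
  Matrix.of fun i a => L.get a i

/-- The orthonormal basis that the Gram-Schmidt process returns for the columns of `Y`. -/
def columnBasis {m s : ℕ} (Y : Matrix (Fin m) (Fin s) ℝ) : List (Fin m → ℝ) :=
  (orthonormalize [] (List.ofFn fun j => fun i => Y i j)).val

theorem val_fastFrobeniusSVD {m n s : ℕ} (A : Matrix (Fin m) (Fin n) ℝ) (k : ℕ)
    (G : Fin n → Fin s → ℝ) :
    (fastFrobeniusSVD A k G).val =
      topRightSingularVectors
        ((listMatrix (columnBasis (A * Matrix.of G))).transpose * A) k := rfl

theorem listMatrix_transpose_mul_self {m : ℕ} {L : List (Fin m → ℝ)} (hL : IsOrthonormalList L) :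
    (listMatrix L).transpose * listMatrix L = 1 := by
  ext a b
  have h : ((listMatrix L).transpose * listMatrix L) a b = L.get a ⬝ᵥ L.get b := rfl
  rw [h]
  have hp := List.pairwise_iff_get.1 hL.1
  rcases lt_trichotomy a b with hab | rfl | hab
  · rw [hp a b hab, Matrix.one_apply_ne hab.ne]
  · rw [hL.2 _ (List.get_mem _ _), Matrix.one_apply_eq]
  · rw [dotProduct_comm, hp b a hab, Matrix.one_apply_ne hab.ne']

open Matrix in
theorem listMatrix_mul_transpose_mulVec {m : ℕ} {L : List (Fin m → ℝ)} (hL : IsOrthonormalList L)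
    {v : Fin m → ℝ} (hv : v ∈ Submodule.span ℝ {q | q ∈ L}) :
    (listMatrix L * (listMatrix L)ᵀ) *ᵥ v = v := by
  induction hv using Submodule.span_induction with
  | mem x hx =>
    obtain ⟨a, rfl⟩ := List.get_of_mem hx
    have h : L.get a = listMatrix L *ᵥ Pi.single a 1 := by
      ext i; simp [listMatrix]
    rw [h, Matrix.mulVec_mulVec, Matrix.mul_assoc, listMatrix_transpose_mul_self hL, Matrix.mul_one]
  | zero => simp
  | add x y _ _ hx hy => rw [Matrix.mulVec_add, hx, hy]
  | smul c x _ hx => rw [Matrix.mulVec_smul, hx]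

theorem isOrthonormalList_nil {m : ℕ} : IsOrthonormalList ([] : List (Fin m → ℝ)) :=
  ⟨List.Pairwise.nil, by simp⟩

theorem columnBasis_orthonormal {m s : ℕ} (Y : Matrix (Fin m) (Fin s) ℝ) :
    IsOrthonormalList (columnBasis Y) :=
  (orthonormalize_spec _ [] isOrthonormalList_nil).1

open Matrix in
theorem columnBasis_mul_transpose_mul {m s : ℕ} (Y : Matrix (Fin m) (Fin s) ℝ) :
    listMatrix (columnBasis Y) * (listMatrix (columnBasis Y))ᵀ * Y = Y := by
  ext i j
  have h : (fun i => Y i j) ∈ Submodule.span ℝ {q | q ∈ columnBasis Y} :=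
    (orthonormalize_spec _ [] isOrthonormalList_nil).2.2.1 _ (by simp [List.mem_ofFn])
  exact congrFun (listMatrix_mul_transpose_mulVec (columnBasis_orthonormal Y) h) i

theorem length_columnBasis_le {m s : ℕ} (Y : Matrix (Fin m) (Fin s) ℝ) :
    (columnBasis Y).length ≤ s := by
  simpa [columnBasis] using
    (orthonormalize_spec (List.ofFn fun j => fun i => Y i j) [] isOrthonormalList_nil).2.2.2.2

theorem length_le_of_isOrthonormalList {m : ℕ} {L : List (Fin m → ℝ)} (hL : IsOrthonormalList L) :
    L.length ≤ m := by
  have h := Matrix.rank_mul_le_left (listMatrix L).transpose (listMatrix L)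
  rw [listMatrix_transpose_mul_self hL, Matrix.rank_one, Fintype.card_fin] at h
  exact h.trans (Matrix.rank_le_width _)

open Matrix in
/-- Orthonormal vectors in the column space of an `m × n` matrix are at most `n` in number. -/
theorem length_le_of_mem_range {m n : ℕ} (A : Matrix (Fin m) (Fin n) ℝ) {L : List (Fin m → ℝ)}
    (hL : IsOrthonormalList L) (h : ∀ q ∈ L, q ∈ LinearMap.range A.mulVecLin) : L.length ≤ n := by
  choose x hx using fun a : Fin L.length => h (L.get a) (List.get_mem _ _)
  have hA : listMatrix L = A * (Matrix.of x)ᵀ := by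
    ext i a
    exact (congrFun (hx a) i).symm
  have h := Matrix.rank_mul_le_right (listMatrix L)ᵀ (listMatrix L)
  rw [listMatrix_transpose_mul_self hL, Matrix.rank_one, Fintype.card_fin, hA] at h
  exact (h.trans (Matrix.rank_mul_le_left _ _)).trans (Matrix.rank_le_width _)

theorem fastFrobeniusSVD_orthonormal {m n s k : ℕ} (hkn : k ≤ n) (A : Matrix (Fin m) (Fin n) ℝ)
    (G : Fin n → Fin s → ℝ) :
    (fastFrobeniusSVD A k G).val.transpose * (fastFrobeniusSVD A k G).val = 1 := by
  rw [val_fastFrobeniusSVD]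
  exact topRightSingularVectors_orthonormal hkn _

open Matrix in
/-- The error of the approximate singular value decomposition is at most that of any approximation
`A G N Vᵀ` from the column space of `A G`, by the optimality of the top singular vectors. -/
theorem frobSq_sub_fastFrobeniusSVD_le {m n s k : ℕ} (hk : 1 ≤ k) (hkn : k ≤ n)
    (A : Matrix (Fin m) (Fin n) ℝ) (G : Fin n → Fin s → ℝ) {V : Matrix (Fin n) (Fin k) ℝ}
    (hV : Vᵀ * V = 1) (N : Matrix (Fin s) (Fin k) ℝ) :
    frobSq (A - A * (fastFrobeniusSVD A k G).val * (fastFrobeniusSVD A k G).valᵀ) ≤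
      frobSq (A - A * V * Vᵀ) + frobSq (A * V - A * Matrix.of G * N) := by
  have hZ := fastFrobeniusSVD_orthonormal hkn A G
  have hval := val_fastFrobeniusSVD A k G
  set Z := (fastFrobeniusSVD A k G).val
  have hQ := listMatrix_transpose_mul_self (columnBasis_orthonormal (A * Matrix.of G))
  have hY := columnBasis_mul_transpose_mul (A * Matrix.of G)
  set Q := listMatrix (columnBasis (A * Matrix.of G))
  have h1 := frobSq_eq_add_right hZ A
  have h2 : frobSq (Qᵀ * (A * Z)) ≤ frobSq (A * Z) := frobSq_transpose_mul_le hQ _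
  have h3 : frobSq (Qᵀ * A * V) ≤ frobSq (Qᵀ * A * Z) := by
    rw [hval]
    exact frobSq_mul_le_topRightSingularVectors hk hkn _ hV
  have h4 := frobSq_eq_add_right hV A
  have h5 := frobSq_eq_add_left hQ (A * V)
  have h6 : frobSq (A * V - Q * Qᵀ * (A * V)) ≤ frobSq (A * V - A * Matrix.of G * N) := by
    have e : A * V - Q * Qᵀ * (A * V) = (A * V - A * Matrix.of G * N) -
        Q * Qᵀ * (A * V - A * Matrix.of G * N) := by
      rw [Matrix.mul_sub, ← Matrix.mul_assoc (Q * Qᵀ) (A * Matrix.of G) N, hY]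
      abel
    rw [e]
    exact frobSq_sub_proj_le hQ _
  rw [Matrix.mul_assoc, Matrix.mul_assoc Qᵀ A Z] at h3
  linarith

theorem eq_zero_of_frobSq_eq_zero {m n : ℕ} {M : Matrix (Fin m) (Fin n) ℝ} (h : frobSq M = 0) :
    M = 0 := by
  ext i j
  have h1 := (Finset.sum_eq_zero_iff_of_nonneg
    (fun i _ => Finset.sum_nonneg fun _ _ => sq_nonneg _)).1 h i (Finset.mem_univ _)
  have h2 := (Finset.sum_eq_zero_iff_of_nonneg (fun _ _ => sq_nonneg _)).1 h1 j (Finset.mem_univ _)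
  simpa using h2

open Matrix in
/-- The row space of a `k × n` matrix is contained in the span of the first `k` members of some
orthonormal basis of the whole space. -/
theorem exists_orthogonal_mul_eq_self {n k : ℕ} (hkn : k ≤ n) (B : Matrix (Fin k) (Fin n) ℝ) :
    ∃ U : Matrix (Fin n) (Fin n) ℝ, Uᵀ * U = 1 ∧
      B * U.submatrix id (Fin.castLE hkn) * (U.submatrix id (Fin.castLE hkn))ᵀ = B := by
  obtain ⟨U, hU, σ, hσ, hσ0, hB⟩ := exists_rightSingularBasis B
  refine ⟨U, hU, ?_⟩
  have hV := submatrix_castLE_transpose_mul hkn hU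
  have hU' : U * Uᵀ = 1 := mul_eq_one_comm.1 hU
  -- `Bᵀ B` has rank at most `k`, so at most `k` singular values are non-zero
  have hz : ∀ i : Fin n, k ≤ i.1 → σ i ^ 2 = 0 := by
    intro i hi
    by_contra hne
    have hd : Matrix.diagonal (fun i => σ i ^ 2) = Uᵀ * Bᵀ * (B * U) := by
      rw [Matrix.mul_assoc, ← Matrix.mul_assoc Bᵀ, hB, ← Matrix.mul_assoc, hU, Matrix.one_mul]
    have hr : (Matrix.diagonal (fun i => σ i ^ 2)).rank ≤ k := by
      rw [hd]
      exact (Matrix.rank_mul_le_left _ _).trans (Matrix.rank_le_width _)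
    rw [Matrix.rank_diagonal] at hr
    have hpos : 0 < σ i := lt_of_le_of_ne (hσ0 i) fun h => hne (by rw [← h]; simp)
    have hc : Fintype.card (Fin (i.1 + 1)) ≤ Fintype.card {i // σ i ^ 2 ≠ 0} := by
      refine Fintype.card_le_of_injective
        (fun j => ⟨⟨j.1, by omega⟩, ?_⟩) ?_
      · have : σ i ≤ σ ⟨j.1, by omega⟩ := hσ (by rw [Fin.le_def]; simp; omega)
        have := hpos.trans_le this
        positivity
      · intro a b hab
        ext
        simpa using hab
    simp only [Fintype.card_fin] at hc
    omega
  have h1 := frobSq_eq_add_right hV B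
  have h2 := frobSq_mul_eq_sum hU hB (1 : Matrix (Fin n) (Fin n) ℝ)
  have h3 := frobSq_mul_eq_sum hU hB (U.submatrix id (Fin.castLE hkn))
  have h4 : ∀ i, ∑ j, (Uᵀ * (1 : Matrix (Fin n) (Fin n) ℝ)) i j ^ 2 = 1 := by
    intro i
    have := congrFun (congrFun hU i) i
    rw [Matrix.mul_apply, Matrix.one_apply_eq] at this
    rw [← this]
    simp [sq]
  have h5 : ∀ i : Fin n, i.1 < k → ∑ j, (Uᵀ * U.submatrix id (Fin.castLE hkn)) i j ^ 2 = 1 := by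
    intro i hi
    have : Uᵀ * U.submatrix id (Fin.castLE hkn) = (Uᵀ * U).submatrix id (Fin.castLE hkn) := by
      ext; simp [Matrix.mul_apply]
    rw [this, hU, Finset.sum_eq_single (⟨i.1, hi⟩ : Fin k)]
    · simp [Matrix.one_apply]
    · intro b _ hb
      have : i ≠ Fin.castLE hkn b := by
        rintro rfl; exact hb rfl
      have h0 : (1 : Matrix (Fin n) (Fin n) ℝ) i (Fin.castLE hkn b) = 0 := Matrix.one_apply_ne this
      change (1 : Matrix (Fin n) (Fin n) ℝ) i (Fin.castLE hkn b) ^ 2 = 0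
      rw [h0]; simp
    · simp
  have h6 : frobSq (B * U.submatrix id (Fin.castLE hkn)) = frobSq B := by
    rw [Matrix.mul_one] at h2
    rw [h2, h3]
    refine Finset.sum_congr rfl fun i _ => ?_
    rw [h4]
    by_cases hi : i.1 < k
    · rw [h5 i hi]
    · rw [hz i (by omega)]; ring
  have h7 := eq_zero_of_frobSq_eq_zero (M := B - B * U.submatrix id (Fin.castLE hkn) *
    (U.submatrix id (Fin.castLE hkn))ᵀ) (by linarith)
  exact (sub_eq_zero.1 h7).symm

open Matrix in
/-- Projecting the rows onto a space that contains the rows of an approximation `X C` is at least as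
good as this approximation. -/
theorem frobSq_sub_proj_le_of_mul_eq {m n k q : ℕ} (A : Matrix (Fin m) (Fin n) ℝ)
    {X : Matrix (Fin m) (Fin q) ℝ} {C : Matrix (Fin q) (Fin n) ℝ} {V : Matrix (Fin n) (Fin k) ℝ}
    (hV : Vᵀ * V = 1) (hC : C * V * Vᵀ = C) :
    frobSq (A - A * V * Vᵀ) ≤ frobSq (A - X * C) := by
  have h := frobSq_eq_add_right hV (A - X * C)
  have h1 : (A - X * C) - (A - X * C) * V * Vᵀ = A - A * V * Vᵀ := by
    rw [Matrix.sub_mul, Matrix.sub_mul, Matrix.mul_assoc X, Matrix.mul_assoc X, hC]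
    abel
  rw [h1] at h
  have := frobSq_nonneg ((A - X * C) * V)
  linarith

/-! ### Expectations over independent samples from a finite set -/

/-- The expectation of `f` over `r` independent samples from a finite set with point weights `p`. -/
def sampleMean {ι : Type*} [Fintype ι] (p : ι → ℝ) (r : ℕ) (f : (Fin r → ι) → ℝ) : ℝ :=
  ∑ J, (∏ t, p (J t)) * f J

section SampleMean

variable {ι : Type*} [Fintype ι] {p : ι → ℝ} {r : ℕ}

theorem sampleMean_mono (hp : ∀ i, 0 ≤ p i) {f g : (Fin r → ι) → ℝ} (h : ∀ J, f J ≤ g J) :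
    sampleMean p r f ≤ sampleMean p r g :=
  Finset.sum_le_sum fun J _ =>
    mul_le_mul_of_nonneg_left (h J) (Finset.prod_nonneg fun t _ => hp (J t))

theorem sampleMean_add (f g : (Fin r → ι) → ℝ) :
    sampleMean p r (fun J => f J + g J) = sampleMean p r f + sampleMean p r g := by
  simp [sampleMean, mul_add, Finset.sum_add_distrib]

theorem sampleMean_const_mul (c : ℝ) (f : (Fin r → ι) → ℝ) :
    sampleMean p r (fun J => c * f J) = c * sampleMean p r f := by
  simp only [sampleMean, Finset.mul_sum]
  exact Finset.sum_congr rfl fun J _ => by ring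

theorem sampleMean_finset_sum {κ : Type*} (s : Finset κ) (f : κ → (Fin r → ι) → ℝ) :
    sampleMean p r (fun J => ∑ a ∈ s, f a J) = ∑ a ∈ s, sampleMean p r (f a) := by
  simp only [sampleMean, Finset.mul_sum]
  exact Finset.sum_comm

theorem sampleMean_const (hp : ∑ i, p i = 1) (c : ℝ) : sampleMean p r (fun _ => c) = c := by
  have h : ∑ J : Fin r → ι, ∏ t, p (J t) = (∑ i, p i) ^ r := by
    rw [Finset.sum_pow']
    simp
  rw [sampleMean, ← Finset.sum_mul, h, hp, one_pow, one_mul]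

theorem sampleMean_zero (f : (Fin 0 → ι) → ℝ) : sampleMean p 0 f = f Fin.elim0 := by
  rw [sampleMean, Fintype.sum_unique]
  simp only [Finset.univ_eq_empty, Finset.prod_empty, one_mul]
  congr 1

theorem sampleMean_succ (f : (Fin (r + 1) → ι) → ℝ) :
    sampleMean p (r + 1) f = sampleMean p r fun J => ∑ i, p i * f (Fin.cons i J) := by
  rw [sampleMean, ← (Fin.consEquiv fun _ => ι).sum_comp, Fintype.sum_prod_type, Finset.sum_comm,
    sampleMean]
  refine Finset.sum_congr rfl fun J _ => ?_
  rw [Finset.mul_sum]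
  refine Finset.sum_congr rfl fun i _ => ?_
  have e : (Fin.consEquiv fun _ => ι) (i, J) = Fin.cons i J := rfl
  simp only [e, Fin.prod_univ_succ, Fin.cons_zero, Fin.cons_succ]
  ring

theorem sampleMean_sum (hp : ∑ i, p i = 1) (g : ι → ℝ) :
    sampleMean p r (fun J => ∑ t, g (J t)) = r * ∑ i, p i * g i := by
  induction r with
  | zero => simp [sampleMean_zero]
  | succ r ih =>
    simp only [sampleMean_succ, Fin.sum_univ_succ, Fin.cons_zero, Fin.cons_succ, mul_add,
      Finset.sum_add_distrib]
    simp only [← Finset.sum_mul, hp, one_mul, sampleMean_add, ih, sampleMean_const hp]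
    push_cast; ring

/-- The second moment of a sum of independent centred samples. -/
theorem sampleMean_sum_sq (hp : ∑ i, p i = 1) {y : ι → ℝ} (hy : ∑ i, p i * y i = 0) :
    sampleMean p r (fun J => (∑ t, y (J t)) ^ 2) = r * ∑ i, p i * y i ^ 2 := by
  induction r with
  | zero => simp [sampleMean_zero]
  | succ r ih =>
    have h : ∀ J : Fin r → ι, ∑ i, p i * (∑ t, y ((Fin.cons i J : Fin (r + 1) → ι) t)) ^ 2 =
        (∑ i, p i * y i ^ 2) + (∑ t, y (J t)) ^ 2 := by
      intro J
      simp only [Fin.sum_univ_succ, Fin.cons_zero, Fin.cons_succ]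
      have : ∀ i, p i * (y i + ∑ t, y (J t)) ^ 2 =
          p i * y i ^ 2 + 2 * (∑ t, y (J t)) * (p i * y i) + p i * (∑ t, y (J t)) ^ 2 :=
        fun i => by ring
      simp only [this, Finset.sum_add_distrib]
      rw [← Finset.mul_sum, hy, ← Finset.sum_mul, hp]
      ring
    simp only [sampleMean_succ, h]
    rw [sampleMean_add, ih, sampleMean_const hp]
    push_cast; ring

end SampleMean

/-! ### A lower tail bound for the least eigenvalue of a sum of random rank-one matrices -/

section LowerTail

open Matrix

theorem pow_sub_pow_eq_sum {R : Type*} [Ring R] (a b : R) (q : ℕ) :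
    a ^ q - b ^ q = ∑ i ∈ Finset.range q, b ^ i * (a - b) * a ^ (q - 1 - i) := by
  induction q with
  | zero => simp
  | succ q ih =>
    have h : ∑ i ∈ Finset.range q, b ^ i * (a - b) * a ^ (q + 1 - 1 - i) =
        (∑ i ∈ Finset.range q, b ^ i * (a - b) * a ^ (q - 1 - i)) * a := by
      rw [Finset.sum_mul]
      refine Finset.sum_congr rfl fun i hi => ?_
      have : q + 1 - 1 - i = (q - 1 - i) + 1 := by
        have := Finset.mem_range.1 hi
        omega
      rw [this, pow_succ, ← mul_assoc]
    rw [Finset.sum_range_succ, h, ← ih]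
    simp only [add_tsub_cancel_right, tsub_self, pow_zero, mul_one, sub_mul, mul_sub, pow_succ]
    abel

variable {k : ℕ}

/-- A real symmetric matrix between `ρ I` and `I` in an orthonormal eigenbasis. -/
theorem exists_eigenbasis {T : Matrix (Fin k) (Fin k) ℝ} (hT : T.IsHermitian) {ρ : ℝ}
    (h1 : ∀ z : Fin k → ℝ, ρ * (z ⬝ᵥ z) ≤ z ⬝ᵥ T *ᵥ z)
    (h2 : ∀ z : Fin k → ℝ, z ⬝ᵥ T *ᵥ z ≤ z ⬝ᵥ z) :
    ∃ (U : Matrix (Fin k) (Fin k) ℝ) (l : Fin k → ℝ), Uᵀ * U = 1 ∧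
      T = U * Matrix.diagonal l * Uᵀ ∧ ∀ j, ρ ≤ l j ∧ l j ≤ 1 := by
  let U : Matrix (Fin k) (Fin k) ℝ := hT.eigenvectorUnitary
  have hU : Uᵀ * U = 1 := by
    have h := Matrix.mem_unitaryGroup_iff'.1 hT.eigenvectorUnitary.2
    simpa [Matrix.star_eq_conjTranspose] using h
  have hTU : T * U = U * Matrix.diagonal hT.eigenvalues := by
    ext i j
    have h := congrFun (hT.mulVec_eigenvectorBasis j) i
    rw [Matrix.mul_diagonal, Matrix.mul_apply]
    simp only [Matrix.mulVec, dotProduct, Pi.smul_apply, smul_eq_mul] at h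
    simp only [U, Matrix.IsHermitian.eigenvectorUnitary_apply]
    rw [h, mul_comm]
  refine ⟨U, hT.eigenvalues, hU, ?_, fun j => ?_⟩
  · rw [← hTU, Matrix.mul_assoc, mul_eq_one_comm.1 hU, Matrix.mul_one]
  · have hz : (U *ᵥ Pi.single j 1) ⬝ᵥ (U *ᵥ Pi.single j 1) = 1 := by
      rw [Matrix.dotProduct_mulVec, Matrix.vecMul_mulVec, hU]
      simp
    have hz' : (U *ᵥ Pi.single j 1) ⬝ᵥ T *ᵥ (U *ᵥ Pi.single j 1) = hT.eigenvalues j := by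
      rw [Matrix.mulVec_mulVec, hTU, Matrix.dotProduct_mulVec, Matrix.vecMul_mulVec,
        ← Matrix.mul_assoc, hU, Matrix.one_mul]
      simp
    have e1 := h1 (U *ᵥ Pi.single j 1)
    have e2 := h2 (U *ᵥ Pi.single j 1)
    rw [hz, hz'] at e1 e2
    exact ⟨by linarith, e2⟩

theorem conj_diagonal_pow {U : Matrix (Fin k) (Fin k) ℝ} {l : Fin k → ℝ} (hU : Uᵀ * U = 1) (q : ℕ) :
    (U * Matrix.diagonal l * Uᵀ) ^ q = U * Matrix.diagonal (l ^ q) * Uᵀ := by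
  induction q with
  | zero => simp [mul_eq_one_comm.1 hU]
  | succ q ih =>
    rw [pow_succ, ih]
    calc U * diagonal (l ^ q) * Uᵀ * (U * diagonal l * Uᵀ)
        = U * diagonal (l ^ q) * (Uᵀ * U) * diagonal l * Uᵀ := by simp only [Matrix.mul_assoc]
      _ = _ := by
        rw [hU, Matrix.mul_one, Matrix.mul_assoc U, Matrix.diagonal_mul_diagonal, pow_succ]
        rfl

theorem trace_conj_diagonal_pow {U : Matrix (Fin k) (Fin k) ℝ} {l : Fin k → ℝ} (hU : Uᵀ * U = 1)
    (q : ℕ) : ((U * Matrix.diagonal l * Uᵀ) ^ q).trace = ∑ j, l j ^ q := by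
  rw [conj_diagonal_pow hU, Matrix.trace_mul_comm, ← Matrix.mul_assoc, hU, Matrix.one_mul,
    Matrix.trace_diagonal]
  rfl

theorem dotProduct_conj_diagonal_pow {U : Matrix (Fin k) (Fin k) ℝ} {l : Fin k → ℝ}
    (hU : Uᵀ * U = 1) (q : ℕ) (x : Fin k → ℝ) :
    x ⬝ᵥ ((U * Matrix.diagonal l * Uᵀ) ^ q) *ᵥ x = ∑ j, l j ^ q * (Uᵀ *ᵥ x) j ^ 2 := by
  rw [conj_diagonal_pow hU, ← Matrix.mulVec_mulVec, ← Matrix.mulVec_mulVec, Matrix.dotProduct_mulVec,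
    ← Matrix.mulVec_transpose]
  simp only [dotProduct, Matrix.mulVec_diagonal, Pi.pow_apply]
  exact Finset.sum_congr rfl fun j _ => by ring

/-- Moments of a positive symmetric matrix are positively correlated (Chebyshev). -/
theorem moment_mul_moment_le {U : Matrix (Fin k) (Fin k) ℝ} {l : Fin k → ℝ} (hU : Uᵀ * U = 1)
    (hl : ∀ j, 0 ≤ l j) (a b : ℕ) (x : Fin k → ℝ) :
    (x ⬝ᵥ ((U * Matrix.diagonal l * Uᵀ) ^ a) *ᵥ x) * (x ⬝ᵥ ((U * Matrix.diagonal l * Uᵀ) ^ b) *ᵥ x) ≤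
      (x ⬝ᵥ x) * (x ⬝ᵥ ((U * Matrix.diagonal l * Uᵀ) ^ (a + b)) *ᵥ x) := by
  have hx : x ⬝ᵥ x = ∑ j, l j ^ 0 * (Uᵀ *ᵥ x) j ^ 2 := by
    rw [← dotProduct_conj_diagonal_pow hU]; simp
  rw [hx]
  simp only [dotProduct_conj_diagonal_pow hU]
  set w := fun j => (Uᵀ *ᵥ x) j ^ 2 with hw
  have hw0 : ∀ j, 0 ≤ w j := fun j => sq_nonneg _
  have e : ∀ c d : ℕ, (∑ i, l i ^ c * w i) * (∑ j, l j ^ d * w j) =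
      ∑ i, ∑ j, (w i * w j) * (l i ^ c * l j ^ d) := by
    intro c d
    rw [Finset.sum_mul_sum]
    exact Finset.sum_congr rfl fun i _ => Finset.sum_congr rfl fun j _ => by ring
  have e' : ∀ c d : ℕ, (∑ i, l i ^ c * w i) * (∑ j, l j ^ d * w j) =
      ∑ i, ∑ j, (w i * w j) * (l j ^ c * l i ^ d) := by
    intro c d
    rw [e, Finset.sum_comm]
    exact Finset.sum_congr rfl fun i _ => Finset.sum_congr rfl fun j _ => by ring
  have key : (∑ i, l i ^ a * w i) * (∑ j, l j ^ b * w j) +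
      (∑ i, l i ^ a * w i) * (∑ j, l j ^ b * w j) ≤
      (∑ i, l i ^ 0 * w i) * (∑ j, l j ^ (a + b) * w j) +
      (∑ i, l i ^ 0 * w i) * (∑ j, l j ^ (a + b) * w j) := by
    nth_rewrite 1 [e a b]
    nth_rewrite 1 [e' a b]
    nth_rewrite 1 [e 0 (a + b)]
    nth_rewrite 1 [e' 0 (a + b)]
    simp only [← Finset.sum_add_distrib]
    refine Finset.sum_le_sum fun i _ => Finset.sum_le_sum fun j _ => ?_
    rw [← mul_add, ← mul_add]
    refine mul_le_mul_of_nonneg_left ?_ (mul_nonneg (hw0 i) (hw0 j))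
    have : 0 ≤ (l i ^ a - l j ^ a) * (l i ^ b - l j ^ b) := by
      rcases le_total (l i) (l j) with h | h
      · have h1 := pow_le_pow_left₀ (hl i) h a
        have h2 := pow_le_pow_left₀ (hl i) h b
        nlinarith
      · have h1 := pow_le_pow_left₀ (hl j) h a
        have h2 := pow_le_pow_left₀ (hl j) h b
        nlinarith
    simp only [pow_add, pow_zero, one_mul]
    nlinarith
  linarith

theorem dotProduct_pow_mulVec_nonneg {B : Matrix (Fin k) (Fin k) ℝ} (hB : B.PosSemidef) (i : ℕ)
    (x : Fin k → ℝ) : 0 ≤ x ⬝ᵥ (B ^ i) *ᵥ x := by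
  simpa using (hB.pow i).dotProduct_mulVec_nonneg x

theorem dotProduct_mul_vecMulVec_mul_mulVec (P Q : Matrix (Fin k) (Fin k) ℝ) (s : ℝ)
    (x : Fin k → ℝ) :
    x ⬝ᵥ (P * (s • Matrix.vecMulVec x x) * Q) *ᵥ x =
      s * ((x ⬝ᵥ P *ᵥ x) * (x ⬝ᵥ Q *ᵥ x)) := by
  rw [← Matrix.mulVec_mulVec, ← Matrix.mulVec_mulVec, Matrix.smul_mulVec, Matrix.vecMulVec_mulVec]
  simp only [Matrix.mulVec_smul, dotProduct_smul, smul_eq_mul, op_smul_eq_smul]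
  ring

/-- One step of the potential argument: subtracting `s x xᵀ` decreases `tr T ^ q` by almost as much
as the first-order expansion predicts. -/
theorem trace_pow_sub_le {T B : Matrix (Fin k) (Fin k) ℝ} (hT : T.IsHermitian)
    (h1 : ∀ z : Fin k → ℝ, 1 / 2 * (z ⬝ᵥ z) ≤ z ⬝ᵥ T *ᵥ z)
    (h2 : ∀ z : Fin k → ℝ, z ⬝ᵥ T *ᵥ z ≤ z ⬝ᵥ z) (hB : B.PosSemidef) {s L : ℝ} (hs : 0 ≤ s)
    {x : Fin k → ℝ} (hx : x ⬝ᵥ x ≤ L) (hBT : T - B = s • Matrix.vecMulVec x x) (q : ℕ) :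
    (B ^ q).trace ≤ (T ^ q).trace - s * q * (1 - 2 * s * q * L) * (x ⬝ᵥ (T ^ (q - 1)) *ᵥ x) := by
  obtain ⟨U, l, hU, hTU, hl⟩ := exists_eigenbasis hT h1 h2
  have hl0 : ∀ j, 0 ≤ l j := fun j => by linarith [(hl j).1]
  have hL : 0 ≤ L := (Finset.sum_nonneg fun _ _ => mul_self_nonneg _ : 0 ≤ x ⬝ᵥ x).trans hx
  have ht0 : ∀ i, 0 ≤ x ⬝ᵥ (T ^ i) *ᵥ x := by
    intro i
    rw [hTU, dotProduct_conj_diagonal_pow hU]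
    exact Finset.sum_nonneg fun j _ => mul_nonneg (pow_nonneg (hl0 j) _) (sq_nonneg _)
  have hb0 := fun i => dotProduct_pow_mulVec_nonneg hB i x
  have hstep : ∀ i, x ⬝ᵥ (T ^ i) *ᵥ x ≤ 2 * (x ⬝ᵥ (T ^ (i + 1)) *ᵥ x) := by
    intro i
    rw [hTU, dotProduct_conj_diagonal_pow hU, dotProduct_conj_diagonal_pow hU, Finset.mul_sum]
    refine Finset.sum_le_sum fun j _ => ?_
    have : 0 ≤ l j ^ i * (Uᵀ *ᵥ x) j ^ 2 := mul_nonneg (pow_nonneg (hl0 j) _) (sq_nonneg _)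
    rw [pow_succ (l j)]
    nlinarith [(hl j).1]
  -- moments of `T` and `B` differ by a convolution of moments
  have hdiff : ∀ a, x ⬝ᵥ (T ^ a) *ᵥ x - x ⬝ᵥ (B ^ a) *ᵥ x =
      ∑ i ∈ Finset.range a, s * ((x ⬝ᵥ (B ^ i) *ᵥ x) * (x ⬝ᵥ (T ^ (a - 1 - i)) *ᵥ x)) := by
    intro a
    rw [← dotProduct_sub, ← Matrix.sub_mulVec, pow_sub_pow_eq_sum, hBT, Matrix.sum_mulVec,
      dotProduct_sum]
    exact Finset.sum_congr rfl fun i _ => dotProduct_mul_vecMulVec_mul_mulVec _ _ _ _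
  have hbt : ∀ a, x ⬝ᵥ (B ^ a) *ᵥ x ≤ x ⬝ᵥ (T ^ a) *ᵥ x := by
    intro a
    rw [← sub_nonneg, hdiff]
    exact Finset.sum_nonneg fun i _ => mul_nonneg hs (mul_nonneg (hb0 _) (ht0 _))
  have hlow : ∀ a, (1 - 2 * s * (a + 1 : ℕ) * L) * (x ⬝ᵥ (T ^ a) *ᵥ x) ≤ x ⬝ᵥ (B ^ a) *ᵥ x := by
    intro a
    have : x ⬝ᵥ (T ^ a) *ᵥ x - x ⬝ᵥ (B ^ a) *ᵥ x ≤
        ∑ i ∈ Finset.range a, s * (L * (2 * (x ⬝ᵥ (T ^ a) *ᵥ x))) := by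
      rw [hdiff]
      refine Finset.sum_le_sum fun i hi => mul_le_mul_of_nonneg_left ?_ hs
      have hi' := Finset.mem_range.1 hi
      calc (x ⬝ᵥ (B ^ i) *ᵥ x) * (x ⬝ᵥ (T ^ (a - 1 - i)) *ᵥ x)
          ≤ (x ⬝ᵥ (T ^ i) *ᵥ x) * (x ⬝ᵥ (T ^ (a - 1 - i)) *ᵥ x) :=
            mul_le_mul_of_nonneg_right (hbt i) (ht0 _)
        _ ≤ (x ⬝ᵥ x) * (x ⬝ᵥ (T ^ (i + (a - 1 - i))) *ᵥ x) := by
            rw [hTU]; exact moment_mul_moment_le hU hl0 _ _ _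
        _ ≤ L * (2 * (x ⬝ᵥ (T ^ a) *ᵥ x)) := by
            have e : a = i + (a - 1 - i) + 1 := by omega
            have := hstep (i + (a - 1 - i))
            rw [← e] at this
            exact mul_le_mul hx this (ht0 _) hL
    rw [Finset.sum_const, Finset.card_range, nsmul_eq_mul] at this
    have h3 : 0 ≤ s * L * (x ⬝ᵥ (T ^ a) *ᵥ x) := mul_nonneg (mul_nonneg hs hL) (ht0 a)
    push_cast
    nlinarith
  -- mixed moments dominate the moments of `B`
  have hmix : ∀ a i, x ⬝ᵥ (B ^ (a + i)) *ᵥ x ≤ x ⬝ᵥ (T ^ a * B ^ i) *ᵥ x := by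
    intro a i
    have e : T ^ a * B ^ i - B ^ (a + i) =
        ∑ j ∈ Finset.range a, T ^ j * (s • Matrix.vecMulVec x x) * B ^ (a - 1 - j + i) := by
      have h := pow_sub_pow_eq_sum B T a
      have h' : B - T = -(s • Matrix.vecMulVec x x) := by rw [← hBT, neg_sub]
      rw [pow_add, ← sub_mul, ← neg_sub (B ^ a), h, h', ← Finset.sum_neg_distrib, Finset.sum_mul]
      refine Finset.sum_congr rfl fun j _ => ?_
      rw [pow_add]
      simp only [Matrix.mul_neg, Matrix.neg_mul, neg_neg, Matrix.mul_assoc]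
    rw [← sub_nonneg, ← dotProduct_sub, ← Matrix.sub_mulVec, e, Matrix.sum_mulVec, dotProduct_sum]
    refine Finset.sum_nonneg fun j _ => ?_
    rw [dotProduct_mul_vecMulVec_mul_mulVec]
    exact mul_nonneg hs (mul_nonneg (ht0 _) (hb0 _))
  have htr : (T ^ q).trace - (B ^ q).trace =
      ∑ i ∈ Finset.range q, s * (x ⬝ᵥ (T ^ (q - 1 - i) * B ^ i) *ᵥ x) := by
    rw [← Matrix.trace_sub, pow_sub_pow_eq_sum, hBT, Matrix.trace_sum]
    refine Finset.sum_congr rfl fun i _ => ?_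
    rw [Matrix.trace_mul_comm, ← Matrix.mul_assoc, Matrix.mul_smul, Matrix.trace_smul,
      Matrix.mul_vecMulVec, Matrix.trace_vecMulVec, dotProduct_comm, smul_eq_mul]
  have hfin : ∑ i ∈ Finset.range q, s * ((1 - 2 * s * q * L) * (x ⬝ᵥ (T ^ (q - 1)) *ᵥ x)) ≤
      (T ^ q).trace - (B ^ q).trace := by
    rw [htr]
    refine Finset.sum_le_sum fun i hi => mul_le_mul_of_nonneg_left ?_ hs
    have hi' := Finset.mem_range.1 hi
    have e1 := hlow (q - 1)
    have e2 := hmix (q - 1 - i) i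
    rw [show q - 1 + 1 = q by omega] at e1
    rw [show q - 1 - i + i = q - 1 by omega] at e2
    exact e1.trans e2
  rw [Finset.sum_const, Finset.card_range, nsmul_eq_mul] at hfin
  linarith

variable {r : ℕ} {ι : Type*}

/-- The matrix `I - s ∑ x xᵀ`, the sum over the sampled vectors.  The trace of its `q`-th power is
the potential: it is large if `∑ x xᵀ` has a small eigenvalue. -/
def residualMatrix (s : ℝ) (x : ι → Fin k → ℝ) (J : Fin r → ι) : Matrix (Fin k) (Fin k) ℝ :=
  1 - s • ∑ t, Matrix.vecMulVec (x (J t)) (x (J t))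

theorem dotProduct_residualMatrix (s : ℝ) (x : ι → Fin k → ℝ) (J : Fin r → ι) (z : Fin k → ℝ) :
    z ⬝ᵥ residualMatrix s x J *ᵥ z = z ⬝ᵥ z - s * ∑ t, (x (J t) ⬝ᵥ z) ^ 2 := by
  rw [residualMatrix, Matrix.sub_mulVec, Matrix.one_mulVec, Matrix.smul_mulVec, Matrix.sum_mulVec,
    dotProduct_sub, dotProduct_smul, dotProduct_sum, smul_eq_mul]
  congr 2
  refine Finset.sum_congr rfl fun t _ => ?_
  rw [Matrix.vecMulVec_mulVec, op_smul_eq_smul, dotProduct_smul, smul_eq_mul, dotProduct_comm z, sq]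

theorem isHermitian_residualMatrix (s : ℝ) (x : ι → Fin k → ℝ) (J : Fin r → ι) :
    (residualMatrix s x J).IsHermitian := by
  ext i j
  simp [residualMatrix, Matrix.sum_apply, Matrix.vecMulVec_apply, Matrix.one_apply, eq_comm, mul_comm]

theorem sq_dotProduct_le (x z : Fin k → ℝ) : (x ⬝ᵥ z) ^ 2 ≤ (x ⬝ᵥ x) * (z ⬝ᵥ z) := by
  have := Finset.sum_mul_sq_le_sq_mul_sq Finset.univ x z
  simpa [dotProduct, sq] using this

theorem half_le_residualMatrix {s L : ℝ} (hs : 0 ≤ s) {x : ι → Fin k → ℝ} (hx : ∀ i, x i ⬝ᵥ x i ≤ L)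
    (hr : s * r * L ≤ 1 / 2) (J : Fin r → ι) (z : Fin k → ℝ) :
    1 / 2 * (z ⬝ᵥ z) ≤ z ⬝ᵥ residualMatrix s x J *ᵥ z := by
  have hz : 0 ≤ z ⬝ᵥ z := Finset.sum_nonneg fun _ _ => mul_self_nonneg _
  have h : ∑ t, (x (J t) ⬝ᵥ z) ^ 2 ≤ ∑ _t : Fin r, L * (z ⬝ᵥ z) :=
    Finset.sum_le_sum fun t _ => (sq_dotProduct_le _ _).trans (mul_le_mul_of_nonneg_right (hx _) hz)
  rw [Finset.sum_const, Finset.card_univ, Fintype.card_fin, nsmul_eq_mul] at h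
  rw [dotProduct_residualMatrix]
  have h1 := mul_le_mul_of_nonneg_left h hs
  have h2 := mul_le_mul_of_nonneg_right hr hz
  nlinarith

theorem residualMatrix_le_one {s : ℝ} (hs : 0 ≤ s) (x : ι → Fin k → ℝ) (J : Fin r → ι)
    (z : Fin k → ℝ) : z ⬝ᵥ residualMatrix s x J *ᵥ z ≤ z ⬝ᵥ z := by
  rw [dotProduct_residualMatrix]
  have : 0 ≤ s * ∑ t, (x (J t) ⬝ᵥ z) ^ 2 := mul_nonneg hs (Finset.sum_nonneg fun _ _ => sq_nonneg _)
  linarith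

variable [Fintype ι] {p : ι → ℝ}

/-- The expected potential decreases by a constant factor with every isotropic sample. -/
theorem sampleMean_trace_residualMatrix_pow_le (hp0 : ∀ i, 0 ≤ p i) (hp : ∑ i, p i = 1)
    {x : ι → Fin k → ℝ} (hiso : ∑ i, p i • Matrix.vecMulVec (x i) (x i) = 1)
    {s L : ℝ} (hs : 0 ≤ s) (hx : ∀ i, x i ⬝ᵥ x i ≤ L) (hL : 0 ≤ L) {q : ℕ} (hq : 1 ≤ q)
    (hsq : s * q ≤ 1) (hsqL : 2 * s * q * L ≤ 1) (r : ℕ) (hr : s * r * L ≤ 1 / 2) :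
    sampleMean p r (fun J => ((residualMatrix s x J) ^ q).trace) ≤
      k * (1 - s * q * (1 - 2 * s * q * L)) ^ r := by
  induction r with
  | zero => simp [sampleMean_zero, residualMatrix]
  | succ r ih =>
    have hr' : s * r * L ≤ 1 / 2 := by
      refine le_trans ?_ hr
      push_cast
      nlinarith [mul_nonneg hs hL]
    have hc : 0 ≤ 1 - s * q * (1 - 2 * s * q * L) := by
      have : 0 ≤ s * q := by positivity
      have : 0 ≤ 2 * s * q * L := by positivity
      nlinarith
    rw [sampleMean_succ]
    have hstep : ∀ J : Fin r → ι,
        ∑ i, p i * ((residualMatrix s x (Fin.cons i J : Fin (r + 1) → ι)) ^ q).trace ≤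
          (1 - s * q * (1 - 2 * s * q * L)) * ((residualMatrix s x J) ^ q).trace := by
      intro J
      have hT := isHermitian_residualMatrix s x J
      have hT1 := half_le_residualMatrix hs hx hr' J
      have hT2 := residualMatrix_le_one hs x J
      set T := residualMatrix s x J with hTdef
      have h1 : ∀ i, p i * ((residualMatrix s x (Fin.cons i J : Fin (r + 1) → ι)) ^ q).trace ≤
          p i * (T ^ q).trace - s * q * (1 - 2 * s * q * L) * (p i * (x i ⬝ᵥ (T ^ (q - 1)) *ᵥ x i)) := by
        intro i
        have hB : (residualMatrix s x (Fin.cons i J : Fin (r + 1) → ι)).PosSemidef := by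
          refine Matrix.PosSemidef.of_dotProduct_mulVec_nonneg (isHermitian_residualMatrix _ _ _)
            fun z => ?_
          have := half_le_residualMatrix hs hx hr (Fin.cons i J : Fin (r + 1) → ι) z
          have hz : 0 ≤ z ⬝ᵥ z := Finset.sum_nonneg fun _ _ => mul_self_nonneg _
          rw [star_trivial]
          linarith
        have hBT : T - residualMatrix s x (Fin.cons i J : Fin (r + 1) → ι) =
            s • Matrix.vecMulVec (x i) (x i) := by
          simp only [hTdef, residualMatrix, Fin.sum_univ_succ, Fin.cons_zero, Fin.cons_succ, smul_add]
          abel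
        have := mul_le_mul_of_nonneg_left (trace_pow_sub_le hT hT1 hT2 hB hs (hx i) hBT q) (hp0 i)
        linarith
      have h2 := Finset.sum_le_sum fun i (_ : i ∈ Finset.univ) => h1 i
      rw [Finset.sum_sub_distrib, ← Finset.sum_mul, hp, ← Finset.mul_sum] at h2
      have h3 : ∑ i, p i * (x i ⬝ᵥ (T ^ (q - 1)) *ᵥ x i) = (T ^ (q - 1)).trace := by
        have e : (T ^ (q - 1)).trace =
            (T ^ (q - 1) * ∑ i, p i • Matrix.vecMulVec (x i) (x i)).trace := by
          rw [hiso, Matrix.mul_one]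
        rw [e, Matrix.mul_sum, Matrix.trace_sum]
        refine Finset.sum_congr rfl fun i _ => ?_
        rw [Matrix.mul_smul, Matrix.trace_smul, Matrix.mul_vecMulVec,
          Matrix.trace_vecMulVec, dotProduct_comm, smul_eq_mul]
      have h4 : (T ^ q).trace ≤ (T ^ (q - 1)).trace := by
        obtain ⟨U, l, hU, hTU, hl⟩ := exists_eigenbasis hT hT1 hT2
        rw [hTU, trace_conj_diagonal_pow hU, trace_conj_diagonal_pow hU]
        exact Finset.sum_le_sum fun j _ =>
          pow_le_pow_of_le_one (by linarith [(hl j).1]) (hl j).2 (by omega)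
      rw [h3] at h2
      have h5 : 0 ≤ s * q * (1 - 2 * s * q * L) := mul_nonneg (by positivity) (by linarith)
      nlinarith [mul_le_mul_of_nonneg_left h4 h5]
    calc _ ≤ sampleMean p r (fun J =>
          (1 - s * q * (1 - 2 * s * q * L)) * ((residualMatrix s x J) ^ q).trace) :=
          sampleMean_mono hp0 hstep
      _ ≤ _ := by
          rw [sampleMean_const_mul, pow_succ]
          have := mul_le_mul_of_nonneg_left (ih hr') hc
          linarith

open Classical in
/-- The lower tail of the least eigenvalue of a sum of independent, isotropic and bounded rank-one
matrices.  The bound is that of the matrix Chernoff inequality up to the constant in the exponent. -/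
theorem sampleMean_exists_lt_le (hp0 : ∀ i, 0 ≤ p i) (hp : ∑ i, p i = 1)
    {x : ι → Fin k → ℝ} (hiso : ∑ i, p i • Matrix.vecMulVec (x i) (x i) = 1)
    {L η : ℝ} (hx : ∀ i, x i ⬝ᵥ x i ≤ L) (hL : 1 ≤ L) (hη : 0 < η) (hη1 : η ≤ 1) (r : ℕ) :
    sampleMean p r (fun J => if ∃ z : Fin k → ℝ,
        ∑ t, (x (J t) ⬝ᵥ z) ^ 2 < (1 - η) * r * (z ⬝ᵥ z) then 1 else 0) ≤
      k * Real.exp (-(η ^ 2 * r / (8 * L))) := by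
  set P := sampleMean p r (fun J => if ∃ z : Fin k → ℝ,
        ∑ t, (x (J t) ⬝ᵥ z) ^ 2 < (1 - η) * r * (z ⬝ᵥ z) then (1 : ℝ) else 0) with hP
  set y := η * (1 - η) * r / (4 * L) with hy
  have hL0 : 0 < L := by linarith
  have hy0 : 0 ≤ y := by
    have : 0 ≤ 1 - η := by linarith
    positivity
  -- the bound for a fixed large exponent `q`, with the step size `s = η / (4 q L)`
  have hq : ∀ᶠ q : ℕ in Filter.atTop,
      P * (1 + -y / q) ^ q ≤ k * Real.exp (-(η * (1 - η / 2) * r / (4 * L))) := by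
    filter_upwards [Filter.eventually_ge_atTop (r + 1)] with q hq
    have hq0 : (0 : ℝ) < q := by exact_mod_cast (by omega : 0 < q)
    have hrq : (r : ℝ) ≤ q := by exact_mod_cast (by omega : r ≤ q)
    set s := η / (4 * q * L) with hs
    have hs0 : 0 ≤ s := by positivity
    have hsq : s * q = η / (4 * L) := by rw [hs]; field_simp
    have hsqL : 2 * s * q * L = η / 2 := by rw [hs]; field_simp; ring
    have hsr : s * r * L ≤ 1 / 2 := by
      have : s * r * L ≤ s * q * L := by gcongr
      nlinarith
    have h1 := sampleMean_trace_residualMatrix_pow_le hp0 hp hiso hs0 hx hL0.le (by omega : 1 ≤ q)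
      (by rw [hsq, div_le_one (by positivity)]; linarith) (by rw [hsqL]; linarith) r hsr
    rw [hsqL, hsq] at h1
    have h2 : (1 - η / (4 * L) * (1 - η / 2)) ^ r ≤
        Real.exp (-(η * (1 - η / 2) * r / (4 * L))) := by
      have e : -(η * (1 - η / 2) * r / (4 * L)) = r * -(η / (4 * L) * (1 - η / 2)) := by ring
      rw [e, Real.exp_nat_mul]
      refine pow_le_pow_left₀ ?_ ?_ r
      · have : η / (4 * L) ≤ 1 := by rw [div_le_one (by positivity)]; linarith
        have : 0 ≤ η / (4 * L) := by positivity
        nlinarith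
      · have := Real.add_one_le_exp (-(η / (4 * L) * (1 - η / 2)))
        linarith
    refine le_trans ?_ (h1.trans (mul_le_mul_of_nonneg_left h2 (Nat.cast_nonneg k)))
    rw [mul_comm, hP, ← sampleMean_const_mul]
    refine sampleMean_mono hp0 fun J => ?_
    have hT := isHermitian_residualMatrix s x J
    have hT1 := half_le_residualMatrix hs0 hx hsr J
    have hT2 := residualMatrix_le_one hs0 x J
    obtain ⟨U, l, hU, hTU, hl⟩ := exists_eigenbasis hT hT1 hT2
    have hl0 : ∀ j, 0 ≤ l j := fun j => by linarith [(hl j).1]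
    have htr : ((residualMatrix s x J) ^ q).trace = ∑ j, l j ^ q := by
      rw [hTU, trace_conj_diagonal_pow hU]
    rw [htr]
    split_ifs with hJ
    · obtain ⟨z, hz⟩ := hJ
      have hbig : (1 + -y / q) * (z ⬝ᵥ z) < z ⬝ᵥ residualMatrix s x J *ᵥ z := by
        rw [dotProduct_residualMatrix]
        have hs1 : 0 < s := by positivity
        have h3 := mul_lt_mul_of_pos_left hz hs1
        have e : y / q = s * ((1 - η) * r) := by rw [hy, hs]; field_simp
        have : (1 + -y / q) * (z ⬝ᵥ z) = z ⬝ᵥ z - s * ((1 - η) * r * (z ⬝ᵥ z)) := by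
          rw [neg_div, e]; ring
        linarith
      have hexp := dotProduct_conj_diagonal_pow (l := l) hU 1 z
      rw [pow_one, ← hTU] at hexp
      have hexp0 := dotProduct_conj_diagonal_pow (l := l) hU 0 z
      simp only [pow_zero, Matrix.one_mulVec, one_mul] at hexp0
      rw [hexp, hexp0, Finset.mul_sum] at hbig
      obtain ⟨j, -, hj⟩ := Finset.exists_lt_of_sum_lt hbig
      have hlj : 1 + -y / q ≤ l j := by
        by_contra! hcon
        have := mul_le_mul_of_nonneg_right hcon.le (sq_nonneg ((Uᵀ *ᵥ z) j))
        rw [pow_one] at hj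
        linarith
      have hnn : 0 ≤ 1 + -y / q := by
        rw [neg_div, ← sub_eq_add_neg, sub_nonneg, div_le_one hq0]
        refine le_trans ?_ hrq
        rw [hy, div_le_iff₀ (by positivity)]
        have : η * (1 - η) ≤ 1 := by nlinarith
        have hr0 : (0 : ℝ) ≤ r := Nat.cast_nonneg r
        nlinarith
      rw [mul_one]
      exact (pow_le_pow_left₀ hnn hlj q).trans
        (Finset.single_le_sum (f := fun j => l j ^ q) (fun i _ => pow_nonneg (hl0 i) q)
          (Finset.mem_univ j))
    · rw [mul_zero]
      exact Finset.sum_nonneg fun j _ => pow_nonneg (hl0 j) q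
  -- in the limit `q → ∞` the left-hand side becomes `P * exp (-y)`
  have hlim : Filter.Tendsto (fun q : ℕ => P * (1 + -y / q) ^ q) Filter.atTop
      (nhds (P * Real.exp (-y))) :=
    (Real.tendsto_one_add_div_pow_exp (-y)).const_mul P
  have hfin := le_of_tendsto hlim hq
  have e : k * Real.exp (-(η ^ 2 * r / (8 * L))) * Real.exp (-y) =
      k * Real.exp (-(η * (1 - η / 2) * r / (4 * L))) := by
    rw [mul_assoc, ← Real.exp_add]
    congr 2
    rw [hy]; field_simp; ring
  rw [← e] at hfin
  exact le_of_mul_le_mul_right hfin (Real.exp_pos _)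

end LowerTail

/-! ### Cluster indicator matrices -/

section Indicator

open Matrix

theorem IsIndicatorMatrix.transpose_mul_self {m k : ℕ} {X : Matrix (Fin m) (Fin k) ℝ}
    (hX : IsIndicatorMatrix X) : Xᵀ * X = 1 := by
  obtain ⟨f, hf, hX⟩ := hX
  ext a b
  rw [Matrix.mul_apply]
  simp only [Matrix.transpose_apply, hX]
  by_cases hab : a = b
  · subst hab
    rw [Matrix.one_apply_eq]
    have hpos : 0 < (Finset.univ.filter fun i => f i = a).card := by
      obtain ⟨i, hi⟩ := hf a
      exact Finset.card_pos.2 ⟨i, by simp [hi]⟩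
    have hpos' : (0 : ℝ) < (Finset.univ.filter fun i => f i = a).card := by exact_mod_cast hpos
    set c : ℝ := ((Finset.univ.filter fun i => f i = a).card : ℝ) with hc
    have : ∀ i, ((if f i = a then 1 / √c else 0) * if f i = a then 1 / √c else 0) =
        if f i = a then 1 / c else 0 := by
      intro i
      split_ifs
      · rw [div_mul_div_comm, one_mul, Real.mul_self_sqrt hpos'.le]
      · simp
    simp only [this]
    rw [← Finset.sum_filter, Finset.sum_const, nsmul_eq_mul, ← hc]
    field_simp
  · rw [Matrix.one_apply_ne hab]
    refine Finset.sum_eq_zero fun i _ => ?_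
    by_cases h : f i = a
    · have : f i ≠ b := fun h' => hab (h.symm.trans h')
      simp [this]
    · simp [h]

instance finite_indicatorMatrix (m k : ℕ) : Finite (IndicatorMatrix m k) := by
  have h : {X : Matrix (Fin m) (Fin k) ℝ | IsIndicatorMatrix X} ⊆
      Set.range fun f : Fin m → Fin k => (Matrix.of fun i j =>
        if f i = j then 1 / √((Finset.univ.filter fun i' => f i' = j).card : ℝ) else 0) := by
    rintro X ⟨f, -, hf⟩
    exact ⟨f, by ext i j; rw [hf]; rfl⟩
  exact (Set.finite_range _).subset h

theorem nonempty_indicatorMatrix {m k : ℕ} (hk : 1 ≤ k) (hkm : k ≤ m) :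
    Nonempty (IndicatorMatrix m k) := by
  have : NeZero k := ⟨by omega⟩
  refine ⟨⟨Matrix.of fun i j => _, fun i => Fin.ofNat k i.1, ?_, fun i j => rfl⟩⟩
  intro j
  exact ⟨⟨j.1, j.2.trans_le hkm⟩, by ext; simp⟩

theorem cost_nonneg {m n k : ℕ} (A : Matrix (Fin m) (Fin n) ℝ) (X : Matrix (Fin m) (Fin k) ℝ) :
    0 ≤ cost A X := frobSq_nonneg _

theorem optCost_le {m n k : ℕ} (A : Matrix (Fin m) (Fin n) ℝ) (X : IndicatorMatrix m k) :
    optCost A k ≤ cost A X.1 :=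
  ciInf_le (Set.finite_range _).bddBelow X

theorem exists_cost_eq_optCost {m n k : ℕ} (hk : 1 ≤ k) (hkm : k ≤ m)
    (A : Matrix (Fin m) (Fin n) ℝ) : ∃ X : IndicatorMatrix m k, cost A X.1 = optCost A k := by
  have := nonempty_indicatorMatrix hk hkm
  exact exists_eq_ciInf_of_finite

end Indicator

/-! ### The clustering on the sampled columns -/

section Quality

open Matrix

variable {m n k r : ℕ}

/-- The matrix `N Ω S` of the sampled and rescaled columns of `N`. -/
def sampledColumns (p : Fin n → ℝ) (N : Matrix (Fin m) (Fin n) ℝ) (J : Fin r → Fin n) :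
    Matrix (Fin m) (Fin r) ℝ :=
  Matrix.of fun i t => N i (J t) * (1 / √(r * p (J t)))

/-- The matrix `Ω S`. -/
def samplingMatrix (p : Fin n → ℝ) (J : Fin r → Fin n) : Matrix (Fin n) (Fin r) ℝ :=
  Matrix.of fun i t => (if i = J t then 1 else 0) * (1 / √(r * p (J t)))

theorem mul_samplingMatrix (p : Fin n → ℝ) (N : Matrix (Fin m) (Fin n) ℝ) (J : Fin r → Fin n) :
    N * samplingMatrix p J = sampledColumns p N J := by
  ext i t
  simp [samplingMatrix, sampledColumns, Matrix.mul_apply, ite_mul]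

theorem sum_mul_le_young (P Q : Matrix (Fin m) (Fin n) ℝ) {c : ℝ} (hc : 0 < c) :
    ∑ i, ∑ j, P i j * Q i j ≤ c / 2 * frobSq P + 1 / (2 * c) * frobSq Q := by
  simp only [frobSq, Finset.mul_sum, ← Finset.sum_add_distrib]
  refine Finset.sum_le_sum fun i _ => Finset.sum_le_sum fun j _ => ?_
  have h : 0 ≤ (c * P i j - Q i j) ^ 2 / (2 * c) := by positivity
  have e : c / 2 * P i j ^ 2 + 1 / (2 * c) * Q i j ^ 2 - P i j * Q i j =
      (c * P i j - Q i j) ^ 2 / (2 * c) := by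
    field_simp; ring
  linarith

theorem trace_mul_transpose_eq_sum (P Q : Matrix (Fin m) (Fin n) ℝ) :
    (P * Qᵀ).trace = ∑ i, ∑ j, P i j * Q i j := by
  simp [Matrix.trace, Matrix.mul_apply]

/-- If `M Mᵀ` is well-conditioned, then `K` is controlled by the two terms of the right-hand side
of `K M Mᵀ = C Mᵀ - e`. -/
theorem frobSq_le_of_mul_eq {K e : Matrix (Fin m) (Fin k) ℝ} {M : Matrix (Fin k) (Fin r) ℝ}
    {C : Matrix (Fin m) (Fin r) ℝ} (h : K * M * Mᵀ = C * Mᵀ - e)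
    (hM : ∀ z : Fin k → ℝ, 0.9 * (z ⬝ᵥ z) ≤ ∑ t, (z ᵥ* M) t ^ 2) :
    frobSq K ≤ 1.25 * frobSq C + 12.5 * frobSq e := by
  have h1 : frobSq (K * M) = (∑ i, ∑ j, C i j * (K * M) i j) + ∑ i, ∑ j, e i j * (-K) i j := by
    rw [← trace_mul_transpose_eq_sum, ← trace_mul_transpose_eq_sum, frobSq_eq_trace,
      Matrix.transpose_mul, ← Matrix.mul_assoc, h, Matrix.sub_mul, Matrix.trace_sub,
      Matrix.transpose_neg, Matrix.mul_neg, Matrix.trace_neg, Matrix.mul_assoc C]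
    ring
  -- the weights leave `(0.9 / 2 - 1 / 20) ‖K‖² = 0.4 ‖K‖²` on the left-hand side
  have h2 := sum_mul_le_young C (K * M) one_pos
  have h3 := sum_mul_le_young e (-K) (c := 10) (by norm_num)
  rw [frobSq_neg] at h3
  have h4 : 0.9 * frobSq K ≤ frobSq (K * M) := by
    simp only [frobSq, Finset.mul_sum]
    refine Finset.sum_le_sum fun i _ => ?_
    have := hM (K i)
    simp only [dotProduct, Finset.mul_sum] at this
    simp only [sq] at this ⊢
    exact this
  linarith

variable {Z : Matrix (Fin n) (Fin k) ℝ}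

theorem frobSq_of_orthonormal (hZ : Zᵀ * Z = 1) : frobSq Z = k := by
  rw [← frobSq_transpose, frobSq_eq_trace, Matrix.transpose_transpose, hZ]; simp

theorem samplingProb_nonneg (Z : Matrix (Fin n) (Fin k) ℝ) (i : Fin n) : 0 ≤ samplingProb Z i :=
  div_nonneg (Finset.sum_nonneg fun _ _ => sq_nonneg _) (frobSq_nonneg Z)

theorem sum_samplingProb (hk : 1 ≤ k) (hZ : Zᵀ * Z = 1) : ∑ i, samplingProb Z i = 1 := by
  have hk0 : (0 : ℝ) < k := by exact_mod_cast hk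
  have h : (∑ i, ∑ j, Z i j ^ 2) / frobSq Z = 1 :=
    div_self (by rw [← frobSq, frobSq_of_orthonormal hZ]; exact hk0.ne')
  rw [← h, Finset.sum_div]
  rfl

theorem samplingProb_mul (hk : 1 ≤ k) (hZ : Zᵀ * Z = 1) (i : Fin n) :
    k * samplingProb Z i = ∑ j, Z i j ^ 2 := by
  have : (0 : ℝ) < k := by exact_mod_cast hk
  rw [samplingProb, frobSq_of_orthonormal hZ]
  field_simp

theorem eq_zero_of_samplingProb_eq_zero (hk : 1 ≤ k) (hZ : Zᵀ * Z = 1) {i : Fin n}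
    (h : samplingProb Z i = 0) (j : Fin k) : Z i j = 0 := by
  have h1 := samplingProb_mul hk hZ i
  rw [h, mul_zero] at h1
  have := (Finset.sum_eq_zero_iff_of_nonneg (fun _ _ => sq_nonneg _)).1 h1.symm j (Finset.mem_univ j)
  simpa using this

theorem inv_sqrt_sq (r : ℕ) {p : ℝ} (hp : 0 ≤ p) : (1 / √(r * p)) ^ 2 = 1 / (r * p) := by
  rw [div_pow, one_pow, Real.sq_sqrt (by positivity)]

/-- Sampling does not increase the squared Frobenius norm in expectation.  There is equality up to
the columns of weight zero, which are never sampled. -/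
theorem sampleMean_frobSq_sampledColumns_le {p : Fin n → ℝ} (hp0 : ∀ i, 0 ≤ p i)
    (hp : ∑ i, p i = 1) (hr : 1 ≤ r) (N : Matrix (Fin m) (Fin n) ℝ) :
    sampleMean p r (fun J => frobSq (sampledColumns p N J)) ≤ frobSq N := by
  have hr0 : (0 : ℝ) < r := by exact_mod_cast hr
  have h : ∀ J : Fin r → Fin n, frobSq (sampledColumns p N J) =
      ∑ t, (fun i => ∑ a, N a i ^ 2 * (1 / (r * p i))) (J t) := by
    intro J
    simp only [frobSq, sampledColumns, Matrix.of_apply, mul_pow, inv_sqrt_sq r (hp0 _)]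
    exact Finset.sum_comm
  rw [funext h, sampleMean_sum hp (fun i => ∑ a, N a i ^ 2 * (1 / (r * p i))), frobSq,
    Finset.sum_comm, Finset.mul_sum]
  refine Finset.sum_le_sum fun i _ => ?_
  rw [Finset.mul_sum, Finset.mul_sum]
  refine Finset.sum_le_sum fun a _ => ?_
  rcases (hp0 i).eq_or_lt with h0 | h0
  · rw [← h0]; simp; positivity
  · refine le_of_eq ?_
    field_simp

/-- The sampled version of a product `E Z = 0` is small in expectation, as its entries are sums of
independent centred terms. -/
theorem sampleMean_frobSq_sampledColumns_mul_le (hk : 1 ≤ k) (hZ : Zᵀ * Z = 1) (hr : 1 ≤ r)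
    {E : Matrix (Fin m) (Fin n) ℝ} (hE : E * Z = 0) :
    sampleMean (samplingProb Z) r (fun J => frobSq (sampledColumns (samplingProb Z) E J *
      (sampledColumns (samplingProb Z) Zᵀ J)ᵀ)) ≤ k / r * frobSq E := by
  have hr0 : (0 : ℝ) < r := by exact_mod_cast hr
  have hp0 := samplingProb_nonneg Z
  have hp1 := sum_samplingProb hk hZ
  have hpk := samplingProb_mul hk hZ
  have hpz := fun i => eq_zero_of_samplingProb_eq_zero (i := i) hk hZ
  set p := samplingProb Z
  set y : Fin m → Fin k → Fin n → ℝ := fun a j i => E a i * Z i j * (1 / (r * p i)) with hy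
  have h : ∀ J : Fin r → Fin n, frobSq (sampledColumns p E J * (sampledColumns p Zᵀ J)ᵀ) =
      ∑ a, ∑ j, (∑ t, y a j (J t)) ^ 2 := by
    intro J
    simp only [frobSq, Matrix.mul_apply]
    refine Finset.sum_congr rfl fun a _ => Finset.sum_congr rfl fun j _ => ?_
    congr 1
    refine Finset.sum_congr rfl fun t _ => ?_
    simp only [sampledColumns, Matrix.transpose_apply, Matrix.of_apply, hy]
    rw [← inv_sqrt_sq r (hp0 _)]
    ring
  have hpy : ∀ a j i, p i * y a j i = E a i * Z i j / r := by
    intro a j i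
    rcases (hp0 i).eq_or_lt with h0 | h0
    · rw [hpz i h0.symm j, ← h0]; simp
    · simp only [hy]; field_simp
  have hmean : ∀ a j, ∑ i, p i * y a j i = 0 := by
    intro a j
    simp only [hpy]
    rw [← Finset.sum_div]
    have := congrFun (congrFun hE a) j
    rw [Matrix.mul_apply] at this
    rw [this]; simp
  simp only [h, sampleMean_finset_sum]
  simp only [sampleMean_sum_sq hp1 (hmean _ _)]
  rw [frobSq, Finset.mul_sum]
  refine Finset.sum_le_sum fun a _ => ?_
  rw [← Finset.mul_sum, Finset.sum_comm, Finset.mul_sum, Finset.mul_sum]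
  refine Finset.sum_le_sum fun i _ => ?_
  have e : ∀ j, p i * y a j i ^ 2 = E a i ^ 2 * (1 / r) * (1 / (r * p i)) * Z i j ^ 2 := by
    intro j
    rw [sq, ← mul_assoc, hpy]
    simp only [hy]; ring
  simp only [e]
  rw [← Finset.mul_sum, ← hpk]
  rcases (hp0 i).eq_or_lt with h0 | h0
  · rw [← h0]; simp; positivity
  · refine le_of_eq ?_
    field_simp

/-- The rows of `Z`, rescaled to an isotropic random vector (zero if the row is zero). -/
def isotropicRow (Z : Matrix (Fin n) (Fin k) ℝ) (i : Fin n) : Fin k → ℝ :=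
  (1 / √(samplingProb Z i)) • Z i

theorem isotropicRow_dotProduct_self_le (hk : 1 ≤ k) (hZ : Zᵀ * Z = 1) (i : Fin n) :
    isotropicRow Z i ⬝ᵥ isotropicRow Z i ≤ k := by
  have e : isotropicRow Z i ⬝ᵥ isotropicRow Z i =
      1 / samplingProb Z i * (k * samplingProb Z i) := by
    rw [isotropicRow, smul_dotProduct, dotProduct_smul, smul_eq_mul, smul_eq_mul, ← mul_assoc,
      samplingProb_mul hk hZ, div_mul_div_comm, one_mul, Real.mul_self_sqrt (samplingProb_nonneg Z i)]
    simp [dotProduct, sq]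
  rw [e]
  rcases (samplingProb_nonneg Z i).eq_or_lt with h0 | h0
  · rw [← h0]; simp
  · refine le_of_eq ?_
    field_simp

theorem sum_vecMulVec_isotropicRow (hk : 1 ≤ k) (hZ : Zᵀ * Z = 1) :
    ∑ i, samplingProb Z i • Matrix.vecMulVec (isotropicRow Z i) (isotropicRow Z i) = 1 := by
  rw [← hZ]
  ext a b
  rw [Matrix.sum_apply, Matrix.mul_apply]
  refine Finset.sum_congr rfl fun i _ => ?_
  simp only [Matrix.smul_apply, Matrix.vecMulVec_apply, isotropicRow, Pi.smul_apply, smul_eq_mul,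
    Matrix.transpose_apply]
  rcases (samplingProb_nonneg Z i).eq_or_lt with h0 | h0
  · rw [← h0, eq_zero_of_samplingProb_eq_zero hk hZ h0.symm a]; simp
  · have := Real.mul_self_sqrt h0.le
    have h1 : √(samplingProb Z i) ≠ 0 := (Real.sqrt_pos.2 h0).ne'
    field_simp
    rw [sq, this]

theorem sum_vecMul_sampledColumns_sq (hr : 1 ≤ r) (J : Fin r → Fin n) (z : Fin k → ℝ) :
    ∑ t, (z ᵥ* sampledColumns (samplingProb Z) Zᵀ J) t ^ 2 =
      (∑ t, (isotropicRow Z (J t) ⬝ᵥ z) ^ 2) / r := by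
  rw [Finset.sum_div]
  refine Finset.sum_congr rfl fun t _ => ?_
  have e : (z ᵥ* sampledColumns (samplingProb Z) Zᵀ J) t =
      (1 / √(r * samplingProb Z (J t))) * (Z (J t) ⬝ᵥ z) := by
    simp only [Matrix.vecMul, dotProduct, sampledColumns, Matrix.of_apply, Matrix.transpose_apply,
      Finset.mul_sum]
    exact Finset.sum_congr rfl fun j _ => by ring
  rw [e, isotropicRow, smul_dotProduct, smul_eq_mul, mul_pow, mul_pow,
    inv_sqrt_sq r (samplingProb_nonneg _ _), div_pow, one_pow,
    Real.sq_sqrt (samplingProb_nonneg _ _)]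
  have hr0 : (0 : ℝ) < r := by exact_mod_cast hr
  field_simp

/-- The clustering cost on all columns is controlled by the cost on the sampled columns, if sampling
decreases the squared norms of vectors in the column space of `Z` by at most a tenth.  This holds for
all clusterings `X` at once, as the condition does not involve `X`. -/
theorem cost_le_of_sample (hZ : Zᵀ * Z = 1) (hr : 1 ≤ r) (A : Matrix (Fin m) (Fin n) ℝ)
    {X : Matrix (Fin m) (Fin k) ℝ} (hX : Xᵀ * X = 1) (J : Fin r → Fin n)
    (hJ : ∀ z : Fin k → ℝ, 0.9 * r * (z ⬝ᵥ z) ≤ ∑ t, (isotropicRow Z (J t) ⬝ᵥ z) ^ 2) :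
    cost A X ≤ 1.25 * cost (sampledColumns (samplingProb Z) A J) X +
      12.5 * frobSq (sampledColumns (samplingProb Z) (A - A * Z * Zᵀ) J *
        (sampledColumns (samplingProb Z) Zᵀ J)ᵀ) + frobSq (A - A * Z * Zᵀ) := by
  have hr0 : (0 : ℝ) < r := by exact_mod_cast hr
  set p := samplingProb Z
  set E := A - A * Z * Zᵀ with hE
  have h1 := frobSq_eq_add_right hZ (A - X * Xᵀ * A)
  have h2 : A - X * Xᵀ * A - (A - X * Xᵀ * A) * Z * Zᵀ = E - X * Xᵀ * E := by
    rw [hE]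
    simp only [Matrix.sub_mul, Matrix.mul_sub, Matrix.mul_assoc]
    abel
  have h3 := frobSq_sub_proj_le hX E
  have h4 : frobSq ((A - X * Xᵀ * A) * Z) ≤
      1.25 * frobSq (sampledColumns p A J - X * Xᵀ * sampledColumns p A J) +
      12.5 * frobSq (sampledColumns p E J * (sampledColumns p Zᵀ J)ᵀ -
        X * Xᵀ * (sampledColumns p E J * (sampledColumns p Zᵀ J)ᵀ)) := by
    refine frobSq_le_of_mul_eq (M := sampledColumns p Zᵀ J) ?_ ?_
    · have hAD : sampledColumns p A J = A * Z * sampledColumns p Zᵀ J + sampledColumns p E J := by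
        simp only [← mul_samplingMatrix, hE, Matrix.sub_mul, Matrix.mul_assoc]
        abel
      rw [hAD]
      simp only [Matrix.sub_mul, Matrix.mul_add, Matrix.add_mul, Matrix.mul_assoc]
      abel
    · intro z
      rw [sum_vecMul_sampledColumns_sq hr, le_div_iff₀ hr0]
      have := hJ z
      linarith
  have h5 := frobSq_sub_proj_le hX (sampledColumns p E J * (sampledColumns p Zᵀ J)ᵀ)
  rw [h2] at h1
  simp only [cost]
  linarith

open Classical in
/-- For fixed `Z`, the probability that some nearly optimal clustering of the sampled columns is a
bad clustering of `A`.  Here `F` is an upper bound of the optimal cost, and `F + h` one of the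
error of the approximation of `A` by its projection to the columns of `Z`. -/
theorem sampleMean_exists_bad_le (hk : 1 ≤ k) (hkm : k ≤ m) (hZ : Zᵀ * Z = 1) (hr : 1 ≤ r)
    (A : Matrix (Fin m) (Fin n) ℝ) {ε γ F h : ℝ} (hε : 0 < ε) (hγ : 1 ≤ γ) (hF : 0 < F)
    (hF' : optCost A k ≤ F) (hh : 0 ≤ h) (hE : frobSq (A - A * Z * Zᵀ) ≤ F + h) :
    sampleMean (samplingProb Z) r (fun J => if ∃ X : IndicatorMatrix m k,
        cost (sampledColumns (samplingProb Z) A J) X.1 ≤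
          γ * optCost (sampledColumns (samplingProb Z) A J) k ∧
        ¬ cost A X.1 ≤ (1 + (2 + ε) * γ) * F then 1 else 0) ≤
      k * Real.exp (-(0.1 ^ 2 * r / (8 * k))) +
        (1.25 * F + 12.5 * (k / r * (F + h)) + h) / ((2 + ε) * F) := by
  have hp0 := samplingProb_nonneg Z
  have hp1 := sum_samplingProb hk hZ
  have hk1 : (1 : ℝ) ≤ k := by exact_mod_cast hk
  have htail := sampleMean_exists_lt_le (r := r) hp0 hp1 (sum_vecMulVec_isotropicRow hk hZ)
    (isotropicRow_dotProduct_self_le hk hZ) hk1 (η := 0.1) (by norm_num) (by norm_num)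
  obtain ⟨X₀, hX₀⟩ := exists_cost_eq_optCost hk hkm A
  set p := samplingProb Z with hp
  set E := A - A * Z * Zᵀ with hEdef
  have hEZ : E * Z = 0 := by
    rw [hEdef, Matrix.sub_mul, Matrix.mul_assoc (A * Z), hZ, Matrix.mul_one, sub_self]
  have hW := sampleMean_frobSq_sampledColumns_le hp0 hp1 hr (A - X₀.1 * X₀.1ᵀ * A)
  have hV := sampleMean_frobSq_sampledColumns_mul_le hk hZ hr hEZ
  set W : (Fin r → Fin n) → ℝ := fun J => frobSq (sampledColumns p (A - X₀.1 * X₀.1ᵀ * A) J)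
    with hWdef
  set V : (Fin r → Fin n) → ℝ :=
    fun J => frobSq (sampledColumns p E J * (sampledColumns p Zᵀ J)ᵀ) with hVdef
  have hD : 0 < (2 + ε) * F := by positivity
  -- Markov's inequality, pointwise
  have hpt : ∀ J : Fin r → Fin n, (if ∃ X : IndicatorMatrix m k,
        cost (sampledColumns p A J) X.1 ≤ γ * optCost (sampledColumns p A J) k ∧
        ¬ cost A X.1 ≤ (1 + (2 + ε) * γ) * F then (1 : ℝ) else 0) ≤
      (if ∃ z : Fin k → ℝ, ∑ t, (isotropicRow Z (J t) ⬝ᵥ z) ^ 2 < (1 - 0.1) * r * (z ⬝ᵥ z)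
        then 1 else 0) + ((1.25 / ((2 + ε) * F)) * W J + ((12.5 / ((2 + ε) * F)) * V J +
          h / ((2 + ε) * F))) := by
    intro J
    have e : (1.25 / ((2 + ε) * F)) * W J + ((12.5 / ((2 + ε) * F)) * V J + h / ((2 + ε) * F)) =
        (1.25 * W J + 12.5 * V J + h) / ((2 + ε) * F) := by ring
    have hW0 : 0 ≤ W J := frobSq_nonneg _
    have hV0 : 0 ≤ V J := frobSq_nonneg _
    have hnn : 0 ≤ (1.25 * W J + 12.5 * V J + h) / ((2 + ε) * F) := by positivity
    rw [e]
    split_ifs with h1 h2 h2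
    · linarith
    · rw [zero_add, le_div_iff₀ hD, one_mul]
      obtain ⟨X, hX1, hX2⟩ := h1
      push Not at h2 hX2
      have h3 := cost_le_of_sample hZ hr A X.2.transpose_mul_self J (fun z => by
        have := h2 z; norm_num at this ⊢; exact this)
      have h4 : cost (sampledColumns p A J) X.1 ≤ γ * W J := by
        refine hX1.trans (mul_le_mul_of_nonneg_left ?_ (by linarith))
        refine (optCost_le _ X₀).trans (le_of_eq ?_)
        rw [cost, hWdef]
        simp only [← mul_samplingMatrix, Matrix.sub_mul, Matrix.mul_assoc]
      by_contra! hcon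
      have h5 : 12.5 * V J + h ≤ γ * (12.5 * V J + h) := by
        have : 0 ≤ 12.5 * V J + h := by positivity
        nlinarith
      have h6 := mul_le_mul_of_nonneg_left hcon.le (by linarith : 0 ≤ γ)
      have h7 : frobSq (sampledColumns (samplingProb Z) (A - A * Z * Zᵀ) J *
        (sampledColumns (samplingProb Z) Zᵀ J)ᵀ) = V J := rfl
      rw [h7] at h3
      nlinarith
    · linarith
    · linarith
  refine (sampleMean_mono hp0 hpt).trans ?_
  rw [sampleMean_add, sampleMean_add, sampleMean_add, sampleMean_const_mul, sampleMean_const_mul,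
    sampleMean_const hp1]
  have hW1 : sampleMean p r W ≤ F := hW.trans (by
    have : cost A X₀.1 ≤ F := hX₀.le.trans hF'
    exact this)
  have hV1 : sampleMean p r V ≤ k / r * (F + h) :=
    hV.trans (mul_le_mul_of_nonneg_left hE (by positivity))
  refine add_le_add htail ?_
  have e2 : (1.25 * F + 12.5 * (k / r * (F + h)) + h) / ((2 + ε) * F) =
      (1.25 / ((2 + ε) * F)) * F + ((12.5 / ((2 + ε) * F)) * (k / r * (F + h)) +
        h / ((2 + ε) * F)) := by ring
  rw [e2]
  gcongr

end Quality

/-! ### Gaussian random matrices -/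

section Gaussian

open Matrix

/-- A standard Gaussian vector is invariant under orthogonal transformations. -/
theorem map_mulVec_pi_gaussianReal {ι : Type*} [Fintype ι] [DecidableEq ι] {U : Matrix ι ι ℝ}
    (hU : Uᵀ * U = 1) :
    MeasurePreserving (fun g : ι → ℝ => U *ᵥ g) (Measure.pi fun _ : ι => gaussianReal 0 1)
      (Measure.pi fun _ : ι => gaussianReal 0 1) := by
  have hm : Measurable (fun g : ι → ℝ => U *ᵥ g) := by
    refine measurable_pi_lambda _ fun i => ?_
    simp only [Matrix.mulVec, dotProduct]
    fun_prop
  refine ⟨hm, ?_⟩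
  let f : EuclideanSpace ℝ ι →ₗᵢ[ℝ] EuclideanSpace ℝ ι :=
    { toLinearMap := Matrix.toEuclideanLin U
      norm_map' := fun x => by
        have h : ‖Matrix.toEuclideanLin U x‖ ^ 2 = ‖x‖ ^ 2 := by
          rw [EuclideanSpace.real_norm_sq_eq, EuclideanSpace.real_norm_sq_eq]
          have h1 : (U *ᵥ x.ofLp) ⬝ᵥ (U *ᵥ x.ofLp) = x.ofLp ⬝ᵥ x.ofLp := by
            rw [Matrix.dotProduct_mulVec, Matrix.vecMul_mulVec, hU, Matrix.vecMul_one]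
          simpa [dotProduct, sq, Matrix.toLpLin_apply] using h1
        exact (sq_eq_sq₀ (norm_nonneg _) (norm_nonneg _)).1 h }
  have hmap := stdGaussian_map (f.toLinearIsometryEquiv rfl)
  rw [← map_pi_eq_stdGaussian, Measure.map_map (by fun_prop) (by fun_prop)] at hmap
  have h2 := congrArg (Measure.map (WithLp.ofLp)) hmap
  rw [Measure.map_map (by fun_prop) (by fun_prop), Measure.map_map (by fun_prop) (by fun_prop)] at h2
  have e1 : (WithLp.ofLp ∘ (f.toLinearIsometryEquiv rfl : EuclideanSpace ℝ ι → EuclideanSpace ℝ ι) ∘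
      WithLp.toLp 2) = fun g : ι → ℝ => U *ᵥ g := by
    ext g i
    simp [f, Matrix.toLpLin_apply]
  have e2 : (WithLp.ofLp ∘ WithLp.toLp 2 : (ι → ℝ) → ι → ℝ) = id := rfl
  rw [e1, e2, Measure.map_id] at h2
  exact h2

theorem measurePreserving_curry_gaussian (ι κ : Type*) [Fintype ι] [Fintype κ] :
    MeasurePreserving (MeasurableEquiv.curry ι κ ℝ)
      (Measure.pi fun _ : ι × κ => gaussianReal 0 1)
      (Measure.pi fun _ : ι => Measure.pi fun _ : κ => gaussianReal 0 1) := by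
  refine ⟨MeasurableEquiv.measurable _, ?_⟩
  have h := Measure.infinitePi_map_curry (ι := ι) (κ := κ) (X := ℝ) (fun _ _ => gaussianReal 0 1)
  simpa [Measure.infinitePi_eq_pi] using h

/-- The law of a Gaussian matrix is invariant under orthogonal transformations of the columns. -/
theorem measurePreserving_mul_gaussianLaw {n s : ℕ} {U : Matrix (Fin n) (Fin n) ℝ}
    (hU : Uᵀ * U = 1) :
    MeasurePreserving (fun (G : Fin n → Fin s → ℝ) i j => (U * Matrix.of G) i j)
      (gaussianLaw n s) (gaussianLaw n s) := by
  have hK : (Matrix.kroneckerMap (· * ·) U (1 : Matrix (Fin s) (Fin s) ℝ))ᵀ *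
      Matrix.kroneckerMap (· * ·) U (1 : Matrix (Fin s) (Fin s) ℝ) = 1 := by
    rw [← Matrix.kroneckerMap_transpose, ← Matrix.mul_kronecker_mul, hU]
    simp
  have h1 := measurePreserving_curry_gaussian (Fin n) (Fin s)
  have h2 := (h1.comp (map_mulVec_pi_gaussianReal hK)).comp h1.symm
  suffices e : (fun (G : Fin n → Fin s → ℝ) i j => (U * Matrix.of G) i j) = _ from e ▸ h2
  ext G i j
  simp [Matrix.mul_apply, Matrix.mulVec, dotProduct, Fintype.sum_prod_type, MeasurableEquiv.curry,
    Matrix.one_apply]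

/-- The second moment of a linear form in independent standard Gaussians. -/
theorem lintegral_sq_sum_gaussian {ι : Type*} [Fintype ι] (c : ι → ℝ) :
    ∫⁻ g, ENNReal.ofReal ((∑ i, c i * g i) ^ 2) ∂(Measure.pi fun _ : ι => gaussianReal 0 1) =
      ENNReal.ofReal (∑ i, c i ^ 2) := by
  have hL : ∀ i, MemLp (fun x : ℝ => c i * x) 2 (gaussianReal 0 1) := fun i =>
    IsGaussian.memLp_two_id.const_mul _
  have hv := variance_sum_pi (μ := fun _ : ι => gaussianReal 0 1) (X := fun i x => c i * x) hL
  have hv' : ∀ i, Var[fun x : ℝ => c i * x; gaussianReal 0 1] = c i ^ 2 := by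
    intro i
    have := variance_const_mul (c i) id (gaussianReal 0 1)
    rw [variance_id_gaussianReal] at this
    simpa using this
  have hLi : ∀ i, MemLp (fun g : ι → ℝ => c i * g i) 2
      (Measure.pi fun _ : ι => gaussianReal 0 1) := fun i =>
    (hL i).comp_measurePreserving (measurePreserving_eval (fun _ : ι => gaussianReal 0 1) i)
  have hLs : MemLp (fun g : ι → ℝ => ∑ i, c i * g i) 2
      (Measure.pi fun _ : ι => gaussianReal 0 1) := memLp_finsetSum _ fun i _ => hLi i
  have hmean : ∫ g : ι → ℝ, ∑ i, c i * g i ∂(Measure.pi fun _ : ι => gaussianReal 0 1) = 0 := by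
    rw [integral_finsetSum _ fun i _ => (hLi i).integrable (by norm_num)]
    refine Finset.sum_eq_zero fun i _ => ?_
    rw [integral_const_mul, integral_eval]
    simp
  have e : (∑ i, fun g : ι → ℝ => c i * g i) = fun g => ∑ i, c i * g i := by
    ext g; simp
  rw [e, variance_eq_sub hLs, hmean] at hv
  simp only [hv'] at hv
  rw [← ofReal_integral_eq_lintegral_ofReal hLs.integrable_sq
    (Filter.Eventually.of_forall fun g => sq_nonneg _), ← hv]
  simp

theorem integral_exp_neg_mul_sq_gaussianReal {t : ℝ} (ht : 0 ≤ t) :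
    ∫ x, Real.exp (-t * x ^ 2) ∂(gaussianReal 0 1) = 1 / √(1 + 2 * t) := by
  rw [integral_gaussianReal_eq_integral_smul (by norm_num)]
  have h : ∀ x : ℝ, gaussianPDFReal 0 1 x • Real.exp (-t * x ^ 2) =
      (√(2 * Real.pi))⁻¹ * Real.exp (-(1 / 2 + t) * x ^ 2) := by
    intro x
    rw [gaussianPDFReal, smul_eq_mul, mul_assoc, ← Real.exp_add]
    congr 2
    · simp
    · simp; ring
  simp only [h]
  have hpi := Real.pi_pos
  have e : 1 / √(1 + 2 * t) = √((1 + 2 * t)⁻¹) := by rw [Real.sqrt_inv, one_div]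
  rw [integral_const_mul, integral_gaussian, ← Real.sqrt_inv, ← Real.sqrt_mul (by positivity), e]
  congr 1
  field_simp

theorem integral_exp_neg_mul_sum_sq_gaussian {ι : Type*} [Fintype ι] (S : Finset ι) {t : ℝ}
    (ht : 0 ≤ t) :
    ∫ g, Real.exp (-t * ∑ i ∈ S, g i ^ 2) ∂(Measure.pi fun _ : ι => gaussianReal 0 1) =
      (1 / √(1 + 2 * t)) ^ S.card := by
  classical
  have h : ∀ g : ι → ℝ, Real.exp (-t * ∑ i ∈ S, g i ^ 2) =
      ∏ i, (fun x : ℝ => if i ∈ S then Real.exp (-t * x ^ 2) else 1) (g i) := by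
    intro g
    rw [Finset.mul_sum, Real.exp_sum, ← Finset.prod_filter]
    simp
  simp only [h]
  rw [integral_fintype_prod_eq_prod (μ := fun _ : ι => gaussianReal 0 1)
    (fun (i : ι) (x : ℝ) => if i ∈ S then Real.exp (-t * x ^ 2) else (1 : ℝ))]
  have h2 : ∀ i, ∫ x : ℝ, (if i ∈ S then Real.exp (-t * x ^ 2) else (1 : ℝ)) ∂(gaussianReal 0 1) =
      if i ∈ S then 1 / √(1 + 2 * t) else 1 := by
    intro i
    split_ifs
    · exact integral_exp_neg_mul_sq_gaussianReal ht
    · simp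
  simp only [h2]
  rw [← Finset.prod_filter]
  simp

/-- The reciprocal as a Laplace transform, which is also correct for `a = 0`. -/
theorem inv_ofReal_eq_lintegral_exp {a : ℝ} (ha : 0 ≤ a) :
    (ENNReal.ofReal a)⁻¹ = ∫⁻ t in Set.Ioi (0 : ℝ), ENNReal.ofReal (Real.exp (-t * a)) := by
  rcases ha.eq_or_lt with rfl | ha
  · simp
  · have h : ∀ t : ℝ, Real.exp (-t * a) = Real.exp (-a * t) := fun t => by ring_nf
    simp only [h]
    rw [← ofReal_integral_eq_lintegral_ofReal (integrableOn_exp_mul_Ioi (by linarith) 0)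
      (Filter.Eventually.of_forall fun t => (Real.exp_pos _).le),
      integral_exp_mul_Ioi (by linarith)]
    simp [ENNReal.ofReal_inv_of_pos ha]

theorem lintegral_one_div_sqrt_pow {d : ℕ} (hd : 3 ≤ d) :
    ∫⁻ t in Set.Ioi (0 : ℝ), ENNReal.ofReal ((1 / √(1 + 2 * t)) ^ d) =
      ENNReal.ofReal (1 / (d - 2)) := by
  have hd' : (3 : ℝ) ≤ d := by exact_mod_cast hd
  set c : ℝ := 1 - d / 2 with hc
  have hc0 : c < 0 := by rw [hc]; linarith
  have hderiv : ∀ t ∈ Set.Ioi (0 : ℝ), HasDerivAt (fun t : ℝ => (1 + 2 * t) ^ c / (2 * c))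
      ((1 / √(1 + 2 * t)) ^ d) t := by
    intro t ht
    have ht' : (0 : ℝ) < 1 + 2 * t := by have := Set.mem_Ioi.1 ht; linarith
    have h1 : HasDerivAt (fun t : ℝ => 1 + 2 * t) 2 t := by
      simpa using ((hasDerivAt_id t).const_mul 2).const_add 1
    have h2 := (h1.rpow_const (p := c) (Or.inl ht'.ne')).div_const (2 * c)
    refine h2.congr_deriv ?_
    rw [Real.sqrt_eq_rpow, one_div, ← Real.rpow_neg ht'.le, ← Real.rpow_natCast, ← Real.rpow_mul ht'.le]
    have : -(1 / 2) * (d : ℝ) = c - 1 := by rw [hc]; ring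
    rw [this]
    field_simp
    exact div_self hc0.ne
  have hcont : ContinuousWithinAt (fun t : ℝ => (1 + 2 * t) ^ c / (2 * c)) (Set.Ici 0) 0 := by
    refine ContinuousAt.continuousWithinAt ?_
    refine ContinuousAt.div_const ?_ _
    exact ContinuousAt.rpow_const (by fun_prop) (Or.inl (by norm_num))
  have hlim : Filter.Tendsto (fun t : ℝ => (1 + 2 * t) ^ c / (2 * c)) Filter.atTop (nhds 0) := by
    have h1 : Filter.Tendsto (fun t : ℝ => 1 + 2 * t) Filter.atTop Filter.atTop :=
      Filter.tendsto_atTop_add_const_left _ _ (Filter.tendsto_id.const_mul_atTop (by norm_num))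
    have h2 := (tendsto_rpow_neg_atTop (y := -c) (by linarith)).comp h1
    have h3 := h2.div_const (2 * c)
    simpa using h3
  have hpos : ∀ t ∈ Set.Ioi (0 : ℝ), 0 ≤ (1 / √(1 + 2 * t)) ^ d := fun t _ => by positivity
  have hint := integrableOn_Ioi_deriv_of_nonneg hcont hderiv hpos hlim
  have hval := integral_Ioi_of_hasDerivAt_of_nonneg hcont hderiv hpos hlim
  rw [← ofReal_integral_eq_lintegral_ofReal hint
    (Filter.Eventually.of_forall fun t => by positivity), hval]
  congr 1
  have : (d : ℝ) - 2 ≠ 0 := by linarith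
  have h2c : 2 * c = -(d - 2) := by rw [hc]; ring
  have h1 : (1 + 2 * (0 : ℝ)) ^ c = 1 := by simp
  rw [h2c, h1, div_neg]
  ring

/-- The inverse moment of a chi-square variable with `d ≥ 3` degrees of freedom. -/
theorem lintegral_inv_sum_sq_gaussian {ι : Type*} [Fintype ι] (S : Finset ι) (hS : 3 ≤ S.card) :
    ∫⁻ g, (ENNReal.ofReal (∑ i ∈ S, g i ^ 2))⁻¹ ∂(Measure.pi fun _ : ι => gaussianReal 0 1) =
      ENNReal.ofReal (1 / (S.card - 2)) := by
  have h : ∀ g : ι → ℝ, (ENNReal.ofReal (∑ i ∈ S, g i ^ 2))⁻¹ =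
      ∫⁻ t in Set.Ioi (0 : ℝ), ENNReal.ofReal (Real.exp (-t * ∑ i ∈ S, g i ^ 2)) := fun g =>
    inv_ofReal_eq_lintegral_exp (Finset.sum_nonneg fun _ _ => sq_nonneg _)
  simp only [h]
  rw [lintegral_lintegral_swap (by fun_prop), ← lintegral_one_div_sqrt_pow hS]
  refine setLIntegral_congr_fun measurableSet_Ioi fun t ht => ?_
  have ht0 : 0 ≤ t := (Set.mem_Ioi.1 ht).le
  rw [← integral_exp_neg_mul_sum_sq_gaussian S ht0]
  refine (ofReal_integral_eq_lintegral_ofReal ?_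
    (Filter.Eventually.of_forall fun g => (Real.exp_pos _).le)).symm
  refine Integrable.of_bound (C := 1) (Measurable.aestronglyMeasurable (by fun_prop))
    (Filter.Eventually.of_forall fun g => ?_)
  rw [Real.norm_eq_abs, abs_of_pos (Real.exp_pos _), Real.exp_le_one_iff, neg_mul, neg_nonpos]
  exact mul_nonneg ht0 (Finset.sum_nonneg fun _ _ => sq_nonneg _)

theorem pi_absolutelyContinuous {μ ν : Measure ℝ} [SigmaFinite μ] [SigmaFinite ν] (h : μ ≪ ν)
    (s : ℕ) : (Measure.pi fun _ : Fin s => μ) ≪ (Measure.pi fun _ : Fin s => ν) := by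
  induction s with
  | zero =>
    rw [Measure.pi_of_empty, Measure.pi_of_empty]
  | succ s ih =>
    rw [← (measurePreserving_piFinSuccAbove (fun _ : Fin (s + 1) => μ) 0).symm.map_eq,
      ← (measurePreserving_piFinSuccAbove (fun _ : Fin (s + 1) => ν) 0).symm.map_eq]
    exact (h.prod ih).map (MeasurableEquiv.measurable _)

theorem pi_gaussianReal_submodule_eq_zero {s : ℕ} {S : Submodule ℝ (Fin s → ℝ)} (hS : S ≠ ⊤) :
    (Measure.pi fun _ : Fin s => gaussianReal 0 1) (S : Set (Fin s → ℝ)) = 0 := by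
  have hac : (Measure.pi fun _ : Fin s => gaussianReal 0 1) ≪
      (Measure.pi fun _ : Fin s => (volume : Measure ℝ)) :=
    pi_absolutelyContinuous (gaussianReal_absolutelyContinuous 0 (by norm_num)) s
  exact hac (Measure.addHaar_submodule volume S hS)

/-- The rows of a Gaussian matrix are almost surely linearly independent. -/
theorem ae_linearIndependent_gaussianLaw (k s : ℕ) (hks : k ≤ s) :
    ∀ᵐ R ∂(gaussianLaw k s), LinearIndependent ℝ R := by
  induction k with
  | zero => exact Filter.Eventually.of_forall fun R => linearIndependent_empty_type
  | succ k ih =>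
    have hmp := measurePreserving_piFinSuccAbove
      (fun _ : Fin (k + 1) => Measure.pi fun _ : Fin s => gaussianReal 0 1) 0
    have hopen : MeasurableSet {R : Fin (k + 1) → Fin s → ℝ | LinearIndependent ℝ R} :=
      isOpen_setOfPred_linearIndependent.measurableSet
    have hpair : ∀ᵐ q ∂((Measure.pi fun _ : Fin s => gaussianReal 0 1).prod (gaussianLaw k s)),
        LinearIndependent ℝ (Fin.cons q.1 q.2 : Fin (k + 1) → Fin s → ℝ) := by
      have hm : MeasurableSet {q : (Fin s → ℝ) × (Fin k → Fin s → ℝ) |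
          LinearIndependent ℝ (Fin.cons q.1 q.2 : Fin (k + 1) → Fin s → ℝ)} := by
        have hc : Measurable fun q : (Fin s → ℝ) × (Fin k → Fin s → ℝ) =>
            (Fin.cons q.1 q.2 : Fin (k + 1) → Fin s → ℝ) := by
          refine measurable_pi_lambda _ fun i => ?_
          refine Fin.cases ?_ (fun j => ?_) i
          · simpa using measurable_fst
          · simp only [Fin.cons_succ]
            exact (measurable_pi_apply j).comp measurable_snd
        exact hc hopen
      have : SFinite (gaussianLaw k s) := by unfold gaussianLaw; infer_instance
      rw [← Measure.prod_swap, ae_map_iff (by fun_prop) hm]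
      refine (Measure.ae_prod_iff_ae_ae (hm.preimage measurable_swap)).2 ?_
      filter_upwards [ih (by omega)] with v hv
      have hspan : Submodule.span ℝ (Set.range v) ≠ ⊤ := by
        intro h
        have h1 := finrank_span_eq_card hv
        rw [h, finrank_top] at h1
        simp at h1
        omega
      have h0 := pi_gaussianReal_submodule_eq_zero hspan
      rw [measure_eq_zero_iff_ae_notMem] at h0
      filter_upwards [h0] with x hx
      exact linearIndependent_finCons.2 ⟨hv, hx⟩
    have h2 := hmp.quasiMeasurePreserving.ae hpair
    filter_upwards [h2] with R hR
    convert hR using 1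
    exact (Fin.insertNth_self_removeNth 0 R).symm.trans (by simp)

/-! ### The right inverse of a Gaussian matrix -/

/-- The right inverse `Rᵀ (R Rᵀ)⁻¹` of a matrix with linearly independent rows; it is zero if the
rows are linearly dependent. -/
def rightInverse {k s : ℕ} (R : Fin k → Fin s → ℝ) : Matrix (Fin s) (Fin k) ℝ :=
  (Matrix.of R)ᵀ * (Matrix.of R * (Matrix.of R)ᵀ)⁻¹

theorem mul_rightInverse_of_isUnit {k s : ℕ} {R : Fin k → Fin s → ℝ}
    (h : IsUnit (Matrix.of R * (Matrix.of R)ᵀ).det) : Matrix.of R * rightInverse R = 1 := by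
  rw [rightInverse, ← Matrix.mul_assoc, Matrix.mul_nonsing_inv _ h]

theorem mul_rightInverse {k s : ℕ} {R : Fin k → Fin s → ℝ} (hR : LinearIndependent ℝ R) :
    Matrix.of R * rightInverse R = 1 := by
  refine mul_rightInverse_of_isUnit ?_
  have h : ((Matrix.of R) * (Matrix.of R)ᴴ).PosDef :=
    Matrix.PosDef.mul_conjTranspose_self _ (Matrix.vecMul_injective_iff.2 hR)
  have h2 := h.isUnit
  rw [Matrix.conjTranspose_eq_transpose_of_trivial] at h2
  exact (Matrix.isUnit_iff_isUnit_det _).1 h2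

theorem measurable_rightInverse {k s : ℕ} (b : Fin s) (j : Fin k) :
    Measurable fun R : Fin k → Fin s → ℝ => rightInverse R b j := by
  have hM : ∀ a c : Fin k, Measurable fun R : Fin k → Fin s → ℝ =>
      (Matrix.of R * (Matrix.of R)ᵀ) a c := by
    intro a c
    simp only [Matrix.mul_apply, Matrix.transpose_apply, Matrix.of_apply]
    fun_prop
  have hdet : ∀ (q : ℕ) (f : (Fin k → Fin s → ℝ) → Matrix (Fin q) (Fin q) ℝ),
      (∀ a c, Measurable fun R => f R a c) → Measurable fun R => (f R).det := by
    intro q f hf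
    simp only [Matrix.det_apply']
    exact Finset.measurable_sum _ fun σ _ => measurable_const.mul
      (Finset.measurable_prod _ fun i _ => hf _ _)
  have hinv : ∀ a c : Fin k, Measurable fun R : Fin k → Fin s → ℝ =>
      (Matrix.of R * (Matrix.of R)ᵀ)⁻¹ a c := by
    intro a c
    simp only [Matrix.inv_def, Matrix.smul_apply, smul_eq_mul, Ring.inverse_eq_inv',
      Matrix.adjugate_apply]
    refine (hdet k _ hM).inv.mul (hdet k _ fun a' c' => ?_)
    simp only [Matrix.updateRow_apply]
    split_ifs
    · exact measurable_const
    · exact hM _ _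
  simp only [rightInverse, Matrix.mul_apply (M := (Matrix.of _)ᵀ), Matrix.transpose_apply,
    Matrix.of_apply]
  refine Finset.measurable_sum _ fun a _ => ?_
  exact Measurable.mul (by fun_prop) (hinv a j)

/-- The columns of `Rᵀ (R Rᵀ)⁻¹` have the least norm among all solutions `w` of `R w = eᵢ`. -/
theorem rightInverse_col_le {k s : ℕ} {R : Fin k → Fin s → ℝ} {i : Fin k} {w : Fin s → ℝ}
    (hw : Matrix.of R *ᵥ w = Pi.single i 1) :
    ∑ b, rightInverse R b i ^ 2 ≤ ∑ b, w b ^ 2 := by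
  have hw0 : 0 ≤ ∑ b, w b ^ 2 := Finset.sum_nonneg fun _ _ => sq_nonneg _
  by_cases hdet : IsUnit (Matrix.of R * (Matrix.of R)ᵀ).det
  · set v : Fin s → ℝ := rightInverse R *ᵥ Pi.single i 1 with hv
    have hvb : ∀ b, v b = rightInverse R b i := fun b => by simp [hv]
    have hRv : Matrix.of R *ᵥ v = Pi.single i 1 := by
      rw [hv, Matrix.mulVec_mulVec, mul_rightInverse_of_isUnit hdet, Matrix.one_mulVec]
    -- `v` lies in the row space of `R`, on which `w` and `v` have the same inner products
    have hvw : ∀ u : Fin s → ℝ, v ⬝ᵥ u =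
        ((Matrix.of R * (Matrix.of R)ᵀ)⁻¹ *ᵥ Pi.single i 1) ⬝ᵥ (Matrix.of R *ᵥ u) := by
      intro u
      rw [hv, rightInverse, ← Matrix.mulVec_mulVec, Matrix.mulVec_transpose,
        ← Matrix.dotProduct_mulVec]
    have h1 : v ⬝ᵥ w = v ⬝ᵥ v := by rw [hvw, hvw, hw, hRv]
    have h2 : ∑ b, v b * w b = ∑ b, v b ^ 2 := by
      simpa [dotProduct, sq] using h1
    have h3 : 0 ≤ ∑ b, (w b - v b) ^ 2 := Finset.sum_nonneg fun _ _ => sq_nonneg _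
    have h4 : ∑ b, (w b - v b) ^ 2 = ∑ b, w b ^ 2 - 2 * ∑ b, v b * w b + ∑ b, v b ^ 2 := by
      rw [Finset.mul_sum, ← Finset.sum_sub_distrib, ← Finset.sum_add_distrib]
      exact Finset.sum_congr rfl fun b _ => by ring
    simp only [← hvb]
    linarith
  · have : rightInverse R = 0 := by
      rw [rightInverse, Matrix.nonsing_inv_apply_not_isUnit _ hdet, Matrix.mul_zero]
    simpa [this] using hw0

/-- The norm of a column of the right inverse is at most the inverse distance of the corresponding
row of `R` to the span of the other rows.  The square of this distance is at least a chi-square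
variable with `s - k` degrees of freedom, as the other `k` rows lie in a space of dimension `k`. -/
theorem lintegral_rightInverse_col_le {k s : ℕ} (hks : k + 3 ≤ s) (i : Fin (k + 1)) :
    ∫⁻ R, ENNReal.ofReal (∑ b, rightInverse R b i ^ 2) ∂(gaussianLaw (k + 1) s) ≤
      ENNReal.ofReal (1 / (s - k - 2)) := by
  have hmp := (measurePreserving_piFinSuccAbove
      (fun _ : Fin (k + 1) => Measure.pi fun _ : Fin s => gaussianReal 0 1) i).symm
  have hmeas : Measurable fun R : Fin (k + 1) → Fin s → ℝ =>
      ENNReal.ofReal (∑ b, rightInverse R b i ^ 2) :=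
    (Finset.measurable_sum _ fun b _ => (measurable_rightInverse b i).pow_const 2).ennreal_ofReal
  rw [gaussianLaw, ← hmp.lintegral_comp hmeas]
  refine (lintegral_prod_symm _ ((hmeas.comp hmp.measurable).aemeasurable)).trans_le ?_
  have hinner : ∀ y : Fin k → Fin s → ℝ, ∫⁻ x, ENNReal.ofReal (∑ b, rightInverse
      ((MeasurableEquiv.piFinSuccAbove (fun _ : Fin (k + 1) => Fin s → ℝ) i).symm (x, y)) b i ^ 2)
        ∂(Measure.pi fun _ : Fin s => gaussianReal 0 1) ≤ ENNReal.ofReal (1 / (s - k - 2)) := by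
    intro y
    obtain ⟨U, hU, hy⟩ := exists_orthogonal_mul_eq_self (by omega : k ≤ s) (Matrix.of y)
    have hU' : U * Uᵀ = 1 := mul_eq_one_comm.1 hU
    set S : Finset (Fin s) := Finset.univ.filter fun j => k ≤ j.1 with hS
    have hcard : S.card = s - k := by
      have h1 : S.card + (Finset.univ.filter fun j : Fin s => j.1 < k).card = s := by
        have := Finset.card_filter_add_card_filter_not (s := (Finset.univ : Finset (Fin s)))
          (fun j => k ≤ j.1)
        simpa [hS, not_le] using this
      have h2 : (Finset.univ.filter fun j : Fin s => j.1 < k).card = k := by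
        have h := sum_castLE (by omega : k ≤ s) (fun _ => (1 : ℝ))
        rw [← Finset.sum_filter] at h
        simp only [Finset.sum_const, Finset.card_univ, Fintype.card_fin, nsmul_eq_mul, mul_one] at h
        exact_mod_cast h.symm
      omega
    have hchi := lintegral_inv_sum_sq_gaussian S (by omega)
    have hUmp := map_mulVec_pi_gaussianReal (U := Uᵀ) (by rw [Matrix.transpose_transpose]; exact hU')
    rw [hcard, Nat.cast_sub (by omega),
      ← hUmp.lintegral_comp (f := fun g => (ENNReal.ofReal (∑ i ∈ S, g i ^ 2))⁻¹) (by fun_prop)]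
      at hchi
    refine le_trans (lintegral_mono fun x => ?_) hchi.le
    set R := (MeasurableEquiv.piFinSuccAbove (fun _ : Fin (k + 1) => Fin s → ℝ) i).symm (x, y)
      with hR
    have hRx : R i = x := Fin.insertNth_apply_same (α := fun _ => Fin s → ℝ) i x y
    have hRy : ∀ j, R (i.succAbove j) = y j := fun j =>
      Fin.insertNth_apply_succAbove (α := fun _ => Fin s → ℝ) i x y j
    set a := ∑ j ∈ S, (Uᵀ *ᵥ x) j ^ 2 with ha
    have ha0 : 0 ≤ a := Finset.sum_nonneg fun _ _ => sq_nonneg _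
    rcases ha0.eq_or_lt with h0 | h0
    -- for `a = 0` the right-hand side is infinite
    · rw [← h0]; simp
    rw [← ENNReal.ofReal_inv_of_pos h0]
    refine ENNReal.ofReal_le_ofReal ?_
    -- the normalized component of `x` orthogonal to the other rows
    set m : Fin s → ℝ := fun j => if j ∈ S then (Uᵀ *ᵥ x) j else 0 with hm
    have hmm : m ⬝ᵥ m = a := by
      simp [hm, dotProduct, ha, sq]
    have hUm : ∀ z : Fin s → ℝ, z ⬝ᵥ (U *ᵥ m) = (Uᵀ *ᵥ z) ⬝ᵥ m := by
      intro z
      rw [Matrix.dotProduct_mulVec, Matrix.mulVec_transpose]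
    have hw : Matrix.of R *ᵥ (a⁻¹ • (U *ᵥ m)) = Pi.single i 1 := by
      ext j
      rw [Matrix.mulVec_smul, Pi.smul_apply, smul_eq_mul]
      change a⁻¹ * (R j ⬝ᵥ (U *ᵥ m)) = _
      rw [hUm]
      rcases Fin.eq_self_or_eq_succAbove i j with rfl | ⟨j', rfl⟩
      · rw [hRx, Pi.single_eq_same]
        have : (Uᵀ *ᵥ x) ⬝ᵥ m = a := by
          simp [hm, dotProduct, ha, sq]
        rw [this, inv_mul_cancel₀ h0.ne']
      · rw [hRy, Pi.single_eq_of_ne (Fin.succAbove_ne i j')]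
        have : (Uᵀ *ᵥ y j') ⬝ᵥ m = 0 := by
          refine Finset.sum_eq_zero fun l _ => ?_
          simp only [hm]
          split_ifs with hl
          · have hl' : k ≤ l.1 := by simpa [hS] using hl
            have h1 : (Uᵀ *ᵥ y j') l = (Matrix.of y * U) j' l := by
              simp [Matrix.mul_apply, Matrix.mulVec, dotProduct, mul_comm]
            have h2 : (Matrix.of y * U) j' l = 0 := by
              rw [← hy, Matrix.mul_assoc (Matrix.of y * _)]
              have h3 : (U.submatrix id (Fin.castLE (by omega : k ≤ s)))ᵀ * U =
                  (Uᵀ * U).submatrix (Fin.castLE (by omega : k ≤ s)) id := by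
                ext; simp [Matrix.mul_apply]
              rw [h3, hU, Matrix.mul_apply]
              refine Finset.sum_eq_zero fun c _ => ?_
              have hne : Fin.castLE (by omega : k ≤ s) c ≠ l := by
                intro hcl
                have h4 := congrArg Fin.val hcl
                have h5 := c.2
                simp only [Fin.val_castLE] at h4
                omega
              have h4 : (1 : Matrix (Fin s) (Fin s) ℝ) (Fin.castLE (by omega : k ≤ s) c) l = 0 :=
                Matrix.one_apply_ne hne
              exact (congrArg (_ * ·) h4).trans (mul_zero _)
            rw [h1, h2, zero_mul]
          · rw [mul_zero]
        rw [this, mul_zero]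
    have h5 := rightInverse_col_le hw
    have h6 : ∑ b, (a⁻¹ • (U *ᵥ m)) b ^ 2 = a⁻¹ := by
      have : ∑ b, (a⁻¹ • (U *ᵥ m)) b ^ 2 = a⁻¹ ^ 2 * ((U *ᵥ m) ⬝ᵥ (U *ᵥ m)) := by
        simp only [Pi.smul_apply, smul_eq_mul, mul_pow, dotProduct, Finset.mul_sum]
        exact Finset.sum_congr rfl fun b _ => by ring
      rw [this, hUm, Matrix.mulVec_mulVec, hU, Matrix.one_mulVec, hmm]
      field_simp
    rw [← h6]
    exact h5
  calc _ ≤ ∫⁻ _y : Fin k → Fin s → ℝ, ENNReal.ofReal (1 / (s - k - 2)) ∂(gaussianLaw k s) :=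
        lintegral_mono hinner
    _ = _ := by
        have : IsProbabilityMeasure (gaussianLaw k s) := by unfold gaussianLaw; infer_instance
        rw [lintegral_const, measure_univ, mul_one]

theorem lintegral_frobSq_rightInverse_le {k s : ℕ} (hk : 1 ≤ k) (hks : k + 2 ≤ s) :
    ∫⁻ R, ENNReal.ofReal (frobSq (rightInverse R)) ∂(gaussianLaw k s) ≤
      ENNReal.ofReal (k / (s - k - 1)) := by
  obtain ⟨k, rfl⟩ : ∃ k', k = k' + 1 := ⟨k - 1, by omega⟩
  have h : ∀ R : Fin (k + 1) → Fin s → ℝ, ENNReal.ofReal (frobSq (rightInverse R)) =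
      ∑ i, ENNReal.ofReal (∑ b, rightInverse R b i ^ 2) := by
    intro R
    rw [← ENNReal.ofReal_sum_of_nonneg fun i _ => Finset.sum_nonneg fun _ _ => sq_nonneg _, frobSq,
      Finset.sum_comm]
  have hs : (0 : ℝ) < s - k - 2 := by
    have : ((k + 1 + 2 : ℕ) : ℝ) ≤ s := by exact_mod_cast hks
    push_cast at this
    linarith
  calc _ = ∑ i, ∫⁻ R, ENNReal.ofReal (∑ b, rightInverse R b i ^ 2) ∂(gaussianLaw (k + 1) s) := by
        simp only [h]
        exact lintegral_finsetSum _ fun i _ =>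
          (Finset.measurable_sum _ fun b _ => (measurable_rightInverse b i).pow_const 2).ennreal_ofReal
    _ ≤ ∑ _i : Fin (k + 1), ENNReal.ofReal (1 / (s - k - 2)) :=
        Finset.sum_le_sum fun i _ => lintegral_rightInverse_col_le (by omega) i
    _ = _ := by
        rw [← ENNReal.ofReal_sum_of_nonneg fun i _ => by positivity]
        congr 1
        rw [Finset.sum_const, Finset.card_univ, Fintype.card_fin, nsmul_eq_mul]
        push_cast
        rw [mul_one_div]
        congr 1
        ring

/-! ### The expected error of the approximate singular value decomposition -/

/-- The second moment of a bilinear form of a Gaussian matrix. -/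
theorem lintegral_sq_sum_mul_mul_gaussian {κ : Type*} [Fintype κ] {s : ℕ} (c : κ → ℝ)
    (d : Fin s → ℝ) :
    ∫⁻ y, ENNReal.ofReal ((∑ b, (∑ l, c l * y l b) * d b) ^ 2)
        ∂(Measure.pi fun _ : κ => Measure.pi fun _ : Fin s => gaussianReal 0 1) =
      ENNReal.ofReal ((∑ l, c l ^ 2) * ∑ b, d b ^ 2) := by
  have h := lintegral_sq_sum_gaussian (fun q : κ × Fin s => c q.1 * d q.2)
  have hmp := measurePreserving_curry_gaussian κ (Fin s)
  rw [← hmp.lintegral_comp (by fun_prop)]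
  have e1 : ∀ g : κ × Fin s → ℝ, ∑ b, (∑ l, c l * MeasurableEquiv.curry κ (Fin s) ℝ g l b) * d b =
      ∑ q : κ × Fin s, c q.1 * d q.2 * g q := by
    intro g
    rw [Fintype.sum_prod_type, Finset.sum_comm]
    refine Finset.sum_congr rfl fun b _ => ?_
    rw [Finset.sum_mul]
    refine Finset.sum_congr rfl fun l _ => ?_
    change c l * g (l, b) * d b = _
    ring
  have e2 : ∑ q : κ × Fin s, (c q.1 * d q.2) ^ 2 = (∑ l, c l ^ 2) * ∑ b, d b ^ 2 := by
    rw [Fintype.sum_prod_type, Finset.sum_mul_sum]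
    simp only [mul_pow]
  simp only [e1]
  rw [h, e2]

theorem ofReal_frobSq {m n : ℕ} (M : Matrix (Fin m) (Fin n) ℝ) :
    ENNReal.ofReal (frobSq M) = ∑ i, ∑ j, ENNReal.ofReal (M i j ^ 2) := by
  refine (ENNReal.ofReal_sum_of_nonneg fun i _ =>
    Finset.sum_nonneg fun j _ => sq_nonneg (M i j)).trans ?_
  exact Finset.sum_congr rfl fun i _ =>
    ENNReal.ofReal_sum_of_nonneg fun j _ => sq_nonneg (M i j)

/-- The elements of `Fin k`, as the indices below `k` in `Fin n`. -/
def finLtEquiv {k n : ℕ} (hkn : k ≤ n) : Fin k ≃ {l : Fin n // l.1 < k} where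
  toFun j := ⟨Fin.castLE hkn j, j.2⟩
  invFun l := ⟨l.1.1, l.2⟩
  left_inv _ := rfl
  right_inv _ := rfl

/-- The first `k` rows of a Gaussian matrix are Gaussian. -/
theorem measurePreserving_firstRows {k n s : ℕ} (hkn : k ≤ n) :
    MeasurePreserving (fun (G : Fin n → Fin s → ℝ) j => G (Fin.castLE hkn j))
      (gaussianLaw n s) (gaussianLaw k s) := by
  have hmp := measurePreserving_piEquivPiSubtypeProd
    (fun _ : Fin n => Measure.pi fun _ : Fin s => gaussianReal 0 1) (fun l => l.1 < k)
  have hre := (measurePreserving_piCongrLeft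
    (fun _ : {l : Fin n // l.1 < k} => Measure.pi fun _ : Fin s => gaussianReal 0 1)
      (finLtEquiv hkn)).symm
  exact hre.comp (measurePreserving_fst.comp hmp)

theorem lintegral_sum_sq_mul_mul_gaussian {κ : Type*} [Fintype κ] {m k s : ℕ}
    (D : Fin m → κ → ℝ) (N : Matrix (Fin s) (Fin k) ℝ) :
    ∫⁻ y, ∑ a, ∑ j, ENNReal.ofReal ((∑ b, (∑ l, D a l * y l b) * N b j) ^ 2)
        ∂(Measure.pi fun _ : κ => Measure.pi fun _ : Fin s => gaussianReal 0 1) =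
      ENNReal.ofReal (∑ a, ∑ l, D a l ^ 2) * ENNReal.ofReal (frobSq N) := by
  have hm : ∀ a j, Measurable fun y : κ → Fin s → ℝ =>
      ENNReal.ofReal ((∑ b, (∑ l, D a l * y l b) * N b j) ^ 2) := fun a j => by fun_prop
  have hN : frobSq N = ∑ j, ∑ b, N b j ^ 2 := Finset.sum_comm
  have hD0 : ∀ a, 0 ≤ ∑ l, D a l ^ 2 := fun a => Finset.sum_nonneg fun _ _ => sq_nonneg _
  have hN0 : ∀ j, 0 ≤ ∑ b, N b j ^ 2 := fun j => Finset.sum_nonneg fun _ _ => sq_nonneg _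
  rw [lintegral_finsetSum _ fun a _ => Finset.measurable_sum _ fun j _ => hm a j,
    ENNReal.ofReal_sum_of_nonneg fun a _ => hD0 a, Finset.sum_mul]
  refine Finset.sum_congr rfl fun a _ => ?_
  rw [lintegral_finsetSum _ fun j _ => hm a j, hN, ENNReal.ofReal_sum_of_nonneg fun j _ => hN0 j,
    Finset.mul_sum]
  refine Finset.sum_congr rfl fun j _ => ?_
  rw [lintegral_sq_sum_mul_mul_gaussian, ENNReal.ofReal_mul (hD0 a)]

/-- The expectation of `‖D G N‖²`, where `N` is the right inverse of the first `k` rows of `G` and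
`D` annihilates these rows. -/
theorem lintegral_frobSq_mul_rightInverse_le {m n k s : ℕ} (hk : 1 ≤ k) (hkn : k ≤ n)
    (hks : k + 2 ≤ s) {D : Matrix (Fin m) (Fin n) ℝ} (hD : ∀ a l, l.1 < k → D a l = 0) :
    ∫⁻ G, ENNReal.ofReal (frobSq (D * Matrix.of G * rightInverse fun j => G (Fin.castLE hkn j)))
        ∂(gaussianLaw n s) ≤ ENNReal.ofReal (frobSq D * (k / (s - k - 1))) := by
  have hmp := measurePreserving_piEquivPiSubtypeProd
    (fun _ : Fin n => Measure.pi fun _ : Fin s => gaussianReal 0 1) (fun l => l.1 < k)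
  -- the first `k` rows, as a function on the first factor of the product
  let e := finLtEquiv hkn
  let N : ({l : Fin n // l.1 < k} → Fin s → ℝ) → Matrix (Fin s) (Fin k) ℝ :=
    fun x => rightInverse fun j => x (e j)
  have hNm : ∀ b j, Measurable fun x => N x b j := fun b j =>
    (measurable_rightInverse b j).comp (measurable_pi_lambda _ fun j' => measurable_pi_apply (e j'))
  let f : ({l : Fin n // l.1 < k} → Fin s → ℝ) × ({l : Fin n // ¬ l.1 < k} → Fin s → ℝ) → ℝ≥0∞ :=
    fun q => ∑ a, ∑ j, ENNReal.ofReal ((∑ b, (∑ l, D a l.1 * q.2 l b) * N q.1 b j) ^ 2)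
  have hterm : ∀ a j, Measurable fun q : ({l : Fin n // l.1 < k} → Fin s → ℝ) ×
      ({l : Fin n // ¬ l.1 < k} → Fin s → ℝ) =>
      ENNReal.ofReal ((∑ b, (∑ l, D a l.1 * q.2 l b) * N q.1 b j) ^ 2) := by
    intro a j
    refine ((Finset.measurable_sum _ fun b _ => ?_).pow_const 2).ennreal_ofReal
    exact Measurable.mul (by fun_prop) ((hNm b j).comp measurable_fst)
  have hfm : Measurable f :=
    Finset.measurable_sum _ fun a _ => Finset.measurable_sum _ fun j _ => hterm a j
  have hf : ∀ G : Fin n → Fin s → ℝ,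
      ENNReal.ofReal (frobSq (D * Matrix.of G * rightInverse fun j => G (Fin.castLE hkn j))) =
        f (MeasurableEquiv.piEquivPiSubtypeProd (fun _ : Fin n => Fin s → ℝ) (fun l => l.1 < k) G) := by
    intro G
    simp only [f]
    rw [ofReal_frobSq]
    refine Finset.sum_congr rfl fun a _ => Finset.sum_congr rfl fun j _ => ?_
    congr 2
    rw [Matrix.mul_apply]
    refine Finset.sum_congr rfl fun b _ => ?_
    congr 1
    rw [Matrix.mul_apply, ← Fintype.sum_subtype_add_sum_subtype (fun l : Fin n => l.1 < k)]
    have h0 : ∑ l : {l : Fin n // l.1 < k}, D a l.1 * Matrix.of G l.1 b = 0 :=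
      Finset.sum_eq_zero fun l _ => by rw [hD a l.1 l.2, zero_mul]
    rw [h0, zero_add]
    rfl
  simp only [hf]
  have hmul : Measurable fun x => ENNReal.ofReal (frobSq D) * ENNReal.ofReal (frobSq (N x)) := by
    refine Measurable.const_mul (Measurable.ennreal_ofReal ?_) _
    exact Finset.measurable_sum _ fun b _ => Finset.measurable_sum _ fun j _ => (hNm b j).pow_const 2
  have hstep := hmp.lintegral_comp hfm
  rw [gaussianLaw]
  refine hstep.trans_le ?_
  rw [lintegral_prod _ hfm.aemeasurable]
  have hinner : ∀ x, ∫⁻ y, f (x, y) ∂(Measure.pi fun _ : {l : Fin n // ¬ l.1 < k} =>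
      Measure.pi fun _ : Fin s => gaussianReal 0 1) ≤
      ENNReal.ofReal (frobSq D) * ENNReal.ofReal (frobSq (N x)) := by
    intro x
    refine (lintegral_sum_sq_mul_mul_gaussian
      (fun a (l : {l : Fin n // ¬ l.1 < k}) => D a l.1) (N x)).trans_le ?_
    refine mul_le_mul_left (ENNReal.ofReal_le_ofReal (Finset.sum_le_sum fun a _ => ?_)) _
    rw [← Fintype.sum_subtype_add_sum_subtype (fun l : Fin n => l.1 < k) (fun l => D a l ^ 2)]
    have : 0 ≤ ∑ l : {l : Fin n // l.1 < k}, D a l.1 ^ 2 := Finset.sum_nonneg fun _ _ => sq_nonneg _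
    linarith
  refine (lintegral_mono hinner).trans ?_
  have hre := measurePreserving_piCongrLeft
    (fun _ : {l : Fin n // l.1 < k} => Measure.pi fun _ : Fin s => gaussianReal 0 1) e
  rw [← hre.lintegral_comp hmul]
  have hN : ∀ R : Fin k → Fin s → ℝ,
      N (MeasurableEquiv.piCongrLeft (fun _ : {l : Fin n // l.1 < k} => Fin s → ℝ) e R) =
        rightInverse R := fun R => rfl
  simp only [hN]
  rw [lintegral_const_mul, ENNReal.ofReal_mul (frobSq_nonneg D)]
  · gcongr
    exact lintegral_frobSq_rightInverse_le hk hks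
  · refine Measurable.ennreal_ofReal ?_
    exact Finset.measurable_sum _ fun b _ => Finset.measurable_sum _ fun j _ =>
      (measurable_rightInverse b j).pow_const 2

/-- The approximate singular value decomposition in expectation: its excess error over the
projection to any `k`-dimensional space containing the rows of an approximation `X C` is dominated
by a measurable function `h` of the Gaussian matrix with small expectation. -/
theorem exists_excess_error {m n k q s : ℕ} (hk : 1 ≤ k) (hkn : k ≤ n) (hqk : q = k)
    (hks : k + 2 ≤ s) (A : Matrix (Fin m) (Fin n) ℝ) (X : Matrix (Fin m) (Fin q) ℝ)
    (C : Matrix (Fin q) (Fin n) ℝ) :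
    ∃ h : (Fin n → Fin s → ℝ) → ℝ, Measurable h ∧ (∀ G, 0 ≤ h G) ∧
      (∀ᵐ G ∂(gaussianLaw n s), frobSq (A - A * (fastFrobeniusSVD A k G).val *
        (fastFrobeniusSVD A k G).valᵀ) ≤ frobSq (A - X * C) + h G) ∧
      ∫⁻ G, ENNReal.ofReal (h G) ∂(gaussianLaw n s) ≤
        ENNReal.ofReal (frobSq (A - X * C) * (k / (s - k - 1))) := by
  subst hqk
  obtain ⟨U, hU, hC⟩ := exists_orthogonal_mul_eq_self hkn C
  have hU' : U * Uᵀ = 1 := mul_eq_one_comm.1 hU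
  have hV := submatrix_castLE_transpose_mul hkn hU
  set V := U.submatrix id (Fin.castLE hkn) with hVdef
  set E := A - A * V * Vᵀ with hE
  have hEle : frobSq E ≤ frobSq (A - X * C) := frobSq_sub_proj_le_of_mul_eq A hV hC
  have hmp := measurePreserving_mul_gaussianLaw (s := s) (U := Uᵀ)
    (by rw [Matrix.transpose_transpose]; exact hU')
  let h₀ : (Fin n → Fin s → ℝ) → ℝ := fun G' =>
    frobSq (E * U * Matrix.of G' * rightInverse fun j => G' (Fin.castLE hkn j))
  have hm₀ : Measurable h₀ := by
    refine Finset.measurable_sum _ fun a _ => Finset.measurable_sum _ fun j _ => ?_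
    refine Measurable.pow_const ?_ 2
    simp only [Matrix.mul_apply (N := rightInverse _)]
    refine Finset.measurable_sum _ fun b _ => Measurable.mul ?_ ?_
    · simp only [Matrix.mul_apply (N := Matrix.of _), Matrix.of_apply]
      fun_prop
    · exact (measurable_rightInverse b j).comp
        (measurable_pi_lambda _ fun j' => measurable_pi_apply _)
  have hEU : ∀ a l, l.1 < q → (E * U) a l = 0 := by
    intro a l hl
    have hEV : E * V = 0 := by
      rw [hE, Matrix.sub_mul, Matrix.mul_assoc (A * V), hV, Matrix.mul_one, sub_self]
    have h1 : (E * U) a l = (E * V) a ⟨l.1, hl⟩ := by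
      rw [Matrix.mul_apply, Matrix.mul_apply]
      rfl
    rw [h1, hEV]
    rfl
  have hEU' : frobSq (E * U) ≤ frobSq E := frobSq_mul_le hU E
  refine ⟨fun G => h₀ fun i j => (Uᵀ * Matrix.of G) i j, hm₀.comp hmp.measurable,
    fun G => frobSq_nonneg _, ?_, ?_⟩
  · have hLI := ((measurePreserving_firstRows (s := s) hkn).comp hmp).quasiMeasurePreserving.ae
      (ae_linearIndependent_gaussianLaw q s (by omega))
    filter_upwards [hLI] with G hG
    have hN := mul_rightInverse hG
    set R : Fin q → Fin s → ℝ := fun j => (fun i b => (Uᵀ * Matrix.of G) i b) (Fin.castLE hkn j)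
      with hR
    have hRV : Matrix.of R = Vᵀ * Matrix.of G := by
      ext j b
      simp [hR, hVdef, Matrix.mul_apply]
    have hN' : Vᵀ * Matrix.of G * rightInverse R = 1 := by
      rw [← hRV]
      exact hN
    refine (frobSq_sub_fastFrobeniusSVD_le hk hkn A G hV (rightInverse R)).trans ?_
    refine add_le_add hEle (le_of_eq ?_)
    have h1 : A * V - A * Matrix.of G * rightInverse R =
        -(E * U * (Uᵀ * Matrix.of G) * rightInverse R) := by
      have h2 : E * U * (Uᵀ * Matrix.of G) = E * Matrix.of G := by
        rw [Matrix.mul_assoc, ← Matrix.mul_assoc U, hU', Matrix.one_mul]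
      have h3 : A * V * Vᵀ * Matrix.of G * rightInverse R = A * V := by
        rw [Matrix.mul_assoc (A * V), Matrix.mul_assoc (A * V), hN', Matrix.mul_one]
      rw [h2, hE, Matrix.sub_mul, Matrix.sub_mul, h3, neg_sub]
    rw [h1, frobSq_neg]
    rfl
  · have h1 := hmp.lintegral_comp hm₀.ennreal_ofReal
    refine h1.trans_le ((lintegral_frobSq_mul_rightInverse_le hk hkn hks hEU).trans ?_)
    refine ENNReal.ofReal_le_ofReal (mul_le_mul_of_nonneg_right (hEU'.trans hEle) ?_)
    have : ((q + 2 : ℕ) : ℝ) ≤ s := by exact_mod_cast hks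
    push_cast at this
    exact div_nonneg (Nat.cast_nonneg q) (by linarith)

end Gaussian

/-! ### Sampling by binary search -/

section BinarySearch

variable {n : ℕ} [NeZero n]

theorem val_charge {α : Type} (c : ℕ) (x : Timed α) : (charge c x).val = x.val := rfl

/-- Binary search in an increasing array finds the least index `i` with `x < F i`, or `hi`. -/
theorem binarySearch_spec {F : Fin n → ℝ} (hF : Monotone F) (x : ℝ) (lo hi : ℕ) (hlh : lo ≤ hi)
    (hhi : hi < n) :
    lo ≤ (binarySearch F x lo hi).val ∧ (binarySearch F x lo hi).val ≤ hi ∧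
      (∀ j : Fin n, lo ≤ j.1 → j.1 < (binarySearch F x lo hi).val → F j ≤ x) ∧
      ((binarySearch F x lo hi).val < hi → x < F (Fin.ofNat n (binarySearch F x lo hi).val)) := by
  have hofNat : ∀ i : ℕ, i < n → (Fin.ofNat n i).1 = i := fun i hi => by
    simp [Nat.mod_eq_of_lt hi]
  induction hd : hi - lo using Nat.strong_induction_on generalizing lo hi with
  | _ d ih =>
    rw [binarySearch]
    split_ifs with h1 h2
    · rw [val_charge]
      obtain ⟨e1, e2, e3, e4⟩ := ih ((lo + hi) / 2 - lo) (by omega) lo ((lo + hi) / 2) (by omega)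
        (by omega) rfl
      refine ⟨e1, by omega, e3, fun _ => ?_⟩
      rcases e2.lt_or_eq with h3 | h3
      · exact e4 h3
      · rw [h3]; exact h2
    · rw [val_charge]
      obtain ⟨e1, e2, e3, e4⟩ := ih (hi - ((lo + hi) / 2 + 1)) (by omega) ((lo + hi) / 2 + 1) hi
        (by omega) hhi rfl
      refine ⟨by omega, e2, fun j hj hj' => ?_, e4⟩
      by_cases h3 : (lo + hi) / 2 + 1 ≤ j.1
      · exact e3 j h3 hj'
      · refine (hF ?_).trans (not_lt.1 h2)
        rw [Fin.le_def, hofNat _ (by omega)]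
        omega
    · have : lo = hi := by omega
      subst this
      simp only [val_charge, Timed.val_pure]
      exact ⟨le_rfl, le_rfl, fun j h4 h5 => absurd h4 (by omega), fun h => absurd h (lt_irrefl _)⟩

/-- The number of steps of a binary search is logarithmic in the length of the range. -/
theorem time_binarySearch_le (F : Fin n → ℝ) (x : ℝ) (b lo hi : ℕ) (h : hi - lo < 2 ^ b) :
    (binarySearch F x lo hi).time ≤ 5 * b + 1 := by
  induction b generalizing lo hi with
  | zero =>
    rw [binarySearch, if_neg (by simp at h; omega)]
    simp [charge]
  | succ b ih =>
    have hp : 2 ^ (b + 1) = 2 * 2 ^ b := by ring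
    rw [binarySearch]
    split_ifs with h1 h2
    · have := ih lo ((lo + hi) / 2) (by omega)
      simp only [charge]; omega
    · have := ih ((lo + hi) / 2 + 1) hi (by omega)
      simp only [charge]; omega
    · simp [charge]

/-- The index that inversion of the distribution function of `p` assigns to the number `x`. -/
def selectIndex (p : Fin n → ℝ) (x : ℝ) : Fin n :=
  Fin.ofNat n (binarySearch (fun i => ∑ j ∈ Finset.Iic i, p j) x 0 (n - 1)).val

/-- The numbers that select the index `i` form a half-open interval of length `p i`; for the last
index the interval includes the endpoint `1`. -/
theorem selectIndex_eq_iff {p : Fin n → ℝ} (hp0 : ∀ i, 0 ≤ p i) {x : ℝ}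
    (hx0 : 0 ≤ x) (i : Fin n) :
    selectIndex p x = i ↔ ∑ j ∈ Finset.Iio i, p j ≤ x ∧
      (x < ∑ j ∈ Finset.Iic i, p j ∨ i.1 = n - 1) := by
  have hn : 0 < n := Nat.pos_of_ne_zero (NeZero.ne n)
  have hF : Monotone fun i : Fin n => ∑ j ∈ Finset.Iic i, p j := fun a b hab =>
    Finset.sum_le_sum_of_subset_of_nonneg (Finset.Iic_subset_Iic.2 hab) fun j _ _ => hp0 j
  obtain ⟨-, h2, h3, h4⟩ := binarySearch_spec hF x 0 (n - 1) (by omega) (by omega)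
  have hval : (selectIndex p x).1 =
      (binarySearch (fun i => ∑ j ∈ Finset.Iic i, p j) x 0 (n - 1)).val := by
    simp only [selectIndex, Fin.val_ofNat]
    exact Nat.mod_eq_of_lt (by omega)
  rw [← hval] at h2 h3 h4
  have h4' : (selectIndex p x).1 < n - 1 → x < ∑ j ∈ Finset.Iic (selectIndex p x), p j := by
    intro h
    have := h4 h
    rwa [show Fin.ofNat n (selectIndex p x).1 = selectIndex p x by ext; simp] at this
  constructor
  · rintro rfl
    set i := selectIndex p x
    refine ⟨?_, or_iff_not_imp_right.2 fun h => h4' (by omega)⟩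
    by_cases h0 : i.1 = 0
    · have : Finset.Iio i = ∅ := by
        ext j
        simp only [Finset.mem_Iio, Fin.lt_def, h0]
        simp
      rw [this]; simpa using hx0
    · have : Finset.Iio i = Finset.Iic (⟨i.1 - 1, by omega⟩ : Fin n) := by
        ext j; simp only [Finset.mem_Iio, Finset.mem_Iic, Fin.lt_def, Fin.le_def]; omega
      rw [this]
      exact h3 ⟨i.1 - 1, by omega⟩ (Nat.zero_le _) (by simp only; omega)
  · rintro ⟨h5, h6⟩
    rcases lt_trichotomy (selectIndex p x) i with h | h | h
    · have h7 := h4' (by rw [Fin.lt_def] at h; omega)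
      have h8 : ∑ j ∈ Finset.Iic (selectIndex p x), p j ≤ ∑ j ∈ Finset.Iio i, p j := by
        refine Finset.sum_le_sum_of_subset_of_nonneg (fun j hj => ?_) fun j _ _ => hp0 j
        exact Finset.mem_Iio.2 ((Finset.mem_Iic.1 hj).trans_lt h)
      linarith
    · exact h
    · have h7 := h3 i (Nat.zero_le _) h
      rcases h6 with h6 | h6
      · linarith
      · rw [Fin.lt_def] at h
        omega

theorem volume_selectIndex_eq {p : Fin n → ℝ} (hp0 : ∀ i, 0 ≤ p i) (hp : ∑ i, p i = 1)
    (i : Fin n) :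
    MeasurableSet {x : unitInterval | selectIndex p x = i} ∧
      volume {x : unitInterval | selectIndex p x = i} = ENNReal.ofReal (p i) := by
  have hsum : ∑ j ∈ Finset.Iic i, p j = ∑ j ∈ Finset.Iio i, p j + p i := by
    rw [← Finset.Iio_insert, Finset.sum_insert (by simp), add_comm]
  have ha0 : 0 ≤ ∑ j ∈ Finset.Iio i, p j := Finset.sum_nonneg fun j _ => hp0 j
  have hb1 : ∑ j ∈ Finset.Iic i, p j ≤ 1 := by
    rw [← hp]
    exact Finset.sum_le_sum_of_subset_of_nonneg (Finset.subset_univ _) fun j _ _ => hp0 j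
  have hset : {x : unitInterval | selectIndex p x = i} = {x : unitInterval |
      ∑ j ∈ Finset.Iio i, p j ≤ x ∧ ((x : ℝ) < ∑ j ∈ Finset.Iic i, p j ∨ i.1 = n - 1)} := by
    ext x
    exact selectIndex_eq_iff hp0 x.2.1 i
  set a := ∑ j ∈ Finset.Iio i, p j with ha
  rw [hset, hsum]
  rw [hsum] at hb1
  by_cases hi : i.1 = n - 1
  · have h1 : a + p i = 1 := by
      rw [← hsum, ← hp]
      congr 1
      ext j
      simp only [Finset.mem_Iic, Finset.mem_univ, iff_true, Fin.le_def]
      omega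
    have e : {x : unitInterval | a ≤ x ∧ ((x : ℝ) < a + p i ∨ i.1 = n - 1)} =
        Set.Ici (⟨a, ha0, by linarith [hp0 i]⟩ : unitInterval) := by
      ext x; simp [hi, ← Subtype.coe_le_coe]
    rw [e]
    refine ⟨measurableSet_Ici, ?_⟩
    rw [unitInterval.volume_Ici]
    congr 1
    simp only
    linarith
  · have e : {x : unitInterval | a ≤ x ∧ ((x : ℝ) < a + p i ∨ i.1 = n - 1)} =
        Set.Ico (⟨a, ha0, by linarith [hp0 i]⟩ : unitInterval)
          ⟨a + p i, by linarith [hp0 i], hb1⟩ := by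
      ext x; simp [hi, ← Subtype.coe_le_coe, ← Subtype.coe_lt_coe]
    rw [e]
    refine ⟨measurableSet_Ico, ?_⟩
    rw [unitInterval.volume_Ico]
    congr 1
    simp

/-- The selected indices are independent with the distribution `p`. -/
theorem uniformLaw_selectIndex_eq {p : Fin n → ℝ} (hp0 : ∀ i, 0 ≤ p i) (hp : ∑ i, p i = 1)
    {r : ℕ} (J : Fin r → Fin n) :
    uniformLaw r {u | (fun t => selectIndex p (u t)) = J} = ∏ t, ENNReal.ofReal (p (J t)) := by
  have h : {u : Fin r → unitInterval | (fun t => selectIndex p (u t)) = J} =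
      Set.univ.pi fun t => {x : unitInterval | selectIndex p x = J t} := by
    ext u
    simp [funext_iff, Set.mem_pi]
  rw [h, uniformLaw, Measure.pi_pi]
  exact Finset.prod_congr rfl fun t _ => (volume_selectIndex_eq hp0 hp (J t)).2

/-- The expectation of a function of the selected indices, as a finite sum. -/
theorem lintegral_selectIndex {p : Fin n → ℝ} (hp0 : ∀ i, 0 ≤ p i) (hp : ∑ i, p i = 1)
    {r : ℕ} (f : (Fin r → Fin n) → ℝ≥0∞) :
    ∫⁻ u, f (fun t => selectIndex p (u t)) ∂(uniformLaw r) =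
      ∑ J, f J * ∏ t, ENNReal.ofReal (p (J t)) := by
  have hsel : Measurable fun x : unitInterval => selectIndex p x :=
    measurable_to_countable' fun i => (volume_selectIndex_eq hp0 hp i).1
  have hm : Measurable fun (u : Fin r → unitInterval) t => selectIndex p (u t) :=
    measurable_pi_lambda _ fun t => hsel.comp (measurable_pi_apply t)
  have hf : Measurable f := measurable_of_finite f
  rw [← lintegral_map hf hm, lintegral_fintype]
  refine Finset.sum_congr rfl fun J _ => ?_
  rw [Measure.map_apply hm (measurableSet_singleton J), ← uniformLaw_selectIndex_eq hp0 hp J]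
  rfl

end BinarySearch

/-! ### The values computed by the algorithm -/

section Values

open Matrix

variable {m n k s r : ℕ}

theorem samplingProb_eq_div (Z : Matrix (Fin n) (Fin k) ℝ) :
    samplingProb Z = fun i => (Z i ⬝ᵥ Z i) / ∑ l, Z l ⬝ᵥ Z l := by
  ext i
  simp [samplingProb, frobSq, dotProduct, sq]

variable [NeZero n]

theorem val_chooseFeatures_idx (A : Matrix (Fin m) (Fin n) ℝ) (G : Fin n → Fin s → ℝ)
    (u : Fin r → unitInterval) :
    (chooseFeatures A k G u).val.idx =
      fun t => selectIndex (samplingProb (fastFrobeniusSVD A k G).val) (u t) := by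
  rw [samplingProb_eq_div]
  rfl

theorem val_chooseFeatures_scale (A : Matrix (Fin m) (Fin n) ℝ) (G : Fin n → Fin s → ℝ)
    (u : Fin r → unitInterval) (t : Fin r) :
    (chooseFeatures A k G u).val.scale t =
      1 / √((r : ℝ) * samplingProb (fastFrobeniusSVD A k G).val
        ((chooseFeatures A k G u).val.idx t)) := by
  rw [samplingProb_eq_div]
  rfl

theorem val_featureSelection_eq_mul (A : Matrix (Fin m) (Fin n) ℝ) (G : Fin n → Fin s → ℝ)
    (u : Fin r → unitInterval) :
    (featureSelection A k G u).val = A * (chooseFeatures A k G u).val.samplingMatrix *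
      (chooseFeatures A k G u).val.rescalingMatrix := by
  ext i t
  rw [Sample.rescalingMatrix, Matrix.mul_diagonal, Matrix.mul_apply]
  simp only [Sample.samplingMatrix, Matrix.of_apply, mul_ite, mul_one, mul_zero,
    Finset.sum_ite_eq', Finset.mem_univ, if_true]
  rfl

theorem val_featureSelection (A : Matrix (Fin m) (Fin n) ℝ) (G : Fin n → Fin s → ℝ)
    (u : Fin r → unitInterval) :
    (featureSelection A k G u).val =
      sampledColumns (samplingProb (fastFrobeniusSVD A k G).val) A
        fun t => selectIndex (samplingProb (fastFrobeniusSVD A k G).val) (u t) := by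
  rw [← val_chooseFeatures_idx A G u]
  ext i t
  rw [sampledColumns, Matrix.of_apply, ← val_chooseFeatures_scale]
  rfl

end Values

/-! ### The number of steps -/

section Time

variable {m n k s r : ℕ}

theorem time_dot (x y : Fin n → ℝ) : (dot x y).time = 3 * n := by
  simp [dot, Timed.sum, mul]; ring

theorem time_matMul {p : ℕ} (M : Matrix (Fin m) (Fin n) ℝ) (N : Matrix (Fin n) (Fin p) ℝ) :
    (matMul M N).time = m * (p * (3 * n + 1) + 1) := by
  simp [matMul, matrix, time_dot]

theorem time_removeComponents (Q : List (Fin m → ℝ)) (w : Fin m → ℝ) :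
    (removeComponents Q w).time = Q.length * (6 * m) := by
  induction Q generalizing w with
  | nil => simp [removeComponents]
  | cons q Q ih =>
    simp only [removeComponents, Timed.time_bind, ih, time_dot, List.length_cons]
    simp [array, mul, Timed.sub]
    ring

theorem length_le_length_orthonormalize (Q ys : List (Fin m → ℝ)) :
    Q.length ≤ (orthonormalize Q ys).val.length := by
  induction ys generalizing Q with
  | nil => simp [orthonormalize]
  | cons y ys ih =>
    rw [val_orthonormalize_cons]
    split_ifs
    · exact ih Q
    · refine le_trans ?_ (ih _)
      simp

theorem time_orthonormalize_le (Q ys : List (Fin m → ℝ)) :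
    (orthonormalize Q ys).time ≤
      ys.length * (6 * m * (orthonormalize Q ys).val.length + 5 * m + 2) := by
  induction ys generalizing Q with
  | nil => simp [orthonormalize]
  | cons y ys ih =>
    have hlen := length_le_length_orthonormalize Q (y :: ys)
    rw [val_orthonormalize_cons] at hlen ⊢
    simp only [orthonormalize, Timed.time_bind, Timed.isZero, decide_eq_true_eq,
      Timed.val_dot, dotProduct_self_eq_zero, time_dot, time_removeComponents, List.length_cons]
    split_ifs at hlen ⊢ with h
    · have h1 := ih Q
      nlinarith
    · have h1 := ih ((fun i => (removeComponents Q y).val i /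
        √((removeComponents Q y).val ⬝ᵥ (removeComponents Q y).val)) :: Q)
      simp only [Timed.time_bind, Timed.sqrt, array, Timed.div, Finset.sum_const,
        Finset.card_univ, Fintype.card_fin, smul_eq_mul]
      nlinarith

theorem columnBasis_mul_length_le (A : Matrix (Fin m) (Fin n) ℝ) (N : Matrix (Fin n) (Fin s) ℝ) :
    (columnBasis (A * N)).length ≤ n := by
  refine length_le_of_mem_range A (columnBasis_orthonormal _) ?_
  refine (orthonormalize_spec _ [] isOrthonormalList_nil).2.2.2.1 _ (by simp) ?_
  intro y hy
  obtain ⟨j, rfl⟩ := (List.mem_ofFn' _ _).1 hy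
  exact ⟨fun l => N l j, rfl⟩

/-- The computed basis has at most `min (m, n, s)` members, so that the step counts of Gram-Schmidt
and of the singular value decomposition are of the same order as that of the product `A G`. -/
theorem time_fastFrobeniusSVD_le (hm : 1 ≤ m) (hn : 1 ≤ n) (hk : 1 ≤ k) (hkm : k ≤ m) (hks : k ≤ s)
    (A : Matrix (Fin m) (Fin n) ℝ) (G : Fin n → Fin s → ℝ) :
    (fastFrobeniusSVD A k G).time ≤ 30 * (m * n * s) := by
  set L := (columnBasis (A * Matrix.of G)).length with hL
  have h1 : L ≤ n := columnBasis_mul_length_le A _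
  have h2 : L ≤ m := length_le_of_isOrthonormalList (columnBasis_orthonormal _)
  have h3 : L ≤ s := length_columnBasis_le _
  have h4 : (orthonormalize [] (List.ofFn fun j => fun i => (A * Matrix.of G) i j)).time ≤
      s * (6 * m * L + 5 * m + 2) := by
    have := time_orthonormalize_le [] (List.ofFn fun j => fun i => (A * Matrix.of G) i j)
    rwa [List.length_ofFn] at this
  have htime : (fastFrobeniusSVD A k G).time = n * (2 * s + 1) + (m * (s * (3 * n + 1) + 1) +
      ((orthonormalize [] (List.ofFn fun j => fun i => (A * Matrix.of G) i j)).time +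
        (L * (n * (3 * m + 1) + 1) + (L * n * min L n + n * k ^ 2 + 1)))) := by
    have e1 : (matrix fun i j => draw (G i j)).time = n * (2 * s + 1) := by
      simp only [matrix, draw, Finset.sum_const, Finset.card_univ, Fintype.card_fin, smul_eq_mul]
      ring
    have e2 := time_matMul A (Matrix.of G)
    have e3 : ∀ Q : List (Fin m → ℝ), (matrix fun (a : Fin Q.length) j =>
        dot (Q.get a) (fun i => A i j)).time = Q.length * (n * (3 * m + 1) + 1) := by
      intro Q; simp [matrix, time_dot]
    have e4 : (fastFrobeniusSVD A k G).time = (matrix fun i j => draw (G i j)).time +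
      ((matMul A (Matrix.of G)).time +
      ((orthonormalize [] (List.ofFn fun j => fun i => (A * Matrix.of G) i j)).time +
        ((matrix fun (a : Fin (columnBasis (A * Matrix.of G)).length) j =>
          dot ((columnBasis (A * Matrix.of G)).get a) (fun i => A i j)).time +
          (L * n * min L n + n * k ^ 2 + 1)))) := rfl
    rw [e4, e1, e2, e3]
  rw [htime]
  have hs : 1 ≤ s := hk.trans hks
  have hmin : min L n ≤ m := (min_le_left _ _).trans h2
  -- every summand is at most a multiple of `m n s`
  have a1 : n * s ≤ m * n * s := by
    calc n * s = 1 * (n * s) := by ring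
      _ ≤ m * (n * s) := Nat.mul_le_mul_right _ hm
      _ = _ := by ring
  have a2 : m * s ≤ m * n * s := by
    calc m * s = 1 * (m * s) := by ring
      _ ≤ n * (m * s) := Nat.mul_le_mul_right _ hn
      _ = _ := by ring
  have a3 : n ≤ n * s := Nat.le_mul_of_pos_right _ hs
  have a4 : m ≤ m * s := Nat.le_mul_of_pos_right _ hs
  have a5 : s ≤ m * s := Nat.le_mul_of_pos_left _ hm
  have a6 : s * m * L ≤ m * n * s := by
    calc s * m * L ≤ s * m * n := Nat.mul_le_mul_left _ h1
      _ = _ := by ring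
  have a7 : L * n * m ≤ m * n * s := by
    calc L * n * m ≤ s * n * m := by gcongr
      _ = _ := by ring
  have a8 : L * n ≤ n * s := by
    calc L * n ≤ s * n := by gcongr
      _ = _ := by ring
  have a9 : L * n * min L n ≤ m * n * s := (Nat.mul_le_mul_left _ hmin).trans a7
  have a10 : n * k ^ 2 ≤ m * n * s := by
    calc n * k ^ 2 = k * n * k := by ring
      _ ≤ m * n * s := by gcongr
  have a11 : 1 ≤ n := hn
  nlinarith

theorem time_chooseFeatures_le [NeZero n] (hk : 1 ≤ k) (hkm : k ≤ m)
    (hks : k ≤ s) {b : ℕ} (hb : n ≤ 2 ^ b) (A : Matrix (Fin m) (Fin n) ℝ) (G : Fin n → Fin s → ℝ)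
    (u : Fin r → unitInterval) :
    (chooseFeatures A k G u).time ≤ 40 * (m * n * s) + r * (5 * b + 7) := by
  have hn : 1 ≤ n := Nat.pos_of_ne_zero (NeZero.ne n)
  have h1 := time_fastFrobeniusSVD_le (hk.trans hkm) hn hk hkm hks A G
  set Z := (fastFrobeniusSVD A k G).val with hZ
  have h2 : (chooseFeatures A k G u).time = (fastFrobeniusSVD A k G).time +
      (randomizedSampling Z u).time := rfl
  have h3 : (randomizedSampling Z u).time ≤ n * (3 * k + 7) + r * (5 * b + 7) := by
    have e1 : (array fun i => dot (Z i) (Z i)).time = n * (3 * k + 1) := by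
      simp [array, time_dot]
    have e2 : ∀ rows : Fin n → ℝ, (Timed.sum fun i => (pure (rows i) : Timed ℝ)).time = 2 * n := by
      intro rows; simp [Timed.sum]; ring
    have e3 : ∀ (rows : Fin n → ℝ) (total : ℝ), (array fun i => div (rows i) total).time = 2 * n := by
      intro rows total; simp [array, div]; ring
    have e4 : ∀ p : Fin n → ℝ, (partialSums p).time = 2 * n := fun p => rfl
    have e5 : ∀ F : Fin n → ℝ, (array fun t => do
        let x ← draw (u t)
        let i ← binarySearch F x 0 (n - 1)
        pure (Fin.ofNat n i)).time ≤ r * (5 * b + 3) := by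
      intro F
      have : ∀ t, (do
        let x ← draw (u t)
        let i ← binarySearch F x 0 (n - 1)
        pure (Fin.ofNat n i) : Timed (Fin n)).time + 1 ≤ 5 * b + 3 := by
        intro t
        have := time_binarySearch_le F (u t) b 0 (n - 1) (by omega)
        simp only [Timed.time_bind, Timed.time_pure, draw]
        omega
      calc _ ≤ ∑ _t : Fin r, (5 * b + 3) := Finset.sum_le_sum fun t _ => this t
        _ = _ := by simp
    have e6 : ∀ (p : Fin n → ℝ) (idx : Fin r → Fin n), (array fun t => do
        let a ← mul r (p (idx t))
        let b ← sqrt a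
        div 1 b).time = 4 * r := by
      intro p idx
      simp [array, mul, Timed.sqrt, div]; ring
    simp only [randomizedSampling, Timed.time_bind, Timed.time_pure, e1, e2, e3, e4, e6]
    have e5' := e5 (partialSums (array fun i =>
      div ((array fun i => dot (Z i) (Z i)).val i)
        (Timed.sum fun i => (pure ((array fun i => dot (Z i) (Z i)).val i) : Timed ℝ)).val).val).val
    nlinarith
  have h4 : n * (3 * k + 7) ≤ 10 * (m * n * s) := by
    have : n * k ≤ m * n * s := by
      calc n * k = 1 * (n * k) := by ring
        _ ≤ m * (n * s) := by
          have := hk.trans hkm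
          gcongr
        _ = _ := by ring
    have h5 : n ≤ n * k := Nat.le_mul_of_pos_right _ hk
    nlinarith
  omega

theorem time_featureSelection_eq [NeZero n] (A : Matrix (Fin m) (Fin n) ℝ) (G : Fin n → Fin s → ℝ)
    (u : Fin r → unitInterval) :
    (featureSelection A k G u).time = (chooseFeatures A k G u).time + m * (2 * r + 1) := by
  have h : ∀ S : Sample n r, (matrix fun i t => mul (A i (S.idx t)) (S.scale t)).time =
      m * (2 * r + 1) := by
    intro S
    simp only [matrix, mul, Finset.sum_const, Finset.card_univ, Fintype.card_fin, smul_eq_mul]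
    ring
  rw [featureSelection, Timed.time_bind, h]

end Time

/-! ### Asymptotic bounds -/

section Bounds

variable {k n r : ℕ} {ε : ℝ}

theorem log_two_le_log {k : ℕ} (hk : 2 ≤ k) : Real.log 2 ≤ Real.log k :=
  Real.log_le_log (by norm_num) (by exact_mod_cast hk)

theorem one_le_mul_log (hk : 2 ≤ k) : 1.38 ≤ k * Real.log k := by
  have h1 := log_two_le_log hk
  have h2 := Real.log_two_gt_d9
  have h3 : (2 : ℝ) ≤ k := by exact_mod_cast hk
  nlinarith

theorem numFeatures_le {c₁ : ℝ} (hc : 0 ≤ c₁) (hk : 2 ≤ k) (hε : 0 < ε) (hε1 : ε < 1 / 3) :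
    (numFeatures c₁ k ε : ℝ) ≤ (36 * c₁ + 1) * (k * Real.log k / ε ^ 2) := by
  have hk0 : (0 : ℝ) < k := by exact_mod_cast (by omega : 0 < k)
  have hl := log_two_le_log hk
  have hl0 : 0 < Real.log 2 := Real.log_pos (by norm_num)
  -- `200 ≤ 2 ^ 8 ≤ k ^ 8`
  have h200 : Real.log (200 * k) ≤ 9 * Real.log k := by
    rw [Real.log_mul (by norm_num) hk0.ne']
    have : Real.log 200 ≤ 8 * Real.log 2 := by
      rw [← Real.log_rpow (by norm_num)]
      exact Real.log_le_log (by norm_num) (by norm_num)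
    linarith
  have h200' : 0 ≤ Real.log (200 * k) := Real.log_nonneg (by
    have : (2 : ℝ) ≤ k := by exact_mod_cast hk
    linarith)
  have hQ : 1 ≤ k * Real.log k / ε ^ 2 := by
    rw [le_div_iff₀ (by positivity)]
    have := one_le_mul_log hk
    nlinarith
  have h1 : (numFeatures c₁ k ε : ℝ) < c₁ * (4 * k * Real.log (200 * k)) / ε ^ 2 + 1 :=
    Nat.ceil_lt_add_one (by positivity)
  have h2 : c₁ * (4 * k * Real.log (200 * k)) / ε ^ 2 ≤ 36 * c₁ * (k * Real.log k / ε ^ 2) := by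
    calc c₁ * (4 * k * Real.log (200 * k)) / ε ^ 2
        ≤ c₁ * (4 * k * (9 * Real.log k)) / ε ^ 2 := by gcongr
      _ = _ := by ring
  linarith

theorem gaussianCols_le (hk : 2 ≤ k) (hε : 0 < ε) (hε1 : ε < 1 / 3) :
    (gaussianCols k ε : ℝ) ≤ 2 * (k / ε) := by
  have hk2 : (2 : ℝ) ≤ k := by exact_mod_cast hk
  have h1 : ((⌈(k : ℝ) / ε + 1⌉₊ : ℕ) : ℝ) < k / ε + 1 + 1 := Nat.ceil_lt_add_one (by positivity)
  have h2 : 3 * (k : ℝ) ≤ k / ε := by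
    rw [le_div_iff₀ hε]; nlinarith
  rw [gaussianCols]
  push_cast
  linarith

/-- The running time of the binary searches: `r ln n` is at most `r ln r + n`. -/
theorem mul_log_le (hr : 1 ≤ r) (hn : 1 ≤ n) :
    (r : ℝ) * Real.log n ≤ r * Real.log r + n := by
  have hr0 : (0 : ℝ) < r := by exact_mod_cast hr
  have hn0 : (0 : ℝ) < n := by exact_mod_cast hn
  have h1 : Real.log n = Real.log r + Real.log (n / r) := by
    rw [Real.log_div hn0.ne' hr0.ne']; ring
  have h2 : Real.log (n / r) ≤ n / r := by
    have := Real.log_le_sub_one_of_pos (div_pos hn0 hr0)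
    linarith
  rw [h1, mul_add]
  have h3 := mul_le_mul_of_nonneg_left h2 hr0.le
  rw [mul_div_cancel₀ _ hr0.ne'] at h3
  linarith

theorem one_le_log_mul_log_div (hk : 2 ≤ k) (hε : 0 < ε) (hε1 : ε < 1 / 3) :
    1 ≤ Real.log (k * Real.log k / ε) := by
  have h1 := one_le_mul_log hk
  rw [Real.le_log_iff_exp_le (by positivity)]
  have h2 := Real.exp_one_lt_d9
  rw [le_div_iff₀ hε]
  nlinarith

/-- The logarithm of the number of samples. -/
theorem log_le_of_le_mul {K : ℝ} (hK : 1 ≤ K) (hk : 2 ≤ k) (hε : 0 < ε) (hr : 1 ≤ r)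
    (hrK : (r : ℝ) ≤ K * (k * Real.log k / ε ^ 2)) :
    Real.log r ≤ Real.log K + 2 * Real.log (k * Real.log k / ε) := by
  have h1 := one_le_mul_log hk
  have hr0 : (0 : ℝ) < r := by exact_mod_cast hr
  have h2 : (r : ℝ) ≤ K * (k * Real.log k / ε) ^ 2 := by
    refine hrK.trans (mul_le_mul_of_nonneg_left ?_ (by linarith))
    rw [div_pow]
    gcongr
    nlinarith
  have h3 := Real.log_le_log hr0 h2
  rwa [Real.log_mul (by linarith) (by positivity), Real.log_pow, Nat.cast_ofNat] at h3

/-- The step count of the algorithm, with the constants made explicit. -/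
theorem steps_le_timeBound {m : ℕ} {K : ℝ} (hK : 1 ≤ K) (hm : 1 ≤ m) (hn : 1 ≤ n) (hk : 2 ≤ k)
    (hε : 0 < ε) (hε1 : ε < 1 / 3) (hr : 1 ≤ r) (hrK : (r : ℝ) ≤ K * (k * Real.log k / ε ^ 2)) :
    43 * ((m : ℝ) * n * gaussianCols k ε) + r * (5 * ((Nat.log 2 n + 1 : ℕ) : ℝ) + 7) ≤
      (94 + K * (28 + 8 * Real.log K)) * timeBound m n k ε := by
  have hm0 : (1 : ℝ) ≤ m := by exact_mod_cast hm
  have hn0 : (1 : ℝ) ≤ n := by exact_mod_cast hn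
  have hk0 : (2 : ℝ) ≤ k := by exact_mod_cast hk
  have hr0 : (1 : ℝ) ≤ r := by exact_mod_cast hr
  have hKl : 0 ≤ Real.log K := Real.log_nonneg hK
  have h1 := one_le_mul_log hk
  have hs := gaussianCols_le hk hε hε1
  have hL := one_le_log_mul_log_div hk hε hε1
  have hlr := log_le_of_le_mul hK hk hε hr hrK
  have hrn := mul_log_le hr hn
  set L := Real.log (k * Real.log k / ε) with hLdef
  set Q := k * Real.log k / ε ^ 2 with hQ
  set T := (m : ℝ) * n * k / ε with hT
  have hT' : timeBound m n k ε = T + Q * L := rfl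
  have hQ0 : 0 ≤ Q := by positivity
  have hms : (m : ℝ) * n * gaussianCols k ε ≤ 2 * T := by
    calc (m : ℝ) * n * gaussianCols k ε ≤ m * n * (2 * (k / ε)) := by gcongr
      _ = 2 * T := by rw [hT]; ring
  have hnT : (n : ℝ) ≤ T := by
    rw [hT, le_div_iff₀ hε]
    have h2 : (n : ℝ) * ε ≤ n * 1 := by gcongr; linarith
    have h3 : (n : ℝ) * 1 ≤ m * n * k := by
      calc (n : ℝ) * 1 = 1 * n * 1 := by ring
        _ ≤ m * n * k := by gcongr; linarith
    linarith
  have hlog : ((Nat.log 2 n : ℕ) : ℝ) * 5 ≤ 8 * Real.log n := by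
    have h2 : (2 : ℝ) ^ Nat.log 2 n ≤ n := by exact_mod_cast Nat.pow_log_le_self 2 (by omega)
    have h3 := Real.log_le_log (by positivity) h2
    rw [Real.log_pow] at h3
    have h4 := Real.log_two_gt_d9
    have h5 : (0 : ℝ) ≤ (Nat.log 2 n : ℕ) := Nat.cast_nonneg _
    nlinarith
  have hb : (r : ℝ) * (5 * ((Nat.log 2 n + 1 : ℕ) : ℝ) + 7) ≤ 12 * r + 8 * (r * Real.log n) := by
    push_cast
    nlinarith
  have hrQ : (r : ℝ) ≤ K * (Q * L) := by
    refine hrK.trans ?_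
    have : Q ≤ Q * L := le_mul_of_one_le_right hQ0 hL
    gcongr
  have hrl : (r : ℝ) * Real.log r ≤ K * (Q * L) * (Real.log K + 2) := by
    have h2 : Real.log r ≤ (Real.log K + 2) * L := by nlinarith
    calc (r : ℝ) * Real.log r ≤ (K * Q) * ((Real.log K + 2) * L) := by
          refine mul_le_mul hrK h2 (Real.log_nonneg hr0) (by positivity)
      _ = _ := by ring
  have hT0 : 0 ≤ T := by linarith
  have hQL : 0 ≤ Q * L := by positivity
  have e : (94 + K * (28 + 8 * Real.log K)) * (T + Q * L) =
      94 * T + 12 * (K * (Q * L)) + 8 * (K * (Q * L) * (Real.log K + 2)) +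
        (K * (28 + 8 * Real.log K) * T + 94 * (Q * L)) := by ring
  have h9 : 0 ≤ K * (28 + 8 * Real.log K) * T + 94 * (Q * L) := by positivity
  rw [hT', e]
  linarith

end Bounds

/-! ### The quality of the clustering -/

section Quality

open Matrix

variable {m n k s r : ℕ}

/-- As there are finitely many clusterings, an upper bound of the cost that holds up to an
arbitrarily small increase of `F` holds for `F` itself. -/
theorem exists_gt_forall_cost_le (A : Matrix (Fin m) (Fin n) ℝ) (k : ℕ) (a F : ℝ) :
    ∃ F', F < F' ∧ ∀ X : IndicatorMatrix m k, cost A X.1 ≤ a * F' → cost A X.1 ≤ a * F := by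
  have h : ∀ᶠ F' in nhdsWithin F (Set.Ioi F), ∀ X : IndicatorMatrix m k,
      cost A X.1 ≤ a * F' → cost A X.1 ≤ a * F := by
    rw [Filter.eventually_all]
    intro X
    by_cases hX : cost A X.1 ≤ a * F
    · exact Filter.Eventually.of_forall fun _ _ => hX
    · have hc : Filter.Tendsto (fun F' => a * F') (nhdsWithin F (Set.Ioi F)) (nhds (a * F)) :=
        ((continuous_const.mul continuous_id).tendsto F).mono_left nhdsWithin_le_nhds
      filter_upwards [hc.eventually_lt_const (not_le.1 hX)] with F' h1 h2
      exact absurd h2 (not_le.2 h1)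
  obtain ⟨F', h1, h2⟩ := (h.and self_mem_nhdsWithin).exists
  exact ⟨F', h2, h1⟩

theorem IsApproximation.nonneg {alg : ClusteringAlgorithm m n k} {γ δ : ℝ}
    (halg : IsApproximation alg γ δ) : 0 ≤ δ := by
  have h1 : ENNReal.ofReal (1 - δ) ≤ (alg 0).toOuterMeasure Set.univ :=
    (halg.2 0).trans ((alg 0).toOuterMeasure.mono (Set.subset_univ _))
  rw [(PMF.toOuterMeasure_apply_eq_one_iff _ _).2 (Set.subset_univ _), ENNReal.ofReal_le_one] at h1
  linarith

/-- The success probability for a fixed matrix `Z` of approximate singular vectors. -/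
theorem le_sum_toOuterMeasure {Z : Matrix (Fin n) (Fin k) ℝ} (hk : 1 ≤ k) (hkm : k ≤ m)
    (hZ : Zᵀ * Z = 1) (hr : 1 ≤ r) (A : Matrix (Fin m) (Fin n) ℝ) {ε γ δ F h : ℝ} (hε : 0 < ε)
    (hF : 0 < F) (hF' : optCost A k ≤ F) (hh : 0 ≤ h) (hE : frobSq (A - A * Z * Zᵀ) ≤ F + h)
    {alg : ClusteringAlgorithm m r k} (halg : IsApproximation alg γ δ) (hδ : δ ≤ 1)
    {good : Set (IndicatorMatrix m k)}
    (hgood : ∀ X : IndicatorMatrix m k, cost A X.1 ≤ (1 + (2 + ε) * γ) * F → X ∈ good) :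
    ENNReal.ofReal ((1 - δ) * (1 - (k * Real.exp (-(0.1 ^ 2 * r / (8 * k))) +
        (1.25 * F + 12.5 * (k / r * (F + h)) + h) / ((2 + ε) * F)))) ≤
      ∑ J, (alg (sampledColumns (samplingProb Z) A J)).toOuterMeasure good *
        ∏ t, ENNReal.ofReal (samplingProb Z (J t)) := by
  classical
  have hp0 := samplingProb_nonneg Z
  have hp1 := sum_samplingProb hk hZ
  have hbad := sampleMean_exists_bad_le hk hkm hZ hr A hε halg.1 hF hF' hh hE
  set p := samplingProb Z
  set B := k * Real.exp (-(0.1 ^ 2 * r / (8 * k))) +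
        (1.25 * F + 12.5 * (k / r * (F + h)) + h) / ((2 + ε) * F)
  let bad : (Fin r → Fin n) → Prop := fun J => ∃ X : IndicatorMatrix m k,
        cost (sampledColumns p A J) X.1 ≤ γ * optCost (sampledColumns p A J) k ∧
        ¬ cost A X.1 ≤ (1 + (2 + ε) * γ) * F
  have hbad' : sampleMean p r (fun J => if bad J then 1 else 0) ≤ B := by
    convert hbad
  have hmean : (1 - δ) * (1 - B) ≤
      sampleMean p r (fun J => (1 - δ) * (1 + -1 * if bad J then 1 else 0)) := by
    rw [sampleMean_const_mul, sampleMean_add, sampleMean_const_mul, sampleMean_const hp1]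
    exact mul_le_mul_of_nonneg_left (by linarith) (by linarith)
  refine (ENNReal.ofReal_le_ofReal hmean).trans ?_
  have hnn : ∀ J : Fin r → Fin n, 0 ≤ ∏ t, p (J t) := fun J => Finset.prod_nonneg fun t _ => hp0 _
  rw [sampleMean, ENNReal.ofReal_sum_of_nonneg]
  · refine Finset.sum_le_sum fun J _ => ?_
    rw [ENNReal.ofReal_mul (hnn J), ENNReal.ofReal_prod_of_nonneg (fun t _ => hp0 _), mul_comm]
    refine mul_le_mul_left ?_ _
    by_cases hJ : bad J
    · simp [hJ]
    · have h1 := halg.2 (sampledColumns p A J)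
      simp only [hJ, if_false, mul_zero, add_zero, mul_one]
      refine h1.trans ((alg _).toOuterMeasure.mono fun X hX => hgood X ?_)
      by_contra hX'
      exact hJ ⟨X, hX, hX'⟩
  · intro J _
    refine mul_nonneg (hnn J) (mul_nonneg (by linarith) ?_)
    split_ifs <;> norm_num

instance isProbabilityMeasure_gaussianLaw (n s : ℕ) : IsProbabilityMeasure (gaussianLaw n s) := by
  unfold gaussianLaw
  infer_instance

/-- The success probability is at least `0.2 - δ`, if there are enough Gaussian columns and enough
samples. -/
theorem le_successProb [NeZero n] (hk : 1 ≤ k) (hkm : k ≤ m) (hkn : k ≤ n) (hr : 1 ≤ r)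
    (A : Matrix (Fin m) (Fin n) ℝ) {ε γ δ : ℝ} (hε : 0 < ε) (hε1 : ε < 1 / 3)
    (hks : k + 2 ≤ s) (hs : (k : ℝ) / (s - k - 1) ≤ ε)
    (hexp : k * Real.exp (-(0.1 ^ 2 * r / (8 * k))) ≤ 1 / 200) (hkr : (k : ℝ) / r ≤ 1 / 1000)
    {alg : ClusteringAlgorithm m r k} (halg : IsApproximation alg γ δ) :
    ENNReal.ofReal (0.2 - δ) ≤ successProb A s alg
      {X | cost A X.1 ≤ (1 + (2 + ε) * γ) * optCost A k} := by
  have hδ0 := halg.nonneg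
  rcases lt_or_ge 1 δ with hδ | hδ
  · rw [ENNReal.ofReal_of_nonpos (by linarith)]
    exact zero_le
  obtain ⟨Xo, hXo⟩ := exists_cost_eq_optCost hk hkm A
  have hopt0 : 0 ≤ optCost A k := hXo ▸ cost_nonneg A _
  -- a strictly positive upper bound of the optimal cost
  obtain ⟨F, hFgt, hF⟩ := exists_gt_forall_cost_le A k (1 + (2 + ε) * γ) (optCost A k)
  have hF0 : 0 < F := hopt0.trans_lt hFgt
  obtain ⟨h, hmeas, hh0, hae, hint⟩ := exists_excess_error hk hkn rfl hks A Xo.1 (Xo.1ᵀ * A)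
  have hcost : frobSq (A - Xo.1 * (Xo.1ᵀ * A)) = optCost A k := by
    rw [← hXo, cost, Matrix.mul_assoc]
  rw [hcost] at hint
  simp only [hcost] at hae
  set good : Set (IndicatorMatrix m k) := {X | cost A X.1 ≤ (1 + (2 + ε) * γ) * optCost A k}
  set c : ℝ := (1 - δ) * (1.0125 / ((2 + ε) * F)) with hc
  have hc0 : 0 ≤ c := mul_nonneg (by linarith) (by positivity)
  set c₀ : ℝ := (1 - δ) * (1 - (1 / 200 + 1.2625 / (2 + ε))) with hc₀
  set inner : (Fin n → Fin s → ℝ) → ℝ≥0∞ := fun G =>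
    ∫⁻ u, (alg (featureSelection A k G u).val).toOuterMeasure good ∂uniformLaw r with hinner
  -- Markov's inequality for fixed `G`; the excess error `h G` enters linearly
  have hpt : ∀ᵐ G ∂gaussianLaw n s, ENNReal.ofReal c₀ ≤ inner G + ENNReal.ofReal (c * h G) := by
    filter_upwards [hae] with G hG
    have hZ := fastFrobeniusSVD_orthonormal hkn A G
    set Z := (fastFrobeniusSVD A k G).val with hZdef
    have h1 := le_sum_toOuterMeasure hk hkm hZ hr A hε hF0 hFgt.le (hh0 G) (hG.trans (by linarith))
      halg hδ (good := good) hF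
    have h2 : inner G = ∑ J, (alg (sampledColumns (samplingProb Z) A J)).toOuterMeasure good *
        ∏ t, ENNReal.ofReal (samplingProb Z (J t)) := by
      simp only [hinner, val_featureSelection]
      exact lintegral_selectIndex (samplingProb_nonneg Z) (sum_samplingProb hk hZ)
        fun J => (alg (sampledColumns (samplingProb Z) A J)).toOuterMeasure good
    rw [← h2] at h1
    refine (ENNReal.ofReal_le_ofReal ?_).trans
      ((ENNReal.ofReal_add_le (p := c₀ - c * h G)).trans (add_le_add_left (LE.le.trans
        (ENNReal.ofReal_le_ofReal ?_) h1) _))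
    · linarith
    · have h3 : 12.5 * ((k : ℝ) / r * (F + h G)) ≤ 0.0125 * (F + h G) := by
        have := mul_le_mul_of_nonneg_right hkr (add_nonneg hF0.le (hh0 G))
        linarith
      have h4 : (1.25 * F + 12.5 * ((k : ℝ) / r * (F + h G)) + h G) / ((2 + ε) * F) ≤
          (1.2625 * F + 1.0125 * h G) / ((2 + ε) * F) :=
        div_le_div_of_nonneg_right (by linarith) (by positivity)
      have h5 : (1.2625 * F + 1.0125 * h G) / ((2 + ε) * F) =
          1.2625 / (2 + ε) + 1.0125 / ((2 + ε) * F) * h G := by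
        field_simp
      have h6 : c₀ - c * h G = (1 - δ) *
          (1 - (1 / 200 + (1.2625 / (2 + ε) + 1.0125 / ((2 + ε) * F) * h G))) := by
        rw [hc₀, hc]; ring
      rw [h6]
      refine mul_le_mul_of_nonneg_left ?_ (by linarith)
      linarith
  have hint' : ∫⁻ G, ENNReal.ofReal (c * h G) ∂gaussianLaw n s ≤
      ENNReal.ofReal ((1 - δ) * (1.0125 * ε / (2 + ε))) := by
    simp only [ENNReal.ofReal_mul hc0]
    rw [lintegral_const_mul _ hmeas.ennreal_ofReal]
    refine (mul_le_mul_right hint _).trans ?_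
    rw [← ENNReal.ofReal_mul hc0]
    refine ENNReal.ofReal_le_ofReal ?_
    have hs0 : (0 : ℝ) < s - k - 1 := by
      have : ((k + 2 : ℕ) : ℝ) ≤ s := by exact_mod_cast hks
      push_cast at this
      linarith
    have h1 : optCost A k * ((k : ℝ) / (s - k - 1)) ≤ F * ε := by
      have : (0 : ℝ) ≤ k / (s - k - 1) := by positivity
      gcongr
    calc c * (optCost A k * ((k : ℝ) / (s - k - 1))) ≤ c * (F * ε) :=
          mul_le_mul_of_nonneg_left h1 hc0
      _ = _ := by rw [hc]; field_simp
  have hfinal : ENNReal.ofReal c₀ ≤ successProb A s alg good +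
      ENNReal.ofReal ((1 - δ) * (1.0125 * ε / (2 + ε))) := by
    calc ENNReal.ofReal c₀ = ∫⁻ _, ENNReal.ofReal c₀ ∂gaussianLaw n s := by simp
      _ ≤ ∫⁻ G, inner G + ENNReal.ofReal (c * h G) ∂gaussianLaw n s := lintegral_mono_ae hpt
      -- `inner` need not be measurable, but `h` is
      _ = ∫⁻ G, inner G ∂gaussianLaw n s + ∫⁻ G, ENNReal.ofReal (c * h G) ∂gaussianLaw n s :=
        lintegral_add_right _ (hmeas.const_mul c).ennreal_ofReal
      _ ≤ _ := add_le_add_right hint' _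
  rw [← tsub_le_iff_right, ← ENNReal.ofReal_sub _ (mul_nonneg (by linarith) (by positivity))]
    at hfinal
  refine (ENNReal.ofReal_le_ofReal ?_).trans hfinal
  have h7 : (1.2625 + 1.0125 * ε) / (2 + ε) ≤ 0.7 := by
    rw [div_le_iff₀ (by linarith)]
    linarith
  have h8 : c₀ - (1 - δ) * (1.0125 * ε / (2 + ε)) =
      (1 - δ) * (1 - (1 / 200 + (1.2625 + 1.0125 * ε) / (2 + ε))) := by
    rw [hc₀]; ring
  rw [h8]
  nlinarith

end Quality

/-! ### The choice of the constants -/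

section Constants

variable {k : ℕ} {ε c₁ : ℝ}

theorem le_numFeatures (hc : 100 ≤ c₁) (hk : 2 ≤ k) (hε : 0 < ε) (hε1 : ε < 1 / 3) :
    3600 * (k * Real.log (200 * k)) ≤ numFeatures c₁ k ε := by
  have hk2 : (2 : ℝ) ≤ k := by exact_mod_cast hk
  have hl : 0 ≤ Real.log (200 * k) := Real.log_nonneg (by linarith)
  refine le_trans ?_ (Nat.le_ceil _)
  rw [le_div_iff₀ (by positivity)]
  have h1 : ε ^ 2 ≤ 1 / 9 := by nlinarith
  have h2 : 0 ≤ k * Real.log (200 * k) := by positivity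
  calc 3600 * (k * Real.log (200 * k)) * ε ^ 2 ≤ 3600 * (k * Real.log (200 * k)) * (1 / 9) := by
        gcongr
    _ = 100 * (4 * k * Real.log (200 * k)) := by ring
    _ ≤ _ := by gcongr

theorem one_le_log_mul (hk : 2 ≤ k) : 1 ≤ Real.log (200 * k) := by
  have hk2 : (2 : ℝ) ≤ k := by exact_mod_cast hk
  rw [Real.le_log_iff_exp_le (by positivity)]
  have := Real.exp_one_lt_d9
  linarith

theorem div_numFeatures_le (hc : 100 ≤ c₁) (hk : 2 ≤ k) (hε : 0 < ε) (hε1 : ε < 1 / 3) :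
    (k : ℝ) / numFeatures c₁ k ε ≤ 1 / 1000 := by
  have hk2 : (2 : ℝ) ≤ k := by exact_mod_cast hk
  have h1 := le_numFeatures hc hk hε hε1
  have h2 := one_le_log_mul hk
  have h3 : (k : ℝ) * 1 ≤ k * Real.log (200 * k) := by gcongr
  rw [div_le_iff₀ (by linarith)]
  linarith

theorem mul_exp_numFeatures_le (hc : 100 ≤ c₁) (hk : 2 ≤ k) (hε : 0 < ε) (hε1 : ε < 1 / 3) :
    k * Real.exp (-(0.1 ^ 2 * numFeatures c₁ k ε / (8 * k))) ≤ 1 / 200 := by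
  have hk2 : (2 : ℝ) ≤ k := by exact_mod_cast hk
  have h1 := le_numFeatures hc hk hε hε1
  have h2 := one_le_log_mul hk
  have h3 : Real.log (200 * k) ≤ 0.1 ^ 2 * numFeatures c₁ k ε / (8 * k) := by
    rw [le_div_iff₀ (by positivity)]
    have : (0 : ℝ) ≤ k * Real.log (200 * k) := by positivity
    linarith
  calc k * Real.exp (-(0.1 ^ 2 * numFeatures c₁ k ε / (8 * k)))
      ≤ k * Real.exp (-Real.log (200 * k)) := by gcongr
    _ = 1 / 200 := by
      rw [Real.exp_neg, Real.exp_log (by positivity)]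
      field_simp

theorem add_two_le_gaussianCols (hk : 2 ≤ k) (hε : 0 < ε) : k + 2 ≤ gaussianCols k ε := by
  have : 1 < ⌈(k : ℝ) / ε + 1⌉₊ := by
    rw [Nat.lt_ceil, Nat.cast_one]
    have : (0 : ℝ) < k / ε := by
      have : (0 : ℝ) < k := by exact_mod_cast (by omega : 0 < k)
      positivity
    linarith
  rw [gaussianCols]
  omega

theorem div_gaussianCols_sub_le (hk : 2 ≤ k) (hε : 0 < ε) :
    (k : ℝ) / (gaussianCols k ε - k - 1) ≤ ε := by
  have hk0 : (0 : ℝ) < k := by exact_mod_cast (by omega : 0 < k)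
  have h1 : (k : ℝ) / ε ≤ gaussianCols k ε - k - 1 := by
    have := Nat.le_ceil ((k : ℝ) / ε + 1)
    rw [gaussianCols]
    push_cast
    linarith
  rw [div_le_iff₀ (lt_of_lt_of_le (by positivity) h1)]
  rw [div_le_iff₀ hε] at h1
  linarith

end Constants

/-! ### The bound on the running time -/

theorem time_le_timeBound {m n k : ℕ} [NeZero n] {c₁ ε : ℝ} (hc : 100 ≤ c₁) (hk : 2 ≤ k)
    (hkm : k ≤ m) (hε : 0 < ε) (hε1 : ε < 1 / 3) (A : Matrix (Fin m) (Fin n) ℝ)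
    (G : Fin n → Fin (gaussianCols k ε) → ℝ) (u : Fin (numFeatures c₁ k ε) → unitInterval) :
    ((chooseFeatures A k G u).time : ℝ) ≤
        (94 + (36 * c₁ + 1) * (28 + 8 * Real.log (36 * c₁ + 1))) * timeBound m n k ε ∧
      (numFeatures c₁ k ε ≤ n → ((featureSelection A k G u).time : ℝ) ≤
        (94 + (36 * c₁ + 1) * (28 + 8 * Real.log (36 * c₁ + 1))) * timeBound m n k ε) := by
  have hn : 1 ≤ n := Nat.pos_of_ne_zero (NeZero.ne n)
  have hks := add_two_le_gaussianCols hk hε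
  have hr : 1 ≤ numFeatures c₁ k ε := by
    have h1 := le_numFeatures hc hk hε hε1
    have h2 := one_le_log_mul hk
    have hk2 : (2 : ℝ) ≤ k := by exact_mod_cast hk
    have h3 : (1 : ℝ) ≤ numFeatures c₁ k ε := by nlinarith
    exact_mod_cast h3
  have hb := steps_le_timeBound (by linarith : 1 ≤ 36 * c₁ + 1) (by omega : 1 ≤ m) hn hk hε hε1 hr
    (numFeatures_le (by linarith) hk hε hε1)
  have ht := time_chooseFeatures_le (by omega : 1 ≤ k) hkm (by omega)
    (Nat.lt_pow_succ_log_self one_lt_two n).le A G u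
  rw [Nat.succ_eq_add_one] at ht
  have key : ∀ T : ℕ, T ≤ 43 * (m * n * gaussianCols k ε) +
      numFeatures c₁ k ε * (5 * (Nat.log 2 n + 1) + 7) → (T : ℝ) ≤
        (94 + (36 * c₁ + 1) * (28 + 8 * Real.log (36 * c₁ + 1))) * timeBound m n k ε := by
    intro T hT
    refine le_trans ?_ hb
    exact_mod_cast hT
  refine ⟨key _ (by omega), fun hrn => key _ ?_⟩
  rw [time_featureSelection_eq]
  -- writing down `C` takes `O(m n)` steps, as `r ≤ n`
  have h1 : m * (2 * numFeatures c₁ k ε + 1) ≤ 3 * (m * n * gaussianCols k ε) := by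
    calc m * (2 * numFeatures c₁ k ε + 1) ≤ m * (3 * n * 1) := by gcongr; omega
      _ ≤ m * (3 * n * gaussianCols k ε) := by gcongr; omega
      _ = _ := by ring
  omega

end KMeans

end

theorem mainTheorem1 :
    ∃ c₀ : ℝ, 0 < c₀ ∧ ∀ c₁ : ℝ, c₀ ≤ c₁ → ∃ K : ℝ, 0 < K ∧
      ∀ (m n k : ℕ) [NeZero n] (A : Matrix (Fin m) (Fin n) ℝ) (ε : ℝ),
        2 ≤ k → k ≤ m → k ≤ n → 0 < ε → ε < 1 / 3 →
        -- the number of features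
        (0 < KMeans.numFeatures c₁ k ε ∧
          (KMeans.numFeatures c₁ k ε : ℝ) ≤ K * (k * Real.log k / ε ^ 2)) ∧
        -- the running time, for all outcomes of the random choices
        (∀ (G : Fin n → Fin (KMeans.gaussianCols k ε) → ℝ)
            (u : Fin (KMeans.numFeatures c₁ k ε) → unitInterval),
          ((KMeans.chooseFeatures A k G u).time : ℝ) ≤ K * KMeans.timeBound m n k ε ∧
          (KMeans.numFeatures c₁ k ε ≤ n →
            ((KMeans.featureSelection A k G u).time : ℝ) ≤ K * KMeans.timeBound m n k ε)) ∧
        -- the features are rescaled columns of `A`, sampled with the probabilities given by `Z`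
        (∀ G : Fin n → Fin (KMeans.gaussianCols k ε) → ℝ,
          (∀ J : Fin (KMeans.numFeatures c₁ k ε) → Fin n,
            KMeans.uniformLaw (KMeans.numFeatures c₁ k ε)
                {u | (KMeans.chooseFeatures A k G u).val.idx = J} =
              ∏ t, ENNReal.ofReal
                (KMeans.samplingProb (KMeans.fastFrobeniusSVD A k G).val (J t))) ∧
          ∀ u : Fin (KMeans.numFeatures c₁ k ε) → unitInterval,
            (∀ t, (KMeans.chooseFeatures A k G u).val.scale t =
              1 / √((KMeans.numFeatures c₁ k ε : ℝ) *
                KMeans.samplingProb (KMeans.fastFrobeniusSVD A k G).val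
                  ((KMeans.chooseFeatures A k G u).val.idx t))) ∧
            (KMeans.featureSelection A k G u).val =
              A * (KMeans.chooseFeatures A k G u).val.samplingMatrix *
                (KMeans.chooseFeatures A k G u).val.rescalingMatrix) ∧
        -- the quality of the clustering
        (∀ (γ δ : ℝ) (alg : KMeans.ClusteringAlgorithm m (KMeans.numFeatures c₁ k ε) k),
          KMeans.IsApproximation alg γ δ →
          ENNReal.ofReal (0.2 - δ) ≤
            KMeans.successProb A (KMeans.gaussianCols k ε) alg
              {X | KMeans.cost A X.1 ≤ (1 + (2 + ε) * γ) * KMeans.optCost A k}) := by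
  refine ⟨100, by norm_num, fun c₁ hc => ?_⟩
  have hlog : 0 ≤ Real.log (36 * c₁ + 1) := Real.log_nonneg (by linarith)
  have hK0 : 0 < 94 + (36 * c₁ + 1) * (28 + 8 * Real.log (36 * c₁ + 1)) := by
    have : 0 ≤ c₁ := by linarith
    positivity
  refine ⟨94 + (36 * c₁ + 1) * (28 + 8 * Real.log (36 * c₁ + 1)), hK0, ?_⟩
  intro m n k _ A ε hk hkm hkn hε hε1
  have hk1 : 1 ≤ k := by omega
  have hr : 0 < KMeans.numFeatures c₁ k ε := by
    have h1 := KMeans.le_numFeatures hc hk hε hε1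
    have h2 := KMeans.one_le_log_mul hk
    have hk2 : (2 : ℝ) ≤ k := by exact_mod_cast hk
    have h3 : (0 : ℝ) < KMeans.numFeatures c₁ k ε := by nlinarith
    exact_mod_cast h3
  refine ⟨⟨hr, ?_⟩, KMeans.time_le_timeBound hc hk hkm hε hε1 A, fun G => ⟨fun J => ?_, fun u =>
    ⟨KMeans.val_chooseFeatures_scale A G u, KMeans.val_featureSelection_eq_mul A G u⟩⟩,
    fun γ δ alg halg => ?_⟩
  · refine (KMeans.numFeatures_le (by linarith) hk hε hε1).trans
      (mul_le_mul_of_nonneg_right ?_ ?_)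
    · nlinarith
    · have := KMeans.one_le_mul_log hk
      exact div_nonneg (by linarith) (sq_nonneg _)
  · simp only [KMeans.val_chooseFeatures_idx]
    exact KMeans.uniformLaw_selectIndex_eq (KMeans.samplingProb_nonneg _)
      (KMeans.sum_samplingProb hk1 (KMeans.fastFrobeniusSVD_orthonormal hkn A G)) J
  · exact KMeans.le_successProb hk1 hkm hkn hr A hε hε1 (KMeans.add_two_le_gaussianCols hk hε)
      (KMeans.div_gaussianCols_sub_le hk hε) (KMeans.mul_exp_numFeatures_le hc hk hε hε1)
      (KMeans.div_numFeatures_le hc hk hε hε1) halg
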